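/- Let $\pi:A\to M$ be a pre-Lie algebroid: a smooth vector bundle of finite rank over a smooth manifold, with a smooth bundle map $\rho:A\to TM$ (the anchor) and an antisymmetric $\mathbb{R}$-bilinear bracket on $\Gamma(A)$ such that $[\alpha,f\beta]=f[\alpha,\beta]+\mathcal{L}_{\rho(\alpha)}(f)\beta$ and $\rho([\alpha,\beta])=[\rho(\alpha),\rho(\beta)]$; the Jacobi identity is not required. Let $\mathrm{Jac}\in\mathrm{Hom}(\Lambda^3A,A)$ be the Jacobiator tensor, $\mathrm{Jac}(\alpha,\beta,\gamma)=[[\alpha,\beta],\gamma]+[[\beta,\gamma],\alpha]+[[\gamma,\alpha],\beta]$. Fix an $A$-connection $\overline\nabla$ on $A$. For $a\in A$ let $g_a:I_a\to A$ be the maximal geodesic of $\overline\nabla$ (an $A$-path $g$ with $\overline\nabla_g g=0$) with $g_a(0)=a$, and let $\gamma_a=\pi\circ g_a$. Let $A_0\subset A$ be an open neighborhood of the zero section such that $ta\in A_0$ for all $a\in A_0$, $t\in[0,1]$, and $1\in I_a$ for all $a\in A_0$. Put $\exp(a)=g_a(1)$ and $\tau=\pi\circ\exp$ on $A_0$. Let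 $\Omega^*_\pi(A_0;\tau^*A)$ be the smooth differential forms along the fibres of $\pi$ with values in $\tau^*A$; a $1$-form $\phi$ is written $\phi_a(b)\in A_{\tau(a)}$ for $a\in A_0\cap A_x$, $b\in A_x$. Fix a vector bundle connection $\nabla$ on $A$, let $[\alpha,\beta]_\nabla=[\alpha,\beta]-\nabla_{\rho(\alpha)}\beta+\nabla_{\rho(\beta)}\alpha$, and let $$\mathrm{MC}_\phi=d_{\tau^*\nabla}\phi+\tfrac12[\phi,\phi]_\nabla\in\Omega^2_\pi(A_0;\tau^*A).$$ Let $\phi\in\Omega^1_\pi(A_0;\tau^*A)$ satisfy, for all $x\in M$, $a\in A_0\cap A_x$, $b\in A_x$, $$(\mathrm{MC}_\phi)_a(a,b)=0,\qquad \rho(\phi_a(b))=(d\tau)_a(b),\qquad \phi_a(a)=\exp(a),$$ and suppose that $\phi_a:A_x\to A_{\tau(a)}$ is an isomorphism for every $a\in A_0\cap A_x$. Then $$\mathrm{MC}_\phi=0\ \text{ on } A_0\quad\Longleftrightarrow\quad \mathrm{Jac}=0 .$$ More precisely, let $x\in M$, $a\in A_0\cap A_x$, $b,c\in A_x$, and let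 $\xi$ be any smooth time dependent section of $A$, defined on an open interval containing $[0,1]$, such that $\xi^t(\gamma_a(t))=g_a(t)$ for all $t\in(0,1)$. Let $\psi^{t,s}_\xi:A_{\gamma_a(s)}\to A_{\gamma_a(t)}$, $s,t\in[0,1]$, be its infinitesimal flow along $\gamma_a$: the unique family of linear maps such that $\psi^{u,t}_\xi\psi^{t,s}_\xi=\psi^{u,s}_\xi$, $\psi^{s,s}_\xi=\mathrm{id}$ and $\frac{d}{dt}\big|_{t=s}\psi^{s,t}_\xi\,\alpha(\gamma_a(t))=[\xi^s,\alpha](\gamma_a(s))$ for all $\alpha\in\Gamma(A)$. Then $$\mathrm{Jac}(a,b,c)=-3\,\frac{d}{dt}\Big(\psi^{0,t}_\xi(\mathrm{MC}_\phi)_{ta}(b,c)\Big)\Big|_{t=0},$$ where the derivative (from the right) exists, and $$(\mathrm{MC}_\phi)_a(b,c)=-\int_0^1\psi^{1,t}_\xi\,\mathrm{Jac}\big(\tfrac1t\exp(ta),\phi_{ta}(tb),\phi_{ta}(tc)\big)\,dt .$$ -/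

import Mathlib

open Set Bundle Manifold MeasureTheory
open scoped ContDiff Topology

noncomputable section

namespace PreLie

section Basic

variable (E : Type*) [NormedAddCommGroup E] [NormedSpace ℝ E]
  (F : Type*) [NormedAddCommGroup F] [NormedSpace ℝ F]
  {M : Type*} [TopologicalSpace M] [ChartedSpace E M] [IsManifold 𝓘(ℝ, E) ∞ M]
  (V : M → Type*) [TopologicalSpace (TotalSpace F V)]
  [∀ x, AddCommGroup (V x)] [∀ x, Module ℝ (V x)] [∀ x, TopologicalSpace (V x)]
  [∀ x, IsTopologicalAddGroup (V x)] [∀ x, ContinuousSMul ℝ (V x)]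
  [FiberBundle F V] [VectorBundle ℝ F V]

/-- The space `Γ(A)` of smooth global sections of the vector bundle `A` with fibres `V x`. -/
abbrev Section := ContMDiffSection 𝓘(ℝ, E) F ∞ V

/-- A pre-Lie algebroid structure on the vector bundle with fibres `V x`: a smooth bundle map
`ρ : A → TM` and an antisymmetric `ℝ`-bilinear bracket on `Γ(A)` satisfying the Leibniz rule and
`ρ [α, β] = [ρ α, ρ β]` (Lie bracket of vector fields). The Jacobi identity is not required. -/
structure PreLieAlgebroid where
  anchor : ∀ x : M, V x →ₗ[ℝ] TangentSpace 𝓘(ℝ, E) x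
  contMDiff_anchor : ContMDiff (𝓘(ℝ, E).prod 𝓘(ℝ, F)) 𝓘(ℝ, E).tangent ∞
    (fun p : TotalSpace F V => (⟨p.proj, anchor p.proj p.2⟩ : TangentBundle 𝓘(ℝ, E) M))
  bracket : Section E F V →ₗ[ℝ] Section E F V →ₗ[ℝ] Section E F V
  bracket_antisymm : ∀ α β, bracket α β = - bracket β α
  bracket_leibniz : ∀ (α β γ : Section E F V) (f : M → ℝ), ContMDiff 𝓘(ℝ, E) 𝓘(ℝ, ℝ) ∞ f →
    (∀ x, γ x = f x • β x) →
    ∀ x, bracket α γ x = f x • bracket α β x + (mvfderiv 𝓘(ℝ, E) f x (anchor x (α x))) • β x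
  anchor_bracket : ∀ (α β : Section E F V) (x : M), anchor x (bracket α β x) =
    VectorField.mlieBracket 𝓘(ℝ, E) (fun y => anchor y (α y)) (fun y => anchor y (β y)) x

end Basic

section Aux

variable {E : Type*} [NormedAddCommGroup E] [NormedSpace ℝ E] [FiniteDimensional ℝ E]
  {F : Type*} [NormedAddCommGroup F] [NormedSpace ℝ F]
  {M : Type*} [TopologicalSpace M] [ChartedSpace E M] [T2Space M] [IsManifold 𝓘(ℝ, E) ∞ M]
  {V : M → Type*} [TopologicalSpace (TotalSpace F V)]
  [∀ x, AddCommGroup (V x)] [∀ x, Module ℝ (V x)] [∀ x, TopologicalSpace (V x)]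
  [FiberBundle F V] [VectorBundle ℝ F V] [ContMDiffVectorBundle ∞ F V 𝓘(ℝ, E)]

variable (E F) in
/-- Every vector of a smooth vector bundle is the value of a smooth global section. -/
theorem exists_section {x : M} (v : V x) : ∃ α : Section E F V, α x = v := by
  obtain ⟨s, hs, hsm⟩ := FiberBundle.exists_contMDiffOn_extend (k := ∞) 𝓘(ℝ, E) F v
  obtain ⟨f, -, hf⟩ := (SmoothBumpFunction.nhds_basis_tsupport (I := 𝓘(ℝ, E)) x).mem_iff.1
    (interior_mem_nhds.2 hs)
  refine ⟨⟨fun y => f y • FiberBundle.extend F v y, fun y => ?_⟩, ?_⟩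
  · by_cases hy : y ∈ tsupport f
    · have h1 := (hsm y (interior_subset (hf hy))).contMDiffAt (mem_interior_iff_mem_nhds.1 (hf hy))
      exact (f.contMDiffAt (x := y)).smul_section h1
    · have h0 : ContMDiffAt 𝓘(ℝ, E) (𝓘(ℝ, E).prod 𝓘(ℝ, F)) ∞
          (fun z => TotalSpace.mk' F z (0 : V z)) y :=
        (Bundle.contMDiff_zeroSection ℝ V).contMDiffAt
      refine h0.congr_of_eventuallyEq ?_
      filter_upwards [(isClosed_tsupport f).isOpen_compl.mem_nhds hy] with z hz
      have : f z = 0 := image_eq_zero_of_notMem_tsupport hz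
      simp [this]
  · change f x • FiberBundle.extend F v x = v
    simp

variable (E F) in
/-- A smooth global section with prescribed value `v` at one point. -/
def sectionThrough {x : M} (v : V x) : Section E F V := (exists_section E F v).choose

/-- The identification of two fibres `V x = V y` coming from an equality `x = y` of base points
(and `0` if `x ≠ y`; below it is only used for points that coincide). -/
def fiberCast {x y : M} (v : V x) : V y := by
  classical exact if h : x = y then h ▸ v else 0

/-- The derivative at time `t`, with respect to a connection, of a curve `u` in `A` that lies over
the point `x₀ = π (u t)` at time `t`. Here `D σ` is the derivative at `x₀`, in the direction of the
motion, of the section `σ`. For the time dependent section `ξˢ` (near `x₀`) that is constant in the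
trivialisation at `x₀` for each `s` and satisfies `ξˢ(π (u s)) = u s`, this is the usual expression
`(dξˢ/ds)|ₛ₌ₜ (x₀) + D ξᵗ`. -/
def curveDeriv (x₀ : M) (u : ℝ → TotalSpace F V) (t : ℝ) (D : (∀ y, V y) → V x₀) : V x₀ :=
  (trivializationAt F V x₀).symm x₀ (deriv (fun s => (trivializationAt F V x₀ (u s)).2) t) +
    D (fun y => (trivializationAt F V x₀).symm y (trivializationAt F V x₀ (u t)).2)

/-- `v = ∫₀¹ f(t) dt` for a function with values in a fibre (a finite-dimensional vector space):
each linear functional of `f` is integrable and integrates to the value of the functional at `v`. -/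
def HasFiberIntegral {x : M} (f : ℝ → V x) (v : V x) : Prop :=
  ∀ l : V x →L[ℝ] ℝ, IntervalIntegrable (fun t => l (f t)) volume 0 1 ∧
    ∫ t in (0 : ℝ)..1, l (f t) = l v

end Aux

namespace PreLieAlgebroid

section Theory

variable {E : Type*} [NormedAddCommGroup E] [NormedSpace ℝ E] [FiniteDimensional ℝ E]
  {F : Type*} [NormedAddCommGroup F] [NormedSpace ℝ F]
  {M : Type*} [TopologicalSpace M] [ChartedSpace E M] [T2Space M] [IsManifold 𝓘(ℝ, E) ∞ M]
  {V : M → Type*} [TopologicalSpace (TotalSpace F V)]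
  [∀ x, AddCommGroup (V x)] [∀ x, Module ℝ (V x)] [∀ x, TopologicalSpace (V x)]
  [∀ x, IsTopologicalAddGroup (V x)] [∀ x, ContinuousSMul ℝ (V x)]
  [FiberBundle F V] [VectorBundle ℝ F V] [ContMDiffVectorBundle ∞ F V 𝓘(ℝ, E)]
  (A : PreLieAlgebroid E F V)

/-- The Jacobiator on sections. -/
def jacobiator (α β γ : Section E F V) : Section E F V :=
  A.bracket (A.bracket α β) γ + A.bracket (A.bracket β γ) α + A.bracket (A.bracket γ α) β

/-- The Jacobiator tensor at a point: the Jacobiator is `C^∞(M)`-linear in each argument, so its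
value at `x` depends only on the values `a`, `b`, `c` of the sections at `x`. -/
def jac {x : M} (a b c : V x) : V x :=
  A.jacobiator (sectionThrough E F a) (sectionThrough E F b) (sectionThrough E F c) x

/-- An `A`-connection on `A` itself. As for Mathlib's `CovariantDerivative`, `D σ x v` stands for
`D_v σ` at `x`; `C^∞(M)`-linearity in the direction is built in, and the conditions concern
differentiable (not necessarily globally smooth) sections. -/
structure AConnection where
  toFun : (∀ x, V x) → ∀ x, V x →ₗ[ℝ] V x
  add : ∀ {σ σ' : ∀ x, V x} {x : M},
    MDifferentiableAt 𝓘(ℝ, E) (𝓘(ℝ, E).prod 𝓘(ℝ, F)) (fun y => TotalSpace.mk' F y (σ y)) x →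
    MDifferentiableAt 𝓘(ℝ, E) (𝓘(ℝ, E).prod 𝓘(ℝ, F)) (fun y => TotalSpace.mk' F y (σ' y)) x →
    toFun (fun y => σ y + σ' y) x = toFun σ x + toFun σ' x
  leibniz : ∀ {σ : ∀ x, V x} {f : M → ℝ} {x : M},
    MDifferentiableAt 𝓘(ℝ, E) (𝓘(ℝ, E).prod 𝓘(ℝ, F)) (fun y => TotalSpace.mk' F y (σ y)) x →
    MDifferentiableAt 𝓘(ℝ, E) 𝓘(ℝ, ℝ) f x →
    ∀ v : V x, toFun (fun y => f y • σ y) x v =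
      f x • toFun σ x v + (mvfderiv 𝓘(ℝ, E) f x (A.anchor x v)) • σ x
  contMDiff : ∀ α σ : Section E F V, ContMDiff 𝓘(ℝ, E) (𝓘(ℝ, E).prod 𝓘(ℝ, F)) ∞
    (fun x => TotalSpace.mk' F x (toFun σ x (α x)))

variable {A} in
/-- `g : J → A` is a geodesic: a smooth `A`-path, `ρ(g) = dγ/dt` with `γ = π ∘ g`, such that
the derivative of `g` along itself vanishes. -/
structure IsGeodesicOn (D : A.AConnection) (g : ℝ → TotalSpace F V) (J : Set ℝ) : Prop where
  contMDiffOn : ContMDiffOn 𝓘(ℝ, ℝ) (𝓘(ℝ, E).prod 𝓘(ℝ, F)) ∞ g J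
  isAPath : ∀ t ∈ J, A.anchor (g t).proj (g t).2 =
    mfderiv 𝓘(ℝ, ℝ) 𝓘(ℝ, E) (fun s => (g s).proj) t (1 : ℝ)
  curveDeriv_eq_zero : ∀ t ∈ J,
    curveDeriv (g t).proj g t (fun σ => D.toFun σ (g t).proj (g t).2) = 0

variable {A} in
/-- `g` is a geodesic with `g 0 = a`, defined on an open interval `J` containing `0` and `t`. -/
def IsGeodesicThrough (D : A.AConnection) (a : TotalSpace F V) (t : ℝ)
    (J : Set ℝ) (g : ℝ → TotalSpace F V) : Prop :=
  IsOpen J ∧ J.OrdConnected ∧ 0 ∈ J ∧ t ∈ J ∧ IsGeodesicOn D g J ∧ g 0 = a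

variable {A} in
/-- The domain `I_a` of the maximal geodesic starting at `a`. -/
def geodesicDomain (D : A.AConnection) (a : TotalSpace F V) : Set ℝ :=
  {t | ∃ J g, IsGeodesicThrough D a t J g}

variable {A} in
/-- The maximal geodesic `g_a` with `g_a(0) = a` (geodesics are determined by their initial value,
so the choices made at different times fit together). It has the junk value `a` outside `I_a`. -/
def geodesic (D : A.AConnection) (a : TotalSpace F V) (t : ℝ) : TotalSpace F V := by
  classical exact if h : ∃ J g, IsGeodesicThrough D a t J g then h.choose_spec.choose t else a

variable {A} in
/-- The exponential map `exp a = g_a(1)`. -/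
abbrev exp (D : A.AConnection) (a : TotalSpace F V) : TotalSpace F V := geodesic D a 1

variable {A} in
/-- The target map `τ = π ∘ exp`. -/
abbrev target (D : A.AConnection) (a : TotalSpace F V) : M := (exp D a).proj

variable {A} in
/-- Families of linear maps `φ_a : A_x → A_{τ(a)}`, `a ∈ A_x`; through `T_a(A_x) = A_x` these are
the (not necessarily smooth) foliated `1`-forms with values in `τ^*A`. -/
abbrev OneForm (D : A.AConnection) := ∀ a : TotalSpace F V, V a.proj →ₗ[ℝ] V (target D a)

variable {A} {D : A.AConnection}

/-- `φ ∈ Ω¹_π(A₀; τ^*A)`: the map `(a, b) ↦ φ_a(b)`, `π(a) = π(b)`, `a ∈ A₀`, from the Whitney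
sum `A ⊕ A` (restricted to `A₀`) to `A` is smooth. -/
def IsSmoothOneForm (φ : OneForm D) (A₀ : Set (TotalSpace F V)) : Prop :=
  ContMDiffOn (𝓘(ℝ, E).prod 𝓘(ℝ, F × F)) (𝓘(ℝ, E).prod 𝓘(ℝ, F)) ∞
    (fun p : TotalSpace (F × F) (V ×ᵇ V) =>
      TotalSpace.mk' F (target D ⟨p.proj, p.2.1⟩) (φ ⟨p.proj, p.2.1⟩ p.2.2))
    {p | (⟨p.proj, p.2.1⟩ : TotalSpace F V) ∈ A₀}

/-- The vector `(dτ)_a(b)`, for `a, b ∈ A_x`. -/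
def dTarget (D : A.AConnection) {x : M} (a b : V x) : TangentSpace 𝓘(ℝ, E) (target D ⟨x, a⟩) :=
  mfderiv 𝓘(ℝ, ℝ) 𝓘(ℝ, E) (fun ε : ℝ => target D ⟨x, a + ε • b⟩) 0 (1 : ℝ)

/-- `ρ ∘ φ = dτ` on `A₀`. -/
def IsAnchored (φ : OneForm D) (A₀ : Set (TotalSpace F V)) : Prop :=
  ∀ (x : M) (a b : V x), (⟨x, a⟩ : TotalSpace F V) ∈ A₀ →
    A.anchor (target D ⟨x, a⟩) (φ ⟨x, a⟩ b) = dTarget D a b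

variable (A) in
/-- The torsion tensor `[u, v]_∇ = [α, β] - ∇_{ρ(α)} β + ∇_{ρ(β)} α` at `x`, where `α`, `β` are
sections with values `u`, `v` at `x`. -/
def torsion (nabla : CovariantDerivative 𝓘(ℝ, E) F V) {x : M} (u v : V x) : V x :=
  A.bracket (sectionThrough E F u) (sectionThrough E F v) x
    - nabla (sectionThrough E F v) x (A.anchor x u) + nabla (sectionThrough E F u) x (A.anchor x v)

/-- The derivative at `a ∈ A_x` in direction `b ∈ A_x` of the section `a' ↦ φ_{a'}(c)` of `τ^*A`
over `A_x`, with respect to the pull-back connection `τ^*∇`. -/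
def pullbackDeriv (nabla : CovariantDerivative 𝓘(ℝ, E) F V) (φ : OneForm D) {x : M}
    (a b c : V x) : V (target D ⟨x, a⟩) :=
  curveDeriv (target D ⟨x, a⟩)
    (fun ε : ℝ => TotalSpace.mk' F (target D ⟨x, a + ε • b⟩) (φ ⟨x, a + ε • b⟩ c)) 0
    (fun σ => nabla σ (target D ⟨x, a⟩) (dTarget D a b))

/-- The Maurer-Cartan `2`-form `(MC_φ)_a(b, c) = (d_{τ^*∇} φ + ½ [φ, φ]_∇)_a(b, c)`. The first
two terms are the Koszul formula for the constant (hence commuting) vector fields `b`, `c` on the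
fibre; the remaining ones are half the sum over `(1,1)`-shuffles. -/
def maurerCartan (nabla : CovariantDerivative 𝓘(ℝ, E) F V) (φ : OneForm D) {x : M}
    (a b c : V x) : V (target D ⟨x, a⟩) :=
  (pullbackDeriv nabla φ a b c - pullbackDeriv nabla φ a c b) +
    (1 / 2 : ℝ) • (A.torsion nabla (φ ⟨x, a⟩ b) (φ ⟨x, a⟩ c)
      - A.torsion nabla (φ ⟨x, a⟩ c) (φ ⟨x, a⟩ b))

variable (E F V) in
/-- A (smooth) time dependent section with time interval `J`. -/
def IsTimeDependentSection (J : Set ℝ) (ξ : ℝ → Section E F V) : Prop :=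
  IsOpen J ∧ J.OrdConnected ∧
    ContMDiffOn (𝓘(ℝ, ℝ).prod 𝓘(ℝ, E)) (𝓘(ℝ, E).prod 𝓘(ℝ, F)) ∞
      (fun p : ℝ × M => TotalSpace.mk' F p.2 (ξ p.1 p.2)) (J ×ˢ univ)

variable (A) in
/-- The properties characterising, over times in `[0, 1]`, the infinitesimal flow `ψ^{t,s}_ξ` along
an integral curve `γ` of the time dependent vector field `ρ(ξ)`, for which
`γ(t) = φ^{t,s}_{ρ(ξ)}(γ(s))`. Here `ψ t s` is `ψ^{t,s}_ξ : A_{γ(s)} → A_{γ(t)}`. -/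
structure IsInfinitesimalFlow (ξ : ℝ → Section E F V) (γ : ℝ → M)
    (ψ : ∀ t s : ℝ, V (γ s) →ₗ[ℝ] V (γ t)) : Prop where
  comp : ∀ s ∈ Icc (0 : ℝ) 1, ∀ t ∈ Icc (0 : ℝ) 1, ∀ u ∈ Icc (0 : ℝ) 1,
    ψ u t ∘ₗ ψ t s = ψ u s
  self : ∀ s ∈ Icc (0 : ℝ) 1, ψ s s = LinearMap.id
  hasDeriv : ∀ s ∈ Icc (0 : ℝ) 1, ∀ α : Section E F V,
    HasDerivWithinAt (fun t => ψ s t (α (γ t))) (A.bracket (ξ s) α (γ s)) (Icc 0 1) s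

variable (A) in
/-- The infinitesimal flow of `ξ` along `γ`: the unique family with the properties above. (For an
integral curve `γ` of `ρ(ξ)` it exists and is unique on `[0, 1]`; otherwise `0` is used.) -/
def infinitesimalFlow (ξ : ℝ → Section E F V) (γ : ℝ → M) :
    ∀ t s : ℝ, V (γ s) →ₗ[ℝ] V (γ t) := by
  classical exact if h : ∃ ψ, A.IsInfinitesimalFlow ξ γ ψ then h.choose else fun _ _ => 0

end Theory

end PreLieAlgebroid

end PreLie

end

/-!
Fix `x` and work on the fibre `A_x`, in a linear coordinate. Near the target `τ(a)` choose a local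
frame of `A` and let `c` be the structure functions of the bracket in it, pulled back along `τ`.
Then `φ` becomes a one-form `Φ` on an open subset of a vector space, and the terms containing the
auxiliary connection `∇` cancel: `MC_φ` becomes `dΦ + c(Φ, Φ)` (`coord_maurerCartan`). As `ρ ∘ φ` is
`dτ` and `ρ` preserves brackets, `MC_φ` takes values in the kernel of the anchor
(`anchor_maurerCartan`), and the directional derivatives of `c` are the derivatives of the structure
functions along `ρ ∘ φ`.

Differentiating `dΦ + c(Φ, Φ)` and using that it vanishes on the radial direction gives the radial
part of the Bianchi identity (`fderiv_mcForm_radial`). Along a ray `t ↦ ta` it says that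
`k(t) = MC_{ta}(b, c)` satisfies
`t k' + 2 k + t c(φ_{ta}(a), k) = - t Jac(φ_{ta}(a), φ_{ta}(b), φ_{ta}(c))` (`hasDerivAt_mcForm_ray`).
Rescaling geodesics shows `exp(ta) = t g_a(t)`, and therefore `φ_{ta}(a) = g_a(t)` (`form_radial`).
At `t = 0` the equation gives `k(0) = 0`, and after division by `t` it gives
`3 k'(0) = - Jac(a, b, c)`, since `φ` is the identity on the zero section. After multiplication by
`t` it becomes `(t² k)' + c(g_a, t² k) = - t² Jac(φ_{ta}(a), φ_{ta}(b), φ_{ta}(c))`.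

If `Jac = 0`, this last equation is linear and homogeneous, and uniqueness of solutions gives
`MC_φ = 0`; the converse is the formula for `k'(0)`. For the integral formula, the infinitesimal
flow of `ξ` is constructed by gluing local fundamental solutions of the linear equation `[ξ, ·] = 0`
along `γ_a` (`IsAnchoredCurve.isInfinitesimalFlow`). On the kernel of the anchor `[ξ, ·]` is the
operator `c(g_a, ·)`, so that `ψ^{1,t}_ξ (t² k)` has the derivative
`- ψ^{1,t}_ξ (t² Jac(φ_{ta}(a), φ_{ta}(b), φ_{ta}(c)))`, and the formula is the fundamental theorem
of calculus (`hasFiberIntegral_jac`).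
-/

set_option linter.unusedSectionVars false

noncomputable section

namespace PreLie

variable {E : Type*} [NormedAddCommGroup E] [NormedSpace ℝ E] [FiniteDimensional ℝ E]
  {F : Type*} [NormedAddCommGroup F] [NormedSpace ℝ F] [FiniteDimensional ℝ F]
  {M : Type*} [TopologicalSpace M] [ChartedSpace E M] [T2Space M] [IsManifold 𝓘(ℝ, E) ∞ M]
  {V : M → Type*} [TopologicalSpace (TotalSpace F V)]
  [∀ x, AddCommGroup (V x)] [∀ x, Module ℝ (V x)] [∀ x, TopologicalSpace (V x)]
  [∀ x, IsTopologicalAddGroup (V x)] [∀ x, ContinuousSMul ℝ (V x)]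
  [FiberBundle F V] [VectorBundle ℝ F V] [ContMDiffVectorBundle ∞ F V 𝓘(ℝ, E)]


/-! ### Coordinates and local frames of constant sections -/

variable (F V) in
/-- The linear coordinate `V y → F` given by the trivialisation of the bundle at `m` (it is `0`
outside of the base set of that trivialisation). -/
def coord (m y : M) : V y →L[ℝ] F := (trivializationAt F V m).continuousLinearMapAt ℝ y

variable (F V) in
/-- The inverse coordinate `F → V y` of the trivialisation at `m`. -/
def uncoord (m y : M) : F →L[ℝ] V y := (trivializationAt F V m).symmL ℝ y

theorem coord_apply {m y : M} (hy : y ∈ (trivializationAt F V m).baseSet) (v : V y) :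
    coord F V m y v = (trivializationAt F V m ⟨y, v⟩).2 := by
  simp [coord, Trivialization.continuousLinearMapAt_apply, Trivialization.coe_linearMapAt_of_mem _ hy]

theorem uncoord_apply {m y : M} (hy : y ∈ (trivializationAt F V m).baseSet) (v : F) :
    uncoord F V m y v = (trivializationAt F V m).symm y v :=
  Trivialization.symmL_apply _ hy v

theorem uncoord_coord {m y : M} (hy : y ∈ (trivializationAt F V m).baseSet) (v : V y) :
    uncoord F V m y (coord F V m y v) = v :=
  Trivialization.symmL_continuousLinearMapAt _ hy v

theorem coord_uncoord {m y : M} (hy : y ∈ (trivializationAt F V m).baseSet) (v : F) :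
    coord F V m y (uncoord F V m y v) = v :=
  Trivialization.continuousLinearMapAt_symmL _ hy v

theorem coord_injective {m y : M} (hy : y ∈ (trivializationAt F V m).baseSet) :
    Function.Injective (coord F V m y) :=
  Function.LeftInverse.injective (uncoord_coord hy)

variable (E F V) in
theorem exists_frameBump (m : M) : ∃ f : SmoothBumpFunction 𝓘(ℝ, E) m,
    tsupport f ⊆ (trivializationAt F V m).baseSet := by
  obtain ⟨f, -, hf⟩ := (SmoothBumpFunction.nhds_basis_tsupport (I := 𝓘(ℝ, E)) m).mem_iff.1
    ((trivializationAt F V m).open_baseSet.mem_nhds (FiberBundle.mem_baseSet_trivializationAt' m))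
  exact ⟨f, hf⟩

variable (E F V) in
/-- A bump function at `m` supported where the trivialisation at `m` is defined. -/
def frameBump (m : M) : SmoothBumpFunction 𝓘(ℝ, E) m := (exists_frameBump E F V m).choose

variable (E F V) in
/-- The interior of the set where the bump function `frameBump` at `m` is `1`. The local frame at
`m` is used on this neighbourhood of `m`, where its global sections are constant in the
trivialisation. -/
def frameNhd (m : M) : Set M := interior {y | frameBump E F V m y = 1}

theorem tsupport_frameBump (m : M) :
    tsupport (frameBump E F V m) ⊆ (trivializationAt F V m).baseSet :=
  (exists_frameBump E F V m).choose_spec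

theorem isOpen_frameNhd (m : M) : IsOpen (frameNhd E F V m) := isOpen_interior

theorem mem_frameNhd_self (m : M) : m ∈ frameNhd E F V m :=
  mem_interior_iff_mem_nhds.2 (frameBump E F V m).eventuallyEq_one

theorem frameNhd_mem_nhds {m y : M} (hy : y ∈ frameNhd E F V m) : frameNhd E F V m ∈ 𝓝 y :=
  (isOpen_frameNhd m).mem_nhds hy

theorem frameBump_eq_one {m y : M} (hy : y ∈ frameNhd E F V m) : frameBump E F V m y = 1 :=
  interior_subset (s := {y | frameBump E F V m y = 1}) hy

theorem frameNhd_subset_baseSet (m : M) :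
    frameNhd E F V m ⊆ (trivializationAt F V m).baseSet := fun y hy =>
  tsupport_frameBump (E := E) m (subset_tsupport _ (by simp [frameBump_eq_one hy]))

theorem mem_baseSet {m y : M} (hy : y ∈ frameNhd E F V m) :
    y ∈ (trivializationAt F V m).baseSet := frameNhd_subset_baseSet m hy

theorem frameNhd_subset_source (m : M) :
    frameNhd E F V m ⊆ (extChartAt 𝓘(ℝ, E) m).source := fun y hy => by
  rw [extChartAt_source]
  exact (frameBump E F V m).tsupport_subset_chartAt_source
    (subset_tsupport _ (by simp [frameBump_eq_one hy]))

theorem contMDiffAt_uncoord {m y : M} (hy : y ∈ (trivializationAt F V m).baseSet) (v : F) :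
    ContMDiffAt 𝓘(ℝ, E) (𝓘(ℝ, E).prod 𝓘(ℝ, F)) ∞
      (fun z => TotalSpace.mk' F z (uncoord F V m z v)) y := by
  rw [Trivialization.contMDiffAt_section_iff (trivializationAt F V m) hy]
  refine (contMDiffAt_const (c := v)).congr_of_eventuallyEq ?_
  filter_upwards [(trivializationAt F V m).open_baseSet.mem_nhds hy] with z hz
  rw [← coord_apply hz, coord_uncoord hz]

theorem contMDiffAt_coord {m y : M} (hy : y ∈ (trivializationAt F V m).baseSet)
    (α : Section E F V) :
    ContMDiffAt 𝓘(ℝ, E) 𝓘(ℝ, F) ∞ (fun z => coord F V m z (α z)) y := by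
  refine ((Trivialization.contMDiffAt_section_iff (trivializationAt F V m) hy).1
    (α.contMDiff y)).congr_of_eventuallyEq ?_
  filter_upwards [(trivializationAt F V m).open_baseSet.mem_nhds hy] with z hz
  rw [coord_apply hz]

/-- A section which is smooth near the support of a bump function, multiplied by it. -/
def bumpSection {m : M} (f : SmoothBumpFunction 𝓘(ℝ, E) m) (σ : ∀ y, V y)
    (hσ : ∀ y ∈ tsupport f, ContMDiffAt 𝓘(ℝ, E) (𝓘(ℝ, E).prod 𝓘(ℝ, F)) ∞
      (fun z => TotalSpace.mk' F z (σ z)) y) : Section E F V :=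
  ⟨fun y => f y • σ y, fun y => by
    by_cases hy : y ∈ tsupport f
    · exact (f.contMDiffAt (x := y)).smul_section (hσ y hy)
    · have h0 : ContMDiffAt 𝓘(ℝ, E) (𝓘(ℝ, E).prod 𝓘(ℝ, F)) ∞
          (fun z => TotalSpace.mk' F z (0 : V z)) y :=
        (Bundle.contMDiff_zeroSection ℝ V).contMDiffAt
      refine h0.congr_of_eventuallyEq ?_
      filter_upwards [(isClosed_tsupport f).isOpen_compl.mem_nhds hy] with z hz
      have : f z = 0 := image_eq_zero_of_notMem_tsupport hz
      simp [this]⟩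

variable (E F V) in
/-- The global section which near `m` is constant, equal to `v`, in the trivialisation at `m`. -/
def frame (m : M) : F →ₗ[ℝ] Section E F V where
  toFun v := bumpSection (frameBump E F V m) (fun y => uncoord F V m y v)
    fun _ hy => contMDiffAt_uncoord (tsupport_frameBump m hy) v
  map_add' v w := by
    ext y
    exact (congrArg _ (map_add _ v w)).trans (smul_add _ _ _)
  map_smul' c v := by
    ext y
    exact (congrArg _ (map_smul _ c v)).trans (smul_comm _ _ _)

theorem frame_apply {m y : M} (hy : y ∈ frameNhd E F V m) (v : F) :
    frame E F V m v y = uncoord F V m y v := by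
  change frameBump E F V m y • uncoord F V m y v = _
  rw [frameBump_eq_one hy, one_smul]

theorem coord_frame {m y : M} (hy : y ∈ frameNhd E F V m) (v : F) :
    coord F V m y (frame E F V m v y) = v := by
  rw [frame_apply hy, coord_uncoord (mem_baseSet hy)]

theorem frame_coord {m y : M} (hy : y ∈ frameNhd E F V m) (v : V y) :
    frame E F V m (coord F V m y v) y = v := by
  rw [frame_apply hy, uncoord_coord (mem_baseSet hy)]

theorem section_sum_apply {ι : Type*} (s : Finset ι) (τ : ι → Section E F V) (y : M) :
    (∑ i ∈ s, τ i) y = ∑ i ∈ s, τ i y := by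
  have := map_sum (ContMDiffSection.coeAddHom 𝓘(ℝ, E) F ∞ V) τ s
  exact (congrFun this y).trans (Finset.sum_apply y s fun i => ⇑(τ i))

/-! ### Derivations of sections along a tangent vector -/

/-- `L : Γ(A) → A_x` satisfies the Leibniz rule with respect to the tangent vector `w` at `x`. -/
def IsDerivationAlong {x : M} (w : TangentSpace 𝓘(ℝ, E) x) (L : Section E F V →ₗ[ℝ] V x) : Prop :=
  ∀ (f : M → ℝ), ContMDiff 𝓘(ℝ, E) 𝓘(ℝ, ℝ) ∞ f → ∀ β γ : Section E F V,
    (∀ y, γ y = f y • β y) → L γ = f x • L β + (mvfderiv 𝓘(ℝ, E) f x w) • β x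

theorem mvfderiv_congr {G : Type*} [NormedAddCommGroup G] [NormedSpace ℝ G] {f g : M → G} {x : M}
    (h : f =ᶠ[𝓝 x] g) : mvfderiv 𝓘(ℝ, E) f x = mvfderiv 𝓘(ℝ, E) g x := by
  ext v
  simp only [mvfderiv]
  rw [h.mfderiv_eq]
  rfl

theorem mvfderiv_clm_comp {G G' : Type*} [NormedAddCommGroup G] [NormedSpace ℝ G]
    [NormedAddCommGroup G'] [NormedSpace ℝ G'] (c : G →L[ℝ] G') {s : M → G} {x : M}
    (hs : MDifferentiableAt 𝓘(ℝ, E) 𝓘(ℝ, G) s x) (w : TangentSpace 𝓘(ℝ, E) x) :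
    mvfderiv 𝓘(ℝ, E) (fun y => c (s y)) x w = c (mvfderiv 𝓘(ℝ, E) s x w) := by
  have := mfderiv_comp_apply x (c.contMDiff.mdifferentiableAt (x := s x) (n := 1) (by simp)) hs w
  rw [mfderiv_eq_fderiv, c.fderiv] at this
  exact this

/-- The chain rule for a function on the manifold and a map from a vector space into it. -/
theorem hasFDerivAt_comp_mvfderiv {G W : Type*} [NormedAddCommGroup G] [NormedSpace ℝ G]
    [NormedAddCommGroup W] [NormedSpace ℝ W] {u : W → M} {f : M → G} {p : W}
    (hf : MDifferentiableAt 𝓘(ℝ, E) 𝓘(ℝ, G) f (u p))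
    (hu : MDifferentiableAt 𝓘(ℝ, W) 𝓘(ℝ, E) u p) :
    HasFDerivAt (fun q => f (u q))
      ((mvfderiv 𝓘(ℝ, E) f (u p)).comp (mfderiv 𝓘(ℝ, W) 𝓘(ℝ, E) u p) : W →L[ℝ] G) p :=
  (hf.hasMFDerivAt.comp p hu.hasMFDerivAt).hasFDerivAt

/-- Derivations along a tangent vector are local operators. -/
theorem IsDerivationAlong.congr {x : M} {w : TangentSpace 𝓘(ℝ, E) x}
    {L : Section E F V →ₗ[ℝ] V x} (hL : IsDerivationAlong w L) {α β : Section E F V}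
    (h : ∀ᶠ y in 𝓝 x, α y = β y) : L α = L β := by
  obtain ⟨f, -, hf⟩ := (SmoothBumpFunction.nhds_basis_tsupport (I := 𝓘(ℝ, E)) x).mem_iff.1 h
  have h1 := hL f f.contMDiff (α - β) 0 fun y => by
    by_cases hy : y ∈ tsupport f
    · have : α y = β y := hf hy
      simp [this]
    · simp [image_eq_zero_of_notMem_tsupport hy]
  have h2 : α x = β x := h.self_of_nhds
  simp only [map_zero, SmoothBumpFunction.eq_one, one_smul, ContMDiffSection.coe_sub, Pi.sub_apply, h2,
    sub_self, smul_zero, add_zero, map_sub] at h1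
  exact (sub_eq_zero.1 h1.symm)

/-- A derivation in coordinates: derivative of the coordinates plus a zeroth order term. -/
theorem IsDerivationAlong.coord_eq {m x : M} (hx : x ∈ frameNhd E F V m)
    {w : TangentSpace 𝓘(ℝ, E) x}
    {L : Section E F V →ₗ[ℝ] V x} (hL : IsDerivationAlong w L) (σ : Section E F V) :
    coord F V m x (L σ) = mvfderiv 𝓘(ℝ, E) (fun y => coord F V m y (σ y)) x w +
      coord F V m x (L (frame E F V m (coord F V m x (σ x)))) := by
  set b := Module.finBasis ℝ F
  have hs : ∀ v, ∑ i, b.repr v i • b i = v := b.sum_repr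
  set c : Fin (Module.finrank ℝ F) → F →L[ℝ] ℝ := fun i => (b.coord i).toContinuousLinearMap
  set s : M → F := fun y => coord F V m y (σ y)
  have hsm : ContMDiffAt 𝓘(ℝ, E) 𝓘(ℝ, F) ∞ s x := contMDiffAt_coord (mem_baseSet hx) σ
  have hcs : ∀ i, ContMDiff 𝓘(ℝ, E) 𝓘(ℝ, ℝ) ∞ (fun y => frameBump E F V m y • c i (s y)) := by
    intro i y
    by_cases hy : y ∈ tsupport (frameBump E F V m)
    · exact ((frameBump E F V m).contMDiffAt (x := y)).smul
        ((c i).contMDiff.contMDiffAt.comp y (contMDiffAt_coord (tsupport_frameBump m hy) σ))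
    · refine (contMDiffAt_const (c := (0:ℝ))).congr_of_eventuallyEq ?_
      filter_upwards [(isClosed_tsupport _).isOpen_compl.mem_nhds hy] with z hz
      have : frameBump E F V m z = 0 := image_eq_zero_of_notMem_tsupport hz
      simp [this]
  set τ : Fin (Module.finrank ℝ F) → Section E F V := fun i =>
    ⟨fun y => (frameBump E F V m y • c i (s y)) • frame E F V m (b i) y,
      (hcs i).smul_section (frame E F V m (b i)).contMDiff⟩
  have h1 : L σ = L (∑ i, τ i) := by
    refine hL.congr ?_
    filter_upwards [frameNhd_mem_nhds hx] with y hy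
    rw [section_sum_apply]
    simp only [τ, ContMDiffSection.coeFn_mk, frameBump_eq_one hy, one_smul, frame_apply hy]
    refine (uncoord_coord (mem_baseSet hy) (σ y)).symm.trans ?_
    conv_lhs => rw [← hs (coord F V m y (σ y))]
    simp only [map_sum, map_smul]
    rfl
  have h2 : ∀ i, L (τ i) = c i (s x) • L (frame E F V m (b i)) +
      (c i (mvfderiv 𝓘(ℝ, E) s x w)) • frame E F V m (b i) x := by
    intro i
    rw [hL _ (hcs i) (frame E F V m (b i)) (τ i) fun y => rfl, frameBump_eq_one hx, one_smul]
    congr 2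
    have h3 : (fun y => frameBump E F V m y • c i (s y)) =ᶠ[𝓝 x] fun y => c i (s y) := by
      filter_upwards [frameNhd_mem_nhds hx] with y hy
      rw [frameBump_eq_one hy, one_smul]
    rw [mvfderiv_congr h3]
    exact mvfderiv_clm_comp (c i) (hsm.mdifferentiableAt (by simp)) w
  rw [h1, map_sum, map_sum]
  simp only [h2, map_add, map_smul, coord_frame hx, Finset.sum_add_distrib]
  rw [add_comm]
  congr 1
  · exact hs _
  · conv_rhs => rw [← hs (coord F V m x (σ x))]
    simp only [map_sum, map_smul]
    rfl

/-! ### The Lie bracket of vector fields as a commutator of derivations -/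

/-- `[X, Y] f = X (Y f) - Y (X f)`, for functions with values in a normed space. -/
theorem mvfderiv_mlieBracket {G : Type*} [NormedAddCommGroup G] [NormedSpace ℝ G] {f : M → G}
    {x : M} (hf : ContMDiffAt 𝓘(ℝ, E) 𝓘(ℝ, G) ∞ f x) {X Y : ∀ y : M, TangentSpace 𝓘(ℝ, E) y}
    (hX : MDifferentiableAt 𝓘(ℝ, E) 𝓘(ℝ, E).tangent
      (fun y => (⟨y, X y⟩ : TangentBundle 𝓘(ℝ, E) M)) x)
    (hY : MDifferentiableAt 𝓘(ℝ, E) 𝓘(ℝ, E).tangent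
      (fun y => (⟨y, Y y⟩ : TangentBundle 𝓘(ℝ, E) M)) x) :
    mvfderiv 𝓘(ℝ, E) f x (VectorField.mlieBracket 𝓘(ℝ, E) X Y x) =
      mvfderiv 𝓘(ℝ, E) (fun y => mvfderiv 𝓘(ℝ, E) f y (Y y)) x (X x) -
      mvfderiv 𝓘(ℝ, E) (fun y => mvfderiv 𝓘(ℝ, E) f y (X y)) x (Y x) := by
  have : IsManifold 𝓘(ℝ, E) 2 M := IsManifold.of_le (n := ∞) (by norm_cast)
  have : IsManifold 𝓘(ℝ, E) 1 M := IsManifold.of_le (n := ∞) (by norm_cast)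
  set φ := extChartAt 𝓘(ℝ, E) x with hφ
  set z₀ : E := φ x
  have hφd : ∀ y ∈ φ.source, MDifferentiableAt 𝓘(ℝ, E) 𝓘(ℝ, E) φ y := fun y hy =>
    mdifferentiableAt_extChartAt (by rwa [hφ, extChartAt_source] at hy)
  have hU : φ.symm ⁻¹' univ ∩ range 𝓘(ℝ, E) = univ := by simp
  set fh : E → G := fun z => f (φ.symm z)
  have hfh : ContDiffAt ℝ ∞ fh z₀ := by
    have := (contMDiffAt_iff.1 hf).2
    rw [modelWithCornersSelf_coe, range_id, contDiffWithinAt_univ] at this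
    exact this
  -- the chart expression of a vector field
  set hat : (∀ y : M, TangentSpace 𝓘(ℝ, E) y) → E → E := fun Z =>
    VectorField.mpullbackWithin 𝓘(ℝ, E) 𝓘(ℝ, E) φ.symm Z (range 𝓘(ℝ, E))
  have hhat : ∀ Z : (∀ y : M, TangentSpace 𝓘(ℝ, E) y), MDifferentiableAt 𝓘(ℝ, E) 𝓘(ℝ, E).tangent
      (fun y => (⟨y, Z y⟩ : TangentBundle 𝓘(ℝ, E) M)) x → DifferentiableAt ℝ (hat Z) z₀ := by
    intro Z hZ
    rw [← mdifferentiableWithinAt_univ] at hZ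
    have := hZ.differentiableWithinAt_mpullbackWithin_vectorField
    change DifferentiableWithinAt ℝ (hat Z) (φ.symm ⁻¹' univ ∩ range 𝓘(ℝ, E)) z₀ at this
    rwa [hU, differentiableWithinAt_univ] at this
  have hsrc : ∀ᶠ y in 𝓝 x, y ∈ φ.source := extChartAt_source_mem_nhds (I := 𝓘(ℝ, E)) x
  have hfe : ∀ᶠ y in 𝓝 x, mvfderiv 𝓘(ℝ, E) f y =
      (fderiv ℝ fh (φ y)).comp (mfderiv 𝓘(ℝ, E) 𝓘(ℝ, E) φ y : TangentSpace 𝓘(ℝ, E) y →L[ℝ] E) := by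
    have h1 : ∀ᶠ y in 𝓝 x, DifferentiableAt ℝ fh (φ y) := by
      have h2 : ∀ᶠ z in 𝓝 z₀, DifferentiableAt ℝ fh z :=
        ((hfh.of_le (m := 1) (by norm_cast)).eventually (by simp)).mono
          fun z hz => hz.differentiableAt (by simp)
      exact (continuousAt_extChartAt (I := 𝓘(ℝ, E)) x).eventually h2
    filter_upwards [h1, eventually_eventually_nhds.2 hsrc] with y hy hys
    have h2 : f =ᶠ[𝓝 y] fh ∘ φ := by
      filter_upwards [hys] with y' hy'
      simp [fh, φ.left_inv hy']
    rw [mvfderiv_congr h2]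
    have := (hy.hasFDerivAt.hasMFDerivAt.comp y (hφd y hys.self_of_nhds).hasMFDerivAt).mfderiv
    exact this
  have hZe : ∀ Z : (∀ y : M, TangentSpace 𝓘(ℝ, E) y), ∀ᶠ y in 𝓝 x,
      mfderiv 𝓘(ℝ, E) 𝓘(ℝ, E) φ y (Z y) = hat Z (φ y) := by
    intro Z
    have := VectorField.eventuallyEq_mpullback_mpullbackWithin_extChartAt (I := 𝓘(ℝ, E))
      (s := univ) (x := x) Z
    rw [nhdsWithin_univ] at this
    filter_upwards [this, hsrc] with y hy hys
    rw [hy, VectorField.mpullback_apply]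
    exact (isInvertible_mfderiv_extChartAt hys).self_apply_inverse _
  have hd : ∀ Z W : (∀ y : M, TangentSpace 𝓘(ℝ, E) y), MDifferentiableAt 𝓘(ℝ, E) 𝓘(ℝ, E).tangent
      (fun y => (⟨y, Z y⟩ : TangentBundle 𝓘(ℝ, E) M)) x →
      mvfderiv 𝓘(ℝ, E) (fun y => mvfderiv 𝓘(ℝ, E) f y (Z y)) x (W x) =
        fderiv ℝ (fderiv ℝ fh) z₀ (hat W z₀) (hat Z z₀) +
          fderiv ℝ fh z₀ (fderiv ℝ (hat Z) z₀ (hat W z₀)) := by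
    intro Z W hZ
    have h1 : (fun y => mvfderiv 𝓘(ℝ, E) f y (Z y)) =ᶠ[𝓝 x]
        (fun z => fderiv ℝ fh z (hat Z z)) ∘ φ := by
      filter_upwards [hfe, hZe Z] with y hy hy'
      rw [hy]
      exact congrArg (fderiv ℝ fh (φ y)) hy'
    rw [mvfderiv_congr h1]
    have h2 : DifferentiableAt ℝ (fderiv ℝ fh) z₀ :=
      (hfh.fderiv_right (m := 1) (by norm_cast)).differentiableAt (by simp)
    have h3 := h2.hasFDerivAt.clm_apply (hhat Z hZ).hasFDerivAt
    have := (h3.hasMFDerivAt.comp x (hφd x hsrc.self_of_nhds).hasMFDerivAt).mfderiv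
    have h4 : mvfderiv 𝓘(ℝ, E) ((fun z => fderiv ℝ fh z (hat Z z)) ∘ φ) x (W x) =
      ((fderiv ℝ fh z₀).comp (fderiv ℝ (hat Z) z₀) + (fderiv ℝ (fderiv ℝ fh) z₀).flip (hat Z z₀))
        (mfderiv 𝓘(ℝ, E) 𝓘(ℝ, E) φ x (W x)) := congrArg (fun l => l (W x)) this
    rw [h4, (hZe W).self_of_nhds, add_comm]
    rfl
  rw [hd Y X hY, hd X Y hX, hfe.self_of_nhds]
  have h5 : mfderiv 𝓘(ℝ, E) 𝓘(ℝ, E) φ x (VectorField.mlieBracket 𝓘(ℝ, E) X Y x) =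
      VectorField.lieBracket ℝ (hat X) (hat Y) z₀ := by
    rw [← VectorField.mlieBracketWithin_univ, VectorField.mlieBracketWithin_apply]
    refine ((isInvertible_mfderiv_extChartAt hsrc.self_of_nhds).self_apply_inverse _).trans ?_
    change VectorField.lieBracketWithin ℝ (hat X) (hat Y)
      (φ.symm ⁻¹' univ ∩ range 𝓘(ℝ, E)) z₀ = _
    rw [hU, VectorField.lieBracketWithin_univ]
  have h6 : fderiv ℝ (fderiv ℝ fh) z₀ (hat X z₀) (hat Y z₀) =
      fderiv ℝ (fderiv ℝ fh) z₀ (hat Y z₀) (hat X z₀) :=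
    (hfh.isSymmSndFDerivAt (by simpa using (by norm_cast : (2 : WithTop ℕ∞) ≤ ∞))) _ _
  refine (congrArg (fderiv ℝ fh z₀) h5).trans ?_
  rw [h6, VectorField.lieBracket, map_sub]
  abel

/-- The derivative of `f p : M → G` along a vector `X p` at the point `g p` depends smoothly on
the parameter `p`. -/
theorem contMDiffAt_mvfderiv_apply {G E' N : Type*} [NormedAddCommGroup G] [NormedSpace ℝ G]
    [NormedAddCommGroup E'] [NormedSpace ℝ E'] [TopologicalSpace N] [ChartedSpace E' N]
    [IsManifold 𝓘(ℝ, E') ∞ N] {f : N → M → G} {g : N → M} {p : N}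
    (hf : ContMDiffAt (𝓘(ℝ, E').prod 𝓘(ℝ, E)) 𝓘(ℝ, G) ∞ (Function.uncurry f) (p, g p))
    {X : ∀ q : N, TangentSpace 𝓘(ℝ, E) (g q)}
    (hX : ContMDiffAt 𝓘(ℝ, E') 𝓘(ℝ, E).tangent ∞
      (fun q => (⟨g q, X q⟩ : TangentBundle 𝓘(ℝ, E) M)) p) :
    ContMDiffAt 𝓘(ℝ, E') 𝓘(ℝ, G) ∞ (fun q => mvfderiv 𝓘(ℝ, E) (f q) (g q) (X q)) p := by
  have : IsManifold 𝓘(ℝ, E') 1 N := IsManifold.of_le (n := ∞) (by norm_cast)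
  have : IsManifold 𝓘(ℝ, E) 1 M := IsManifold.of_le (n := ∞) (by norm_cast)
  have : ContMDiffVectorBundle ∞ E (TangentSpace 𝓘(ℝ, E) : M → Type _) 𝓘(ℝ, E) := by
    have : IsManifold 𝓘(ℝ, E) (∞ + 1) M := by simpa using ‹IsManifold 𝓘(ℝ, E) ∞ M›
    infer_instance
  have hg : ContMDiffAt 𝓘(ℝ, E') 𝓘(ℝ, E) ∞ g p := (contMDiffAt_totalSpace.1 hX).1
  have hfg : ContMDiffAt 𝓘(ℝ, E') 𝓘(ℝ, G) ∞ (fun q => f q (g q)) p :=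
    hf.comp p (contMDiffAt_id.prodMk hg)
  have h1 := ContMDiffAt.mfderiv (m := ∞) f g hf hg (by simp)
  have h2 := ContMDiffAt.clm_apply_of_inCoordinates (F₁ := E) (F₂ := G)
    (E₁ := (TangentSpace 𝓘(ℝ, E) : M → Type _)) (E₂ := (TangentSpace 𝓘(ℝ, G) : G → Type _))
    (b₁ := g) (b₂ := fun q => f q (g q))
    (ϕ := fun q => mfderiv 𝓘(ℝ, E) 𝓘(ℝ, G) (f q) (g q)) (v := X) h1 hX hfg
  exact (contMDiff_snd_tangentBundle_modelSpace G 𝓘(ℝ, G)).contMDiffAt.comp p h2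

/-! ### Pre-Lie algebroids in a local frame -/

variable (E F V) in
/-- Evaluation of sections at a point. -/
def evalSection (x : M) : Section E F V →ₗ[ℝ] V x where
  toFun α := α x
  map_add' _ _ := rfl
  map_smul' _ _ := rfl

namespace PreLieAlgebroid

variable (A : PreLieAlgebroid E F V)

theorem contMDiff_anchor_section (α : Section E F V) :
    ContMDiff 𝓘(ℝ, E) 𝓘(ℝ, E).tangent ∞
      (fun x => (⟨x, A.anchor x (α x)⟩ : TangentBundle 𝓘(ℝ, E) M)) :=
  A.contMDiff_anchor.comp α.contMDiff

theorem mdifferentiableAt_anchor_section (α : Section E F V) (x : M) :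
    MDifferentiableAt 𝓘(ℝ, E) 𝓘(ℝ, E).tangent
      (fun x => (⟨x, A.anchor x (α x)⟩ : TangentBundle 𝓘(ℝ, E) M)) x :=
  (A.contMDiff_anchor_section α).mdifferentiable (by simp) x

theorem contMDiffAt_anchor_deriv {G : Type*} [NormedAddCommGroup G] [NormedSpace ℝ G] {f : M → G}
    {x : M} (hf : ContMDiffAt 𝓘(ℝ, E) 𝓘(ℝ, G) ∞ f x) (α : Section E F V) :
    ContMDiffAt 𝓘(ℝ, E) 𝓘(ℝ, G) ∞ (fun y => mvfderiv 𝓘(ℝ, E) f y (A.anchor y (α y))) x :=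
  contMDiffAt_mvfderiv_apply (f := fun _ => f) (g := id)
    (ContMDiffAt.comp (x, x) hf contMDiffAt_snd) (A.contMDiff_anchor_section α x)

theorem isDerivationAlong_bracket (α : Section E F V) (x : M) :
    IsDerivationAlong (A.anchor x (α x)) (evalSection E F V x ∘ₗ A.bracket α) :=
  fun f hf β γ h => A.bracket_leibniz α β γ f hf h x

theorem bracket_apply_antisymm (α β : Section E F V) (x : M) :
    A.bracket α β x = - A.bracket β α x := by
  rw [A.bracket_antisymm]; rfl

/-- `ρ [α, β] f = ρ α (ρ β f) - ρ β (ρ α f)`. -/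
theorem mvfderiv_anchor_bracket {G : Type*} [NormedAddCommGroup G] [NormedSpace ℝ G] {f : M → G}
    {x : M} (hf : ContMDiffAt 𝓘(ℝ, E) 𝓘(ℝ, G) ∞ f x) (α β : Section E F V) :
    mvfderiv 𝓘(ℝ, E) f x (A.anchor x (A.bracket α β x)) =
      mvfderiv 𝓘(ℝ, E) (fun y => mvfderiv 𝓘(ℝ, E) f y (A.anchor y (β y))) x (A.anchor x (α x)) -
      mvfderiv 𝓘(ℝ, E) (fun y => mvfderiv 𝓘(ℝ, E) f y (A.anchor y (α y))) x (A.anchor x (β x)) := by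
  rw [A.anchor_bracket]
  exact mvfderiv_mlieBracket hf (A.mdifferentiableAt_anchor_section α x)
    (A.mdifferentiableAt_anchor_section β x)

/-- The structure functions of the bracket in the local frame at `m`: the coordinates of the
bracket of two frame sections. -/
def structureMap (m y : M) : F →L[ℝ] F →L[ℝ] F :=
  LinearMap.toContinuousBilinearMap
    ((A.bracket.compl₁₂ (frame E F V m) (frame E F V m)).compr₂
      ((coord F V m y).toLinearMap ∘ₗ evalSection E F V y))

theorem structureMap_apply (m y : M) (v w : F) : A.structureMap m y v w =
    coord F V m y (A.bracket (frame E F V m v) (frame E F V m w) y) := rfl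

theorem structureMap_antisymm (m y : M) (v w : F) :
    A.structureMap m y v w = - A.structureMap m y w v := by
  rw [structureMap_apply, bracket_apply_antisymm, map_neg]; rfl

/-- The bracket in the local frame at `m`. -/
theorem coord_bracket {m x : M} (hx : x ∈ frameNhd E F V m) (α β : Section E F V) :
    coord F V m x (A.bracket α β x) =
      mvfderiv 𝓘(ℝ, E) (fun y => coord F V m y (β y)) x (A.anchor x (α x)) -
      mvfderiv 𝓘(ℝ, E) (fun y => coord F V m y (α y)) x (A.anchor x (β x)) +
      A.structureMap m x (coord F V m x (α x)) (coord F V m x (β x)) := by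
  have h1 := (A.isDerivationAlong_bracket α x).coord_eq hx β
  set β' := frame E F V m (coord F V m x (β x))
  have hβ' : β' x = β x := frame_coord hx _
  have h2 := (A.isDerivationAlong_bracket β' x).coord_eq hx α
  simp only [LinearMap.comp_apply] at h1 h2
  change coord F V m x (A.bracket α β x) = _ + coord F V m x (A.bracket α β' x) at h1
  change coord F V m x (A.bracket β' α x) = _ + coord F V m x (A.bracket β' _ x) at h2
  rw [h1, bracket_apply_antisymm, map_neg, h2, hβ', structureMap_antisymm, structureMap_apply]
  abel

theorem contMDiffAt_structureMap_apply {m y : M} (hy : y ∈ frameNhd E F V m) (v w : F) :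
    ContMDiffAt 𝓘(ℝ, E) 𝓘(ℝ, F) ∞ (fun z => A.structureMap m z v w) y :=
  contMDiffAt_coord (mem_baseSet hy) (A.bracket (frame E F V m v) (frame E F V m w))

/-! ### The Jacobiator is a tensor -/

theorem jacobiator_cyclic (α β γ : Section E F V) :
    A.jacobiator α β γ = A.jacobiator β γ α := by
  simp only [jacobiator]; abel

/-- The Jacobiator as a linear map in its last argument. -/
def jacobiatorLeft (α β : Section E F V) : Section E F V →ₗ[ℝ] Section E F V :=
  A.bracket (A.bracket α β) + A.bracket.flip α ∘ₗ A.bracket β + A.bracket.flip β ∘ₗ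
    A.bracket.flip α

theorem jacobiatorLeft_apply (α β γ : Section E F V) :
    A.jacobiatorLeft α β γ = A.jacobiator α β γ := rfl

/-- `C^∞(M)`-linearity of the Jacobiator in its last argument; this is where the anchor has to
preserve brackets. -/
theorem isDerivationAlong_jacobiatorLeft (α β : Section E F V) (x : M) :
    IsDerivationAlong (0 : TangentSpace 𝓘(ℝ, E) x)
      (evalSection E F V x ∘ₗ A.jacobiatorLeft α β) := by
  intro f hf γ fγ h
  have hLα : ContMDiff 𝓘(ℝ, E) 𝓘(ℝ, ℝ) ∞ fun y => mvfderiv 𝓘(ℝ, E) f y (A.anchor y (α y)) :=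
    fun y => A.contMDiffAt_anchor_deriv (hf y) α
  have hLβ : ContMDiff 𝓘(ℝ, E) 𝓘(ℝ, ℝ) ∞ fun y => mvfderiv 𝓘(ℝ, E) f y (A.anchor y (β y)) :=
    fun y => A.contMDiffAt_anchor_deriv (hf y) β
  -- multiplication of a section by a smooth function
  let mul : ∀ g : M → ℝ, ContMDiff 𝓘(ℝ, E) 𝓘(ℝ, ℝ) ∞ g → Section E F V → Section E F V :=
    fun g hg σ => ⟨fun y => g y • σ y, hg.smul_section σ.contMDiff⟩
  have hbr : ∀ (δ σ : Section E F V) (g : M → ℝ) (hg : ContMDiff 𝓘(ℝ, E) 𝓘(ℝ, ℝ) ∞ g),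
      A.bracket δ (mul g hg σ) x = g x • A.bracket δ σ x +
        (mvfderiv 𝓘(ℝ, E) g x (A.anchor x (δ x))) • σ x :=
    fun δ σ g hg => A.bracket_leibniz δ σ (mul g hg σ) g hg (fun y => rfl) x
  have hα : A.bracket α fγ = mul f hf (A.bracket α γ) + mul _ hLα γ := by
    ext y; exact A.bracket_leibniz α γ fγ f hf h y
  have hβ : A.bracket β fγ = mul f hf (A.bracket β γ) + mul _ hLβ γ := by
    ext y; exact A.bracket_leibniz β γ fγ f hf h y
  have e1 : ∀ σ : Section E F V, A.jacobiator α β σ x = A.bracket (A.bracket α β) σ x -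
      A.bracket α (A.bracket β σ) x + A.bracket β (A.bracket α σ) x := by
    intro σ
    rw [jacobiator, A.bracket_antisymm (A.bracket β σ) α, A.bracket_antisymm (A.bracket σ α) β,
      A.bracket_antisymm σ α, map_neg, neg_neg]
    simp only [ContMDiffSection.coe_add, ContMDiffSection.coe_neg, Pi.add_apply, Pi.neg_apply]
    abel
  have e2 := A.mvfderiv_anchor_bracket (hf x) α β
  change A.jacobiator α β fγ x = f x • A.jacobiator α β γ x + (mvfderiv 𝓘(ℝ, E) f x 0) • γ x
  rw [e1, e1, hα, hβ, map_add, map_add, A.bracket_leibniz (A.bracket α β) γ fγ f hf h x, e2,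
    ContMDiffSection.coe_add, ContMDiffSection.coe_add, Pi.add_apply, Pi.add_apply, hbr _ _ _ hf,
    hbr _ _ _ hf, hbr _ _ _ hLα, hbr _ _ _ hLβ, map_zero]
  module

/-- The value of the Jacobiator at a point depends only on the values of the sections there. -/
theorem jacobiator_congr {x : M} {α β γ α' β' γ' : Section E F V} (hα : α x = α' x)
    (hβ : β x = β' x) (hγ : γ x = γ' x) :
    A.jacobiator α β γ x = A.jacobiator α' β' γ' x := by
  have key : ∀ α β γ γ' : Section E F V, γ x = γ' x →
      A.jacobiator α β γ x = A.jacobiator α β γ' x := by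
    intro α β γ γ' h
    have hx := mem_frameNhd_self (E := E) (F := F) (V := V) x
    have h1 := (A.isDerivationAlong_jacobiatorLeft α β x).coord_eq hx γ
    have h2 := (A.isDerivationAlong_jacobiatorLeft α β x).coord_eq hx γ'
    rw [map_zero] at h1 h2
    exact coord_injective (mem_baseSet hx) (h1.trans (h ▸ h2.symm))
  rw [key α β γ γ' hγ, A.jacobiator_cyclic, key β γ' α α' hα, A.jacobiator_cyclic,
    key γ' α' β β' hβ, A.jacobiator_cyclic]

theorem jac_eq {x : M} (α β γ : Section E F V) :
    A.jac (α x) (β x) (γ x) = A.jacobiator α β γ x :=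
  A.jacobiator_congr (exists_section E F (α x)).choose_spec (exists_section E F (β x)).choose_spec
    (exists_section E F (γ x)).choose_spec

theorem coord_jac {m x : M} (hx : x ∈ frameNhd E F V m) (a b c : V x) :
    coord F V m x (A.jac a b c) = coord F V m x (A.jacobiator (frame E F V m (coord F V m x a))
      (frame E F V m (coord F V m x b)) (frame E F V m (coord F V m x c)) x) := by
  rw [← A.jac_eq, frame_coord hx, frame_coord hx, frame_coord hx]

/-- The Jacobiator in terms of the structure functions. -/
theorem coord_jacobiator_frame {m x : M} (hx : x ∈ frameNhd E F V m) (p q r : F) :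
    coord F V m x (A.jacobiator (frame E F V m p) (frame E F V m q) (frame E F V m r) x) =
      (A.structureMap m x (A.structureMap m x p q) r -
        mvfderiv 𝓘(ℝ, E) (fun y => A.structureMap m y p q) x (A.anchor x (frame E F V m r x))) +
      (A.structureMap m x (A.structureMap m x q r) p -
        mvfderiv 𝓘(ℝ, E) (fun y => A.structureMap m y q r) x (A.anchor x (frame E F V m p x))) +
      (A.structureMap m x (A.structureMap m x r p) q -
        mvfderiv 𝓘(ℝ, E) (fun y => A.structureMap m y r p) x (A.anchor x (frame E F V m q x))) := by
  have h1 : ∀ p q r : F, coord F V m x (A.bracket (A.bracket (frame E F V m p) (frame E F V m q))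
      (frame E F V m r) x) = A.structureMap m x (A.structureMap m x p q) r -
        mvfderiv 𝓘(ℝ, E) (fun y => A.structureMap m y p q) x
          (A.anchor x (frame E F V m r x)) := by
    intro p q r
    rw [A.coord_bracket hx, coord_frame hx]
    have h2 : (fun y => coord F V m y (frame E F V m r y)) =ᶠ[𝓝 x] fun _ => r := by
      filter_upwards [frameNhd_mem_nhds hx] with y hy
      exact coord_frame hy r
    have h3 : mvfderiv 𝓘(ℝ, E) (fun _ : M => r) x = 0 := by
      ext; simp [mvfderiv, mfderiv_const]
    rw [mvfderiv_congr h2, h3, ← structureMap_apply]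
    simp only [_root_.zero_apply, zero_sub]
    rw [neg_add_eq_sub]
    rfl
  rw [jacobiator]
  simp only [ContMDiffSection.coe_add, Pi.add_apply, map_add, h1]

end PreLieAlgebroid

/-! ### Connections and derivatives along curves in coordinates -/

/-- The derivative of a curve in the bundle with respect to a connection can be computed in every
local frame, and not only in the one at the base point. -/
theorem curveDeriv_eq {m x₀ : M} (hm : x₀ ∈ frameNhd E F V m) {u : ℝ → TotalSpace F V} {t : ℝ}
    (hu : MDifferentiableAt 𝓘(ℝ, ℝ) (𝓘(ℝ, E).prod 𝓘(ℝ, F)) u t) (hx₀ : (u t).proj = x₀)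
    {w : TangentSpace 𝓘(ℝ, E) x₀}
    (hw : mfderiv 𝓘(ℝ, ℝ) 𝓘(ℝ, E) (fun s => (u s).proj) t (1 : ℝ) = w)
    {L : Section E F V →ₗ[ℝ] V x₀} (hL : IsDerivationAlong w L) {D : (∀ y, V y) → V x₀}
    (hD : ∀ (σ : ∀ y, V y) (α : Section E F V), ContMDiffAt 𝓘(ℝ, E) (𝓘(ℝ, E).prod 𝓘(ℝ, F)) ∞
      (fun z => TotalSpace.mk' F z (σ z)) x₀ → (∀ᶠ y in 𝓝 x₀, σ y = α y) → D σ = L α) :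
    curveDeriv x₀ u t D =
      uncoord F V m x₀ (deriv (fun s => coord F V m (u s).proj (u s).2) t) +
      L (frame E F V m (coord F V m (u t).proj (u t).2)) := by
  subst hx₀
  have hx := mem_frameNhd_self (E := E) (F := F) (V := V) (u t).proj
  have hup : MDifferentiableAt 𝓘(ℝ, ℝ) 𝓘(ℝ, E) (fun s => (u s).proj) t :=
    (contMDiff_proj V (n := 1) (IB := 𝓘(ℝ, E)) |>.mdifferentiable (by simp) (u t)).comp t hu
  have hev : ∀ m, (u t).proj ∈ frameNhd E F V m → ∀ᶠ s in 𝓝 t, (u s).proj ∈ frameNhd E F V m :=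
    fun m hm => hup.continuousAt (frameNhd_mem_nhds hm)
  set uh : ℝ → F := fun s => coord F V m (u s).proj (u s).2
  have huh : DifferentiableAt ℝ uh t := by
    have : MDifferentiableAt 𝓘(ℝ, ℝ) 𝓘(ℝ, F) (fun s => (trivializationAt F V m (u s)).2) t := by
      have h1 : MDifferentiableAt (𝓘(ℝ, E).prod 𝓘(ℝ, F)) 𝓘(ℝ, F)
          (fun z => (trivializationAt F V m z).2) (u t) := by
        have := ((trivializationAt F V m).contMDiffOn (n := ∞) (IB := 𝓘(ℝ, E))).contMDiffAt
          ((trivializationAt F V m).open_source.mem_nhds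
            ((trivializationAt F V m).mem_source.2 (mem_baseSet (E := E) hm)))
        exact (contMDiff_snd.contMDiffAt.comp _ this).mdifferentiableAt (by simp)
      exact h1.comp t hu
    refine this.differentiableAt.congr_of_eventuallyEq ?_
    filter_upwards [hev m hm] with s hs
    exact coord_apply (mem_baseSet hs) _
  set b := Module.finBasis ℝ F
  set c : Fin (Module.finrank ℝ F) → F →L[ℝ] ℝ := fun i => (b.coord i).toContinuousLinearMap
  have hs : ∀ v, ∑ i, c i v • b i = v := b.sum_repr
  set h : Fin (Module.finrank ℝ F) → M → F := fun i y =>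
    coord F V (u t).proj y (frame E F V m (b i) y)
  have hh : ∀ i, MDifferentiableAt 𝓘(ℝ, E) 𝓘(ℝ, F) (h i) (u t).proj := fun i =>
    (contMDiffAt_coord (mem_baseSet hx) _).mdifferentiableAt (by simp)
  have hfr : ∀ v y, coord F V (u t).proj y (frame E F V m v y) = ∑ i, c i v • h i y := by
    intro v y
    have : frame E F V m v y = ∑ i, c i v • frame E F V m (b i) y := by
      conv_lhs => rw [← hs v, map_sum, section_sum_apply]
      simp only [map_smul]
      rfl
    rw [this, map_sum]
    simp only [map_smul]
    rfl
  -- the derivative of the curve in the frame at the base point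
  have hd : HasDerivAt (fun s => (trivializationAt F V (u t).proj (u s)).2)
      (∑ i, (c i (uh t) • mvfderiv 𝓘(ℝ, E) (h i) (u t).proj w +
        c i (deriv uh t) • h i (u t).proj)) t := by
    have h1 : ∀ i, HasDerivAt (fun s => c i (uh s) • h i (u s).proj)
        (c i (uh t) • mvfderiv 𝓘(ℝ, E) (h i) (u t).proj w + c i (deriv uh t) • h i (u t).proj) t := by
      intro i
      have h2 := (hasFDerivAt_comp_mvfderiv (u := fun s => (u s).proj) (hh i) hup).hasDerivAt
      have h3 := ((c i).hasFDerivAt.comp_hasDerivAt t huh.hasDerivAt).smul h2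
      rw [← hw]
      exact h3
    refine (HasDerivAt.fun_sum fun i _ => h1 i).congr_of_eventuallyEq ?_
    filter_upwards [hev m hm, hev (u t).proj hx] with s hs1 hs2
    rw [← hfr, frame_coord hs1, coord_apply (mem_baseSet hs2)]
  have hLf : ∀ v, coord F V (u t).proj (u t).proj (L (frame E F V m v)) =
      ∑ i, c i v • mvfderiv 𝓘(ℝ, E) (h i) (u t).proj w +
        coord F V (u t).proj (u t).proj (L (frame E F V (u t).proj
          (coord F V (u t).proj (u t).proj (frame E F V m v (u t).proj)))) := by
    intro v
    rw [hL.coord_eq hx]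
    congr 1
    have h1 : (fun y => coord F V (u t).proj y (frame E F V m v y)) =
        fun y => (∑ i, c i v • ContinuousLinearMap.proj i : (Fin (Module.finrank ℝ F) → F) →L[ℝ] F)
          (fun i => h i y) := by
      ext y
      rw [hfr, _root_.sum_apply]
      rfl
    have h2 : MDifferentiableAt 𝓘(ℝ, E) 𝓘(ℝ, Fin (Module.finrank ℝ F) → F)
        (fun y i => h i y) (u t).proj :=
      (contMDiffAt_pi_space.2 fun i =>
        contMDiffAt_coord (E := E) (mem_baseSet hx) _).mdifferentiableAt (n := ∞) (by simp)
    rw [h1, mvfderiv_clm_comp _ h2, _root_.sum_apply]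
    refine Finset.sum_congr rfl fun i _ => ?_
    exact congrArg (c i v • ·) (mvfderiv_clm_comp (ContinuousLinearMap.proj i) h2 w).symm
  rw [curveDeriv, hd.deriv, hD _ (frame E F V (u t).proj (trivializationAt F V (u t).proj (u t)).2)]
  · apply coord_injective (mem_baseSet hx)
    have h1 : coord F V (u t).proj (u t).proj (uncoord F V m (u t).proj (deriv uh t)) =
        ∑ i, c i (deriv uh t) • h i (u t).proj := by
      rw [← hfr, frame_apply hm]
    rw [map_add, map_add, h1, hLf, frame_coord hm,
      ← uncoord_apply (mem_baseSet (E := E) hx), coord_uncoord (mem_baseSet (E := E) hx), coord_apply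
        (mem_baseSet (E := E) hx) (u t).2, Finset.sum_add_distrib]
    abel
  · refine (contMDiffAt_uncoord (E := E) (mem_baseSet hx)
      (trivializationAt F V (u t).proj (u t)).2).congr_of_eventuallyEq ?_
    filter_upwards [frameNhd_mem_nhds hx] with y hy
    rw [uncoord_apply (mem_baseSet hy)]
  · filter_upwards [frameNhd_mem_nhds hx] with y hy
    rw [frame_apply hy, uncoord_apply (mem_baseSet hy)]

/-- A covariant derivative in a fixed direction, on global sections. -/
def nablaAt (nabla : CovariantDerivative 𝓘(ℝ, E) F V) (x : M) (w : TangentSpace 𝓘(ℝ, E) x) :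
    Section E F V →ₗ[ℝ] V x where
  toFun α := nabla α x w
  map_add' α β := by
    have := nabla.isCovariantDerivativeOnUniv.add (x := x) α.mdifferentiableAt β.mdifferentiableAt
    exact congrArg (fun l => l w) this
  map_smul' c α := by
    have := nabla.isCovariantDerivativeOnUniv.smul_const (x := x) c α.mdifferentiableAt
    exact congrArg (fun l => l w) this

theorem isDerivationAlong_nablaAt (nabla : CovariantDerivative 𝓘(ℝ, E) F V) (x : M)
    (w : TangentSpace 𝓘(ℝ, E) x) : IsDerivationAlong w (nablaAt nabla x w) := by
  intro f hf β γ h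
  have := nabla.isCovariantDerivativeOnUniv.leibniz (x := x) β.mdifferentiableAt
    (hf.mdifferentiable (by simp) x)
  have hγ : (f • ⇑β : ∀ y, V y) = γ := by ext y; simp [h]
  rw [hγ] at this
  exact congrArg (fun l => l w) this

theorem nablaAt_congr (nabla : CovariantDerivative 𝓘(ℝ, E) F V) (x : M)
    (w : TangentSpace 𝓘(ℝ, E) x) (σ : ∀ y, V y) (α : Section E F V)
    (hσ : ContMDiffAt 𝓘(ℝ, E) (𝓘(ℝ, E).prod 𝓘(ℝ, F)) ∞
      (fun z => TotalSpace.mk' F z (σ z)) x) (h : ∀ᶠ y in 𝓝 x, σ y = α y) :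
    nabla σ x w = nablaAt nabla x w α := by
  have := nabla.isCovariantDerivativeOnUniv.congr_of_eventuallyEq (hσ.mdifferentiableAt (by simp))
    α.mdifferentiableAt Filter.univ_mem h
  exact congrArg (fun l => l w) this

namespace PreLieAlgebroid

variable (A : PreLieAlgebroid E F V)

/-- The torsion tensor in a local frame. -/
theorem coord_torsion (nabla : CovariantDerivative 𝓘(ℝ, E) F V) {m x : M}
    (hx : x ∈ frameNhd E F V m) (u v : V x) :
    coord F V m x (A.torsion nabla u v) =
      A.structureMap m x (coord F V m x u) (coord F V m x v) -
      coord F V m x (nablaAt nabla x (A.anchor x u) (frame E F V m (coord F V m x v))) +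
      coord F V m x (nablaAt nabla x (A.anchor x v) (frame E F V m (coord F V m x u))) := by
  have hu : sectionThrough E F u x = u := (exists_section E F u).choose_spec
  have hv : sectionThrough E F v x = v := (exists_section E F v).choose_spec
  have h1 := (isDerivationAlong_nablaAt nabla x (A.anchor x u)).coord_eq hx (sectionThrough E F v)
  have h2 := (isDerivationAlong_nablaAt nabla x (A.anchor x v)).coord_eq hx (sectionThrough E F u)
  change coord F V m x (A.bracket (sectionThrough E F u) (sectionThrough E F v) x -
    nablaAt nabla x (A.anchor x u) (sectionThrough E F v) +
    nablaAt nabla x (A.anchor x v) (sectionThrough E F u)) = _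
  rw [map_add, map_sub, h1, h2, A.coord_bracket hx, hu, hv]
  abel

variable {A}

/-- An `A`-connection in a fixed direction, on global sections. -/
def AConnection.derivAt (D : A.AConnection) (x : M) (v : V x) : Section E F V →ₗ[ℝ] V x where
  toFun α := D.toFun α x v
  map_add' α β := by
    have := D.add (x := x) α.mdifferentiableAt β.mdifferentiableAt
    exact congrArg (fun l => l v) this
  map_smul' c α := by
    have := D.leibniz (x := x) (f := fun _ => c) α.mdifferentiableAt mdifferentiableAt_const v
    have h3 : mvfderiv 𝓘(ℝ, E) (fun _ : M => c) x = 0 := by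
      ext; simp [mvfderiv, mfderiv_const]
    rw [h3] at this
    refine this.trans ?_
    rw [_root_.zero_apply, zero_smul, add_zero]
    rfl

theorem AConnection.isDerivationAlong_derivAt (D : A.AConnection) (x : M) (v : V x) :
    IsDerivationAlong (A.anchor x v) (D.derivAt x v) := by
  intro f hf β γ h
  have := D.leibniz (x := x) β.mdifferentiableAt (hf.mdifferentiable (by simp) x) v
  have hγ : (fun y => f y • β y) = γ := by ext y; simp [h]
  rw [hγ] at this
  exact this

theorem AConnection.derivAt_congr (D : A.AConnection) (x : M) (v : V x) (σ : ∀ y, V y)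
    (α : Section E F V) (hσ : ContMDiffAt 𝓘(ℝ, E) (𝓘(ℝ, E).prod 𝓘(ℝ, F)) ∞
      (fun z => TotalSpace.mk' F z (σ z)) x) (h : ∀ᶠ y in 𝓝 x, σ y = α y) :
    D.toFun σ x v = D.derivAt x v α := by
  obtain ⟨f, -, hf⟩ := (SmoothBumpFunction.nhds_basis_tsupport (I := 𝓘(ℝ, E)) x).mem_iff.1 h
  have hfσ : (fun y => f y • σ y) = fun y => f y • α y := by
    ext y
    by_cases hy : y ∈ tsupport f
    · have : σ y = α y := hf hy
      rw [this]
    · rw [image_eq_zero_of_notMem_tsupport hy, zero_smul, zero_smul]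
  have hfd : MDifferentiableAt 𝓘(ℝ, E) 𝓘(ℝ, ℝ) f x :=
    f.contMDiff.mdifferentiable (by simp) x
  have h1 := D.leibniz (x := x) (hσ.mdifferentiableAt (by simp)) hfd v
  have h2 := D.leibniz (x := x) α.mdifferentiableAt hfd v
  rw [hfσ, h2, h.self_of_nhds] at h1
  rw [f.eq_one, one_smul, one_smul] at h1
  exact (add_right_cancel h1).symm

end PreLieAlgebroid

/-! ### The Bianchi identity on a vector space -/

section Bianchi

variable {c : F → F →L[ℝ] F →L[ℝ] F} {Φ : F → F →L[ℝ] F}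

/-- The Maurer-Cartan form `dΦ + ½ [Φ, Φ]` of a one-form `Φ` on `F` with respect to a family of
brackets `c`. -/
def mcForm (c : F → F →L[ℝ] F →L[ℝ] F) (Φ : F → F →L[ℝ] F) (p q r : F) : F :=
  fderiv ℝ Φ p q r - fderiv ℝ Φ p r q + c p (Φ p q) (Φ p r)

/-- The Jacobiator of `Φ q`, `Φ r`, `Φ s` for the family of brackets `c`, regarded as brackets of
constant sections: when `Φ` is anchored, the anchor of `Φ s` differentiates structure functions
along the target map as the direction `s` differentiates `c`. -/
def jacForm (c : F → F →L[ℝ] F →L[ℝ] F) (Φ : F → F →L[ℝ] F) (p q r s : F) : F :=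
  (c p (c p (Φ p q) (Φ p r)) (Φ p s) - fderiv ℝ c p s (Φ p q) (Φ p r)) +
  (c p (c p (Φ p r) (Φ p s)) (Φ p q) - fderiv ℝ c p q (Φ p r) (Φ p s)) +
  (c p (c p (Φ p s) (Φ p q)) (Φ p r) - fderiv ℝ c p r (Φ p s) (Φ p q))

set_option synthInstance.maxHeartbeats 200000 in
theorem jacForm_smul_left (t : ℝ) (p q r s : F) :
    jacForm c Φ p (t • q) r s = t • jacForm c Φ p q r s := by
  simp only [jacForm, map_smul, _root_.smul_apply]
  module

set_option synthInstance.maxHeartbeats 200000 in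
theorem jacForm_smul_right (t : ℝ) (p q r s : F) :
    jacForm c Φ p q (t • r) (t • s) = t ^ 2 • jacForm c Φ p q r s := by
  simp only [jacForm, map_smul, _root_.smul_apply]
  module

theorem hasFDerivAt_mcForm {p : F} (hc : DifferentiableAt ℝ c p) (hΦ : ContDiffAt ℝ ∞ Φ p)
    {u v : F → F} {u' v' : F →L[ℝ] F} (hu : HasFDerivAt u u' p) (hv : HasFDerivAt v v' p) :
    ∃ L : F →L[ℝ] F, HasFDerivAt (fun p => mcForm c Φ p (u p) (v p)) L p ∧ ∀ s, L s =
      fderiv ℝ (fderiv ℝ Φ) p s (u p) (v p) - fderiv ℝ (fderiv ℝ Φ) p s (v p) (u p) +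
      (fderiv ℝ c p s (Φ p (u p)) (Φ p (v p)) + c p (fderiv ℝ Φ p s (u p)) (Φ p (v p)) +
        c p (Φ p (u p)) (fderiv ℝ Φ p s (v p))) +
      (mcForm c Φ p (u' s) (v p) + mcForm c Φ p (u p) (v' s)) := by
  have hΦ1 := (hΦ.differentiableAt (by simp)).hasFDerivAt
  have hΦ2 := ((hΦ.fderiv_right (m := 1) (by norm_cast)).differentiableAt (by simp)).hasFDerivAt
  have h1 := (hΦ2.clm_apply hu).clm_apply hv
  have h2 := (hΦ2.clm_apply hv).clm_apply hu
  have h3 := (hc.hasFDerivAt.clm_apply (hΦ1.clm_apply hu)).clm_apply (hΦ1.clm_apply hv)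
  refine ⟨_, (h1.sub h2).add h3, fun s => ?_⟩
  change (fderiv ℝ Φ p (u p) (v' s) +
      (fderiv ℝ Φ p (u' s) + fderiv ℝ (fderiv ℝ Φ) p s (u p)) (v p)) -
    (fderiv ℝ Φ p (v p) (u' s) +
      (fderiv ℝ Φ p (v' s) + fderiv ℝ (fderiv ℝ Φ) p s (v p)) (u p)) +
    (c p (Φ p (u p)) (Φ p (v' s) + fderiv ℝ Φ p s (v p)) +
      (c p (Φ p (u' s) + fderiv ℝ Φ p s (u p)) + fderiv ℝ c p s (Φ p (u p))) (Φ p (v p))) = _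
  have h4 : ∀ x y z, c p (x + y) z = c p x z + c p y z := (c p).map_add₂
  have h5 : ∀ x y z, c p z (x + y) = c p z x + c p z y := fun x y z => (c p z).map_add x y
  have h6 : ∀ z, (c p (Φ p (u' s) + fderiv ℝ Φ p s (u p)) + fderiv ℝ c p s (Φ p (u p))) z =
    c p (Φ p (u' s) + fderiv ℝ Φ p s (u p)) z + fderiv ℝ c p s (Φ p (u p)) z := fun z => rfl
  rw [h6, h4, h5]
  simp only [mcForm]
  change (fderiv ℝ Φ p (u p) (v' s) +
      (fderiv ℝ Φ p (u' s) (v p) + fderiv ℝ (fderiv ℝ Φ) p s (u p) (v p))) -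
    (fderiv ℝ Φ p (v p) (u' s) +
      (fderiv ℝ Φ p (v' s) (u p) + fderiv ℝ (fderiv ℝ Φ) p s (v p) (u p))) + _ = _
  abel

theorem mcForm_antisymm (hanti : ∀ p v w, c p v w = - c p w v) (p q r : F) :
    mcForm c Φ p q r = - mcForm c Φ p r q := by
  simp only [mcForm]
  rw [hanti p (Φ p q)]
  abel

/-- The radial part of the Bianchi identity: if the Maurer-Cartan form vanishes on the radial
vector field, then along rays it satisfies a linear equation whose inhomogeneous term is the
Jacobiator. -/
theorem fderiv_mcForm_radial {p : F} (hanti : ∀ p v w, c p v w = - c p w v)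
    (hc : DifferentiableAt ℝ c p) (hΦ : ContDiffAt ℝ ∞ Φ p)
    (hrad : ∀ᶠ p' in 𝓝 p, ∀ q, mcForm c Φ p' p' q = 0) (r s : F) :
    fderiv ℝ (fun p => mcForm c Φ p r s) p p + (2 : ℝ) • mcForm c Φ p r s +
      c p (Φ p p) (mcForm c Φ p r s) = - jacForm c Φ p p r s := by
  have hsymm : ∀ u v, fderiv ℝ (fderiv ℝ Φ) p u v = fderiv ℝ (fderiv ℝ Φ) p v u :=
    hΦ.isSymmSndFDerivAt (by simpa using (by norm_cast : (2 : WithTop ℕ∞) ≤ ∞))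
  have hzero : ∀ u v, fderiv ℝ (fderiv ℝ Φ) p u p v - fderiv ℝ (fderiv ℝ Φ) p u v p +
      (fderiv ℝ c p u (Φ p p) (Φ p v) + c p (fderiv ℝ Φ p u p) (Φ p v) +
        c p (Φ p p) (fderiv ℝ Φ p u v)) + mcForm c Φ p u v = 0 := by
    intro u v
    obtain ⟨L, hL, hLs⟩ := hasFDerivAt_mcForm hc hΦ (hasFDerivAt_id p) (hasFDerivAt_const v p)
    have h0 : HasFDerivAt (fun p => mcForm c Φ p (id p) v) (0 : F →L[ℝ] F) p :=
      (hasFDerivAt_const (0 : F) p).congr_of_eventuallyEq (hrad.mono fun p' h => h v)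
    have := hLs u
    rw [hL.unique h0] at this
    simp only [_root_.zero_apply, id, ContinuousLinearMap.id_apply] at this
    have h1 : mcForm c Φ p p 0 = 0 := hrad.self_of_nhds 0
    rw [h1, add_zero] at this
    exact this.symm
  obtain ⟨L, hL, hLs⟩ := hasFDerivAt_mcForm hc hΦ (hasFDerivAt_const r p) (hasFDerivAt_const s p)
  have hLp := hLs p
  have h0 : ∀ v, mcForm c Φ p 0 v = 0 ∧ mcForm c Φ p v 0 = 0 := fun v => by simp [mcForm]
  simp only [_root_.zero_apply, (h0 _).1, (h0 _).2, add_zero] at hLp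
  rw [hL.fderiv, hLp, jacForm]
  have e1 := hzero r s
  have e2 := hzero s r
  rw [hsymm r p, hsymm r s] at e1
  rw [hsymm s p, mcForm_antisymm hanti p s r] at e2
  have hanti' : fderiv ℝ c p r (Φ p s) (Φ p p) = - fderiv ℝ c p r (Φ p p) (Φ p s) := by
    have h1 : ∀ v w, HasFDerivAt (fun p => c p v w) _ p := fun v w =>
      (hc.hasFDerivAt.clm_apply (hasFDerivAt_const v p)).clm_apply (hasFDerivAt_const w p)
    have h3 := (h1 (Φ p s) (Φ p p)).unique ((h1 (Φ p p) (Φ p s)).neg.congr_of_eventuallyEq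
      (Filter.Eventually.of_forall fun p' => hanti p' _ _))
    have h4 := congrArg (fun l : F →L[ℝ] F => l r) h3
    change c p (Φ p s) 0 + (c p 0 (Φ p p) + fderiv ℝ c p r (Φ p s) (Φ p p)) =
      - (c p (Φ p p) 0 + (c p 0 (Φ p s) + fderiv ℝ c p r (Φ p p) (Φ p s))) at h4
    have h5 : ∀ z, c p 0 z = 0 := (c p).map_zero₂
    rw [h5, h5, (c p _).map_zero, (c p _).map_zero] at h4
    simpa only [zero_add] using h4
  -- the Maurer-Cartan form vanishes on the radial direction
  have m1 : ∀ v, fderiv ℝ Φ p p v = fderiv ℝ Φ p v p - c p (Φ p p) (Φ p v) := fun v => by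
    have := hrad.self_of_nhds v
    rw [mcForm, sub_add, sub_eq_zero] at this
    exact this
  have f1 : c p (fderiv ℝ Φ p p r) (Φ p s) =
      c p (fderiv ℝ Φ p r p) (Φ p s) - c p (c p (Φ p p) (Φ p r)) (Φ p s) := by
    rw [m1, map_sub]; rfl
  have f2 : c p (Φ p r) (fderiv ℝ Φ p p s) =
      - (c p (fderiv ℝ Φ p s p) (Φ p r) - c p (c p (Φ p p) (Φ p s)) (Φ p r)) := by
    rw [hanti, m1, map_sub]; rfl
  have f3 : c p (Φ p p) (mcForm c Φ p r s) = c p (Φ p p) (fderiv ℝ Φ p r s) -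
      c p (Φ p p) (fderiv ℝ Φ p s r) + c p (Φ p p) (c p (Φ p r) (Φ p s)) := by
    rw [mcForm, map_add, map_sub]
  have f5 : c p (c p (Φ p s) (Φ p p)) (Φ p r) = - c p (c p (Φ p p) (Φ p s)) (Φ p r) := by
    rw [hanti p (Φ p s), map_neg]; rfl
  rw [f1, f2, f3, f5, hanti', hanti p (c p (Φ p r) (Φ p s))]
  linear_combination (norm := module) e1 - e2

end Bianchi

/-! ### A foliated one-form in coordinates -/

variable (F V) in
/-- The linear parametrisation of the fibre over `x`, as a map into the total space. -/
def fibrePt (x : M) (p : F) : TotalSpace F V := ⟨x, uncoord F V x x p⟩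

theorem mem_baseSet_self (x : M) : x ∈ (trivializationAt F V x).baseSet :=
  FiberBundle.mem_baseSet_trivializationAt' x

/-- Smoothness of a map into the bundle in terms of a local coordinate. -/
theorem contMDiffAt_iff_coord {E' H N : Type*} [NormedAddCommGroup E'] [NormedSpace ℝ E']
    [TopologicalSpace H] {I : ModelWithCorners ℝ E' H}
    [TopologicalSpace N] [ChartedSpace H N] {m : M} {u : N → TotalSpace F V} {p : N}
    (hm : (u p).proj ∈ (trivializationAt F V m).baseSet) :
    ContMDiffAt I (𝓘(ℝ, E).prod 𝓘(ℝ, F)) ∞ u p ↔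
      ContMDiffAt I 𝓘(ℝ, E) ∞ (fun q => (u q).proj) p ∧
      ContMDiffAt I 𝓘(ℝ, F) ∞ (fun q => coord F V m (u q).proj (u q).2) p := by
  rw [Trivialization.contMDiffAt_iff (e := trivializationAt F V m)
    ((trivializationAt F V m).mem_source.2 hm)]
  refine and_congr_right fun h => ?_
  have : (fun q => coord F V m (u q).proj (u q).2) =ᶠ[𝓝 p]
      fun q => (trivializationAt F V m (u q)).2 := by
    filter_upwards [h.continuousAt ((trivializationAt F V m).open_baseSet.mem_nhds hm)] with q hq
    exact coord_apply hq _
  exact ⟨fun h' => h'.congr_of_eventuallyEq this, fun h' => h'.congr_of_eventuallyEq this.symm⟩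

theorem contMDiff_fibrePt_prod (x : M) (b : V x) :
    ContMDiff 𝓘(ℝ, F) (𝓘(ℝ, E).prod 𝓘(ℝ, F × F)) ∞
      (fun p => (⟨x, (uncoord F V x x p, b)⟩ : TotalSpace (F × F) (V ×ᵇ V))) := fun p => by
  rw [contMDiffAt_totalSpace]
  refine ⟨contMDiffAt_const, ?_⟩
  have h : (fun p => (trivializationAt (F × F) (V ×ᵇ V) x
      (⟨x, (uncoord F V x x p, b)⟩ : TotalSpace (F × F) (V ×ᵇ V))).2) =
      fun p => (p, coord F V x x b) := by
    ext1 p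
    change ((trivializationAt F V x ⟨x, uncoord F V x x p⟩).2, (trivializationAt F V x ⟨x, b⟩).2) = _
    rw [← coord_apply (mem_baseSet_self x), coord_uncoord (mem_baseSet_self x),
      ← coord_apply (mem_baseSet_self x)]
  refine ContMDiffAt.congr_of_eventuallyEq (f := fun p => (p, coord F V x x b)) ?_
    (Filter.Eventually.of_forall fun p => congrFun h p)
  exact (contDiff_id.prodMk contDiff_const).contMDiff.contMDiffAt

/-- The points of the fibre over `x` which lie in `A₀`. -/
def fibreDomain (A₀ : Set (TotalSpace F V)) (x : M) : Set F := fibrePt F V x ⁻¹' A₀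

theorem isOpen_fibreDomain {A₀ : Set (TotalSpace F V)} (h : IsOpen A₀) (x : M) :
    IsOpen (fibreDomain A₀ x) :=
  h.preimage ((FiberBundle.totalSpaceMk_isInducing F V x).continuous.comp (uncoord F V x x).continuous)

namespace PreLieAlgebroid

variable {A : PreLieAlgebroid E F V} {D : A.AConnection} {φ : OneForm D}
  {A₀ : Set (TotalSpace F V)}

/-- The target map on the fibre over `x`. -/
def fibreTarget (D : A.AConnection) (x : M) (p : F) : M := target D (fibrePt F V x p)

/-- The one-form `φ` on the fibre over `x`, in the coordinates of the fibre and in the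
trivialisation at `m`. -/
def formCoord (φ : OneForm D) (m x : M) (p : F) : F →L[ℝ] F :=
  LinearMap.toContinuousLinearMap ((coord F V m (fibreTarget D x p)).toLinearMap ∘ₗ
    φ (fibrePt F V x p) ∘ₗ (uncoord F V x x).toLinearMap)

theorem formCoord_apply (m x : M) (p q : F) : formCoord φ m x p q =
    coord F V m (fibreTarget D x p) (φ (fibrePt F V x p) (uncoord F V x x q)) := rfl

theorem contMDiffAt_form (hopen : IsOpen A₀) (hsmooth : IsSmoothOneForm φ A₀) {x : M} {p : F}
    (hp : p ∈ fibreDomain A₀ x) (b : V x) :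
    ContMDiffAt 𝓘(ℝ, F) (𝓘(ℝ, E).prod 𝓘(ℝ, F)) ∞
      (fun p => TotalSpace.mk' F (fibreTarget D x p) (φ (fibrePt F V x p) b)) p := by
  have h := ContMDiffOn.comp hsmooth (contMDiff_fibrePt_prod (E := E) x b).contMDiffOn
    (s := fibreDomain A₀ x) (fun q hq => hq)
  exact h.contMDiffAt ((isOpen_fibreDomain hopen x).mem_nhds hp)

theorem contMDiffAt_fibreTarget (hopen : IsOpen A₀) (hsmooth : IsSmoothOneForm φ A₀) {x : M} {p : F}
    (hp : p ∈ fibreDomain A₀ x) :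
    ContMDiffAt 𝓘(ℝ, F) 𝓘(ℝ, E) ∞ (fibreTarget D x) p :=
  (contMDiffAt_totalSpace.1 (contMDiffAt_form hopen hsmooth hp 0)).1

/-- The points of `A₀` over `x` whose target lies in the domain of the local frame at `m`. -/
def formDomain (D : A.AConnection) (A₀ : Set (TotalSpace F V)) (m x : M) : Set F :=
  {p | p ∈ fibreDomain A₀ x ∧ fibreTarget D x p ∈ frameNhd E F V m}

theorem isOpen_formDomain (hopen : IsOpen A₀) (hsmooth : IsSmoothOneForm φ A₀) (m x : M) :
    IsOpen (formDomain D A₀ m x) := by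
  have h : ContinuousOn (fibreTarget D x) (fibreDomain A₀ x) := fun p hp =>
    (contMDiffAt_fibreTarget hopen hsmooth hp).continuousAt.continuousWithinAt
  exact h.isOpen_inter_preimage (isOpen_fibreDomain hopen x) (isOpen_frameNhd m)

theorem contDiffAt_formCoord (hopen : IsOpen A₀) (hsmooth : IsSmoothOneForm φ A₀) {m x : M} {p : F}
    (hp : p ∈ formDomain D A₀ m x) : ContDiffAt ℝ ∞ (formCoord φ m x) p := by
  have h : ContDiffOn ℝ ∞ (formCoord φ m x) (formDomain D A₀ m x) := by
    rw [contDiffOn_clm_apply]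
    intro q p hp
    have h1 := contMDiffAt_form hopen hsmooth hp.1 (uncoord F V x x q)
    rw [contMDiffAt_iff_coord (u := fun p => TotalSpace.mk' F (fibreTarget D x p)
      (φ (fibrePt F V x p) (uncoord F V x x q))) (mem_baseSet hp.2)] at h1
    exact h1.2.contDiffAt.contDiffWithinAt
  exact h.contDiffAt ((isOpen_formDomain hopen hsmooth m x).mem_nhds hp)

/-- `ρ ∘ φ = dτ` on the fibre over `x`. -/
theorem mfderiv_fibreTarget (hopen : IsOpen A₀) (hsmooth : IsSmoothOneForm φ A₀)
    (hanchored : IsAnchored φ A₀) {x : M} {p : F} (hp : p ∈ fibreDomain A₀ x) (q : F) :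
    mfderiv 𝓘(ℝ, F) 𝓘(ℝ, E) (fibreTarget D x) p q =
      A.anchor (fibreTarget D x p) (φ (fibrePt F V x p) (uncoord F V x x q)) := by
  refine Eq.trans ?_ (hanchored x (uncoord F V x x p) (uncoord F V x x q) hp).symm
  have h1 : (fun ε : ℝ => target D ⟨x, uncoord F V x x p + ε • uncoord F V x x q⟩) =
      fun ε : ℝ => fibreTarget D x (p + ε • q) := by
    ext1 ε
    rw [fibreTarget, fibrePt, map_add, map_smul]
  have hd : HasFDerivAt (fun ε : ℝ => p + ε • q) ((1 : ℝ →L[ℝ] ℝ).smulRight q) 0 :=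
    ((hasFDerivAt_id (0 : ℝ)).smul_const q).const_add p
  have hp0 : p + (0 : ℝ) • q ∈ fibreDomain A₀ x := by simpa using hp
  have h2 := HasMFDerivAt.comp (0 : ℝ) (f := fun ε : ℝ => p + ε • q)
    ((contMDiffAt_fibreTarget hopen hsmooth hp0).mdifferentiableAt (by simp)).hasMFDerivAt
    hd.hasMFDerivAt
  have h3 := congrArg (fun l : ℝ →L[ℝ] E => l 1) h2.mfderiv
  change mfderiv 𝓘(ℝ, ℝ) 𝓘(ℝ, E) (fun ε : ℝ => fibreTarget D x (p + ε • q)) 0 (1 : ℝ) =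
    mfderiv 𝓘(ℝ, F) 𝓘(ℝ, E) (fibreTarget D x) (p + (0 : ℝ) • q) ((1 : ℝ) • q) at h3
  rw [one_smul, zero_smul, add_zero] at h3
  rw [dTarget, h1]
  exact h3.symm

/-- The structure functions of the bracket, along the target map. -/
def structureAlong (D : A.AConnection) (m x : M) (p : F) : F →L[ℝ] F →L[ℝ] F :=
  A.structureMap m (fibreTarget D x p)

/-- The derivative of `φ` with respect to the pullback connection, in coordinates. -/
theorem coord_pullbackDeriv (hopen : IsOpen A₀) (hsmooth : IsSmoothOneForm φ A₀)
    (hanchored : IsAnchored φ A₀) (nabla : CovariantDerivative 𝓘(ℝ, E) F V) {m x : M} {p : F}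
    (hp : p ∈ formDomain D A₀ m x) (q r : F) :
    coord F V m (fibreTarget D x p) (pullbackDeriv nabla φ (uncoord F V x x p)
      (uncoord F V x x q) (uncoord F V x x r)) =
    fderiv ℝ (formCoord φ m x) p q r + coord F V m (fibreTarget D x p)
      (nablaAt nabla (fibreTarget D x p) (A.anchor (fibreTarget D x p)
        (φ (fibrePt F V x p) (uncoord F V x x q))) (frame E F V m (formCoord φ m x p r))) := by
  have hd : HasFDerivAt (fun ε : ℝ => p + ε • q) ((1 : ℝ →L[ℝ] ℝ).smulRight q) 0 :=
    ((hasFDerivAt_id (0 : ℝ)).smul_const q).const_add p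
  have hp0 : p + (0 : ℝ) • q = p := by simp
  set u : ℝ → TotalSpace F V := fun ε => TotalSpace.mk' F (fibreTarget D x (p + ε • q))
    (φ (fibrePt F V x (p + ε • q)) (uncoord F V x x r)) with hu
  have hu' : (fun ε : ℝ => TotalSpace.mk' F
      (target D ⟨x, uncoord F V x x p + ε • uncoord F V x x q⟩)
      (φ ⟨x, uncoord F V x x p + ε • uncoord F V x x q⟩ (uncoord F V x x r))) = u := by
    ext1 ε
    rw [hu, ← map_smul, ← map_add]
    rfl
  have hud : MDifferentiableAt 𝓘(ℝ, ℝ) (𝓘(ℝ, E).prod 𝓘(ℝ, F)) u 0 := by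
    have h1 := (contMDiffAt_form hopen hsmooth (by rw [hp0]; exact hp.1 :
      p + (0 : ℝ) • q ∈ fibreDomain A₀ x) (uncoord F V x x r)).mdifferentiableAt (by simp)
    exact h1.comp (0 : ℝ) hd.differentiableAt.mdifferentiableAt
  have hproj : (u 0).proj = fibreTarget D x p := by simp [hu]
  have hw : mfderiv 𝓘(ℝ, ℝ) 𝓘(ℝ, E) (fun ε => (u ε).proj) 0 (1 : ℝ) =
      A.anchor (fibreTarget D x p) (φ (fibrePt F V x p) (uncoord F V x x q)) := by
    rw [show A.anchor (fibreTarget D x p) (φ (fibrePt F V x p) (uncoord F V x x q)) = _ from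
      hanchored x _ _ hp.1, dTarget, ← hu']
  have h2 := curveDeriv_eq hp.2 hud hproj hw
    (isDerivationAlong_nablaAt nabla (fibreTarget D x p) _)
    (D := fun σ => nabla σ (fibreTarget D x p) (A.anchor (fibreTarget D x p)
      (φ (fibrePt F V x p) (uncoord F V x x q)))) (nablaAt_congr nabla _ _)
  have h3 : pullbackDeriv nabla φ (uncoord F V x x p)
      (uncoord F V x x q) (uncoord F V x x r) = curveDeriv (fibreTarget D x p) u 0
      (fun σ => nabla σ (fibreTarget D x p) (A.anchor (fibreTarget D x p)
      (φ (fibrePt F V x p) (uncoord F V x x q)))) := by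
    rw [pullbackDeriv, hu', ← hanchored x _ _ hp.1]
    rfl
  have h4 : deriv (fun s => coord F V m (u s).proj (u s).2) 0 =
      fderiv ℝ (formCoord φ m x) p q r := by
    have h5 : HasFDerivAt (formCoord φ m x) (fderiv ℝ (formCoord φ m x) p) (p + (0 : ℝ) • q) := by
      rw [hp0]
      exact ((contDiffAt_formCoord hopen hsmooth hp).differentiableAt (by simp)).hasFDerivAt
    have h6 := ((ContinuousLinearMap.apply ℝ F r).hasFDerivAt.comp _ (h5.comp 0 hd)).hasDerivAt
    have h7 := h6.deriv
    simpa using! h7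
  have h8 : coord F V m (u 0).proj (u 0).2 = formCoord φ m x p r :=
    congrArg (fun p' => formCoord φ m x p' r) hp0
  rw [h3, h2, map_add, coord_uncoord (mem_baseSet hp.2), h4, h8]

/-- The Maurer-Cartan form in coordinates. The terms containing `nabla` from the pullback
derivative and from the torsion cancel. -/
theorem coord_maurerCartan (hopen : IsOpen A₀) (hsmooth : IsSmoothOneForm φ A₀)
    (hanchored : IsAnchored φ A₀) (nabla : CovariantDerivative 𝓘(ℝ, E) F V) {m x : M} {p : F}
    (hp : p ∈ formDomain D A₀ m x) (q r : F) :
    coord F V m (fibreTarget D x p) (maurerCartan nabla φ (uncoord F V x x p)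
      (uncoord F V x x q) (uncoord F V x x r)) =
      mcForm (structureAlong D m x) (formCoord φ m x) p q r := by
  have h1 := coord_pullbackDeriv hopen hsmooth hanchored nabla hp q r
  have h2 := coord_pullbackDeriv hopen hsmooth hanchored nabla hp r q
  have h3 := A.coord_torsion nabla hp.2 (φ (fibrePt F V x p) (uncoord F V x x q))
    (φ (fibrePt F V x p) (uncoord F V x x r))
  have h4 := A.coord_torsion nabla hp.2 (φ (fibrePt F V x p) (uncoord F V x x r))
    (φ (fibrePt F V x p) (uncoord F V x x q))
  simp only [← formCoord_apply] at h3 h4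
  rw [A.structureMap_antisymm m _ (formCoord φ m x p r)] at h4
  have h5 : ∀ a b c d : V (fibreTarget D x p), coord F V m (fibreTarget D x p)
      ((a - b) + (1 / 2 : ℝ) • (c - d)) =
      (coord F V m (fibreTarget D x p) a - coord F V m (fibreTarget D x p) b) + (1 / 2 : ℝ) •
      (coord F V m (fibreTarget D x p) c - coord F V m (fibreTarget D x p) d) := by
    intros; simp only [map_add, map_sub, map_smul]
  refine (h5 _ _ _ _).trans ?_
  refine (congrArg₂ (· + ·) (congrArg₂ (· - ·) h1 h2) (congrArg ((1 / 2 : ℝ) • ·)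
    (congrArg₂ (· - ·) h3 h4))).trans ?_
  rw [mcForm, structureAlong]
  module

end PreLieAlgebroid

/-! ### The Bianchi identity along the fibres -/

namespace PreLieAlgebroid

variable {A : PreLieAlgebroid E F V} {D : A.AConnection} {φ : OneForm D}
  {A₀ : Set (TotalSpace F V)}

variable (A) in
/-- The anchor in the local frame at `m` and the chart at `m`. -/
def anchorMap (m y : M) : F →L[ℝ] E := LinearMap.toContinuousLinearMap
  ((mvfderiv 𝓘(ℝ, E) (extChartAt 𝓘(ℝ, E) m) y).toLinearMap ∘ₗ A.anchor y ∘ₗ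
    evalSection E F V y ∘ₗ frame E F V m)

variable (A) in
theorem anchorMap_apply (m y : M) (v : F) : A.anchorMap m y v =
    mvfderiv 𝓘(ℝ, E) (extChartAt 𝓘(ℝ, E) m) y (A.anchor y (frame E F V m v y)) := rfl

theorem contMDiffAt_chart {m y : M} (hy : y ∈ frameNhd E F V m) :
    ContMDiffAt 𝓘(ℝ, E) 𝓘(ℝ, E) ∞ (extChartAt 𝓘(ℝ, E) m) y :=
  contMDiffAt_extChartAt' (by rw [← extChartAt_source 𝓘(ℝ, E)]; exact frameNhd_subset_source m hy)

variable (A) in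
theorem contMDiffAt_anchorMap_apply {m y : M} (hy : y ∈ frameNhd E F V m) (v : F) :
    ContMDiffAt 𝓘(ℝ, E) 𝓘(ℝ, E) ∞ (fun z => A.anchorMap m z v) y :=
  A.contMDiffAt_anchor_deriv (contMDiffAt_chart hy) (frame E F V m v)

theorem structureAlong_antisymm (m x : M) (p v w : F) :
    structureAlong D m x p v w = - structureAlong D m x p w v := A.structureMap_antisymm m _ v w

theorem contDiffAt_structureAlong (hopen : IsOpen A₀) (hsmooth : IsSmoothOneForm φ A₀) {m x : M}
    {p : F} (hp : p ∈ formDomain D A₀ m x) : ContDiffAt ℝ ∞ (structureAlong D m x) p := by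
  have h : ContDiffOn ℝ ∞ (structureAlong D m x) (formDomain D A₀ m x) := by
    rw [contDiffOn_clm_apply]
    intro v
    rw [contDiffOn_clm_apply]
    intro w p hp
    have h1 := (A.contMDiffAt_structureMap_apply hp.2 v w).comp p
      (contMDiffAt_fibreTarget hopen hsmooth hp.1)
    exact h1.contDiffAt.contDiffWithinAt
  exact h.contDiffAt ((isOpen_formDomain hopen hsmooth m x).mem_nhds hp)

/-- Since `φ` is anchored, the structure functions along the target map are differentiated by
differentiating the structure functions on `M` along `ρ ∘ φ`. -/
theorem fderiv_structureAlong (hopen : IsOpen A₀) (hsmooth : IsSmoothOneForm φ A₀)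
    (hanchored : IsAnchored φ A₀) {m x : M}
    {p : F} (hp : p ∈ formDomain D A₀ m x) (s v w : F) :
    fderiv ℝ (structureAlong D m x) p s v w =
      mvfderiv 𝓘(ℝ, E) (fun y => A.structureMap m y v w) (fibreTarget D x p)
        (A.anchor (fibreTarget D x p) (φ (fibrePt F V x p) (uncoord F V x x s))) := by
  have h1 := (((contDiffAt_structureAlong hopen hsmooth hp).differentiableAt
    (by simp)).hasFDerivAt.clm_apply (hasFDerivAt_const v p)).clm_apply (hasFDerivAt_const w p)
  have h2 := hasFDerivAt_comp_mvfderiv (u := fibreTarget D x)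
    ((A.contMDiffAt_structureMap_apply hp.2 v w).mdifferentiableAt (by simp))
    ((contMDiffAt_fibreTarget hopen hsmooth hp.1).mdifferentiableAt (by simp))
  have h3 := congrArg (fun l : F →L[ℝ] F => l s) (h1.unique h2)
  change structureAlong D m x p v 0 + (structureAlong D m x p 0 w +
    fderiv ℝ (structureAlong D m x) p s v w) = mvfderiv 𝓘(ℝ, E) (fun y => A.structureMap m y v w)
      (fibreTarget D x p) (mfderiv 𝓘(ℝ, F) 𝓘(ℝ, E) (fibreTarget D x) p s) at h3
  have h5 : structureAlong D m x p 0 w = 0 := (structureAlong D m x p).map_zero₂ w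
  rw [h5, (structureAlong D m x p v).map_zero, zero_add, zero_add] at h3
  rw [h3]
  exact congrArg _ (mfderiv_fibreTarget hopen hsmooth hanchored hp.1 s)

/-- The Jacobiator on values of `φ`, in coordinates. -/
theorem coord_jac_form (hopen : IsOpen A₀) (hsmooth : IsSmoothOneForm φ A₀)
    (hanchored : IsAnchored φ A₀) {m x : M}
    {p : F} (hp : p ∈ formDomain D A₀ m x) (q r s : F) :
    coord F V m (fibreTarget D x p) (A.jac (φ (fibrePt F V x p) (uncoord F V x x q))
      (φ (fibrePt F V x p) (uncoord F V x x r)) (φ (fibrePt F V x p) (uncoord F V x x s))) =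
    jacForm (structureAlong D m x) (formCoord φ m x) p q r s := by
  have h : ∀ u v w : V (fibreTarget D x p), _ := fun u v w =>
    (A.coord_jac hp.2 u v w).trans (A.coord_jacobiator_frame hp.2 _ _ _)
  simp only [frame_coord hp.2] at h
  refine (h _ _ _).trans ?_
  simp only [jacForm, fderiv_structureAlong hopen hsmooth hanchored hp]
  rfl

set_option synthInstance.maxHeartbeats 200000 in
theorem contDiffAt_mcForm (hopen : IsOpen A₀) (hsmooth : IsSmoothOneForm φ A₀) {m x : M}
    {p : F} (hp : p ∈ formDomain D A₀ m x) (q r : F) :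
    ContDiffAt ℝ ∞ (fun p => mcForm (structureAlong D m x) (formCoord φ m x) p q r) p := by
  have h1 := contDiffAt_formCoord hopen hsmooth hp
  have h2 := h1.fderiv_right (m := ∞) (by simp)
  have h3 := contDiffAt_structureAlong hopen hsmooth hp
  exact (((h2.clm_apply contDiffAt_const).clm_apply contDiffAt_const).sub
    ((h2.clm_apply contDiffAt_const).clm_apply contDiffAt_const)).add
    ((h3.clm_apply (h1.clm_apply contDiffAt_const)).clm_apply (h1.clm_apply contDiffAt_const))

set_option synthInstance.maxHeartbeats 200000 in
theorem continuousAt_jacForm (hopen : IsOpen A₀) (hsmooth : IsSmoothOneForm φ A₀) {m x : M}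
    {p : F} (hp : p ∈ formDomain D A₀ m x) (q r s : F) :
    ContinuousAt (fun p => jacForm (structureAlong D m x) (formCoord φ m x) p q r s) p := by
  have h1 := (contDiffAt_formCoord hopen hsmooth hp).continuousAt
  have h3 := contDiffAt_structureAlong hopen hsmooth hp
  have h2 := (h3.fderiv_right (m := ∞) (by simp)).continuousAt
  have h3 := h3.continuousAt
  have h4 : ∀ q r s, ContinuousAt (fun p => structureAlong D m x p (structureAlong D m x p
      (formCoord φ m x p q) (formCoord φ m x p r)) (formCoord φ m x p s) -
      fderiv ℝ (structureAlong D m x) p s (formCoord φ m x p q) (formCoord φ m x p r)) p := by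
    intro q r s
    exact ((h3.clm_apply ((h3.clm_apply (h1.clm_apply continuousAt_const)).clm_apply
      (h1.clm_apply continuousAt_const))).clm_apply (h1.clm_apply continuousAt_const)).sub
      (((h2.clm_apply continuousAt_const).clm_apply
      (h1.clm_apply continuousAt_const)).clm_apply (h1.clm_apply continuousAt_const))
  exact ((h4 q r s).add (h4 r s q)).add (h4 s q r)

/-- The anchor of the Maurer-Cartan form vanishes, since `ρ ∘ φ = dτ` and the anchor preserves
brackets. -/
theorem anchor_maurerCartan (hopen : IsOpen A₀) (hsmooth : IsSmoothOneForm φ A₀)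
    (hanchored : IsAnchored φ A₀) (nabla : CovariantDerivative 𝓘(ℝ, E) F V) {x : M}
    {p : F} (hp : p ∈ fibreDomain A₀ x) (q r : F) :
    A.anchor (fibreTarget D x p) (maurerCartan nabla φ (uncoord F V x x p)
      (uncoord F V x x q) (uncoord F V x x r)) = 0 := by
  set y := fibreTarget D x p with hy
  have hyN : y ∈ frameNhd E F V y := mem_frameNhd_self y
  have hpd : p ∈ formDomain D A₀ y x := ⟨hp, hyN⟩
  have : IsManifold 𝓘(ℝ, E) 1 M := IsManifold.of_le (n := ∞) (by norm_cast)
  set f := extChartAt 𝓘(ℝ, E) y with hf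
  have hfs : ∀ z ∈ frameNhd E F V y, ContMDiffAt 𝓘(ℝ, E) 𝓘(ℝ, E) ∞ f z := fun z hz =>
    contMDiffAt_chart hz
  set G : M → F →L[ℝ] E := A.anchorMap y
  have hG : ∀ z v, G z v = mvfderiv 𝓘(ℝ, E) f z (A.anchor z (frame E F V y v z)) := fun _ _ => rfl
  have hGs : ∀ v, ∀ z ∈ frameNhd E F V y, ContMDiffAt 𝓘(ℝ, E) 𝓘(ℝ, E) ∞ (fun z => G z v) z :=
    fun v z hz => A.contMDiffAt_anchorMap_apply hz v
  set θ := fibreTarget D x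
  set Φ := formCoord φ y x
  have hU := isOpen_formDomain (D := D) hopen hsmooth y x
  have hθ : ∀ p' ∈ formDomain D A₀ y x, ContMDiffAt 𝓘(ℝ, F) 𝓘(ℝ, E) ∞ θ p' := fun p' h =>
    contMDiffAt_fibreTarget hopen hsmooth h.1
  have hΦ := contDiffAt_formCoord hopen hsmooth hpd
  have hGθ : DifferentiableAt ℝ (fun p' => G (θ p')) p := by
    have h : ContDiffOn ℝ ∞ (fun p' => G (θ p')) (formDomain D A₀ y x) := by
      rw [contDiffOn_clm_apply]
      exact fun v p' hp' => (((hGs v _ hp'.2).comp p' (hθ p' hp')).contDiffAt).contDiffWithinAt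
    exact (h.contDiffAt (hU.mem_nhds hpd)).differentiableAt (by simp)
  set g : F → E := fun p' => f (θ p') with hg
  have hgs : ContDiffAt ℝ ∞ g p := ((hfs y hyN).comp p (hθ p hpd)).contDiffAt
  -- the differential of the target map, in the chart
  have hdg : fderiv ℝ g =ᶠ[𝓝 p] fun p' => (G (θ p')).comp (Φ p') := by
    filter_upwards [hU.mem_nhds hpd] with p' hp'
    ext v
    rw [(hasFDerivAt_comp_mvfderiv (u := θ) ((hfs _ hp'.2).mdifferentiableAt (by simp))
      ((hθ p' hp').mdifferentiableAt (by simp))).fderiv]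
    refine (congrArg (mvfderiv 𝓘(ℝ, E) f (θ p'))
      (mfderiv_fibreTarget hopen hsmooth hanchored hp'.1 v)).trans ?_
    change _ = G (θ p') (Φ p' v)
    rw [hG]
    exact congrArg (fun w => mvfderiv 𝓘(ℝ, E) f (θ p') (A.anchor (θ p') w))
      (frame_coord hp'.2 _).symm
  have hΦd := (hΦ.differentiableAt (by simp)).hasFDerivAt
  have hsecond : ∀ v w, fderiv ℝ (fderiv ℝ g) p v w =
      G y (fderiv ℝ Φ p v w) + mvfderiv 𝓘(ℝ, E) (fun z => G z (Φ p w)) y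
        (A.anchor y (φ (fibrePt F V x p) (uncoord F V x x v))) := by
    intro v w
    rw [hdg.fderiv_eq]
    have h1 := (hGθ.hasFDerivAt.clm_comp hΦd).fderiv
    have h2 := congrArg (fun l : F →L[ℝ] F →L[ℝ] E => l v w) h1
    refine h2.trans ?_
    change G y (fderiv ℝ Φ p v w) + fderiv ℝ (fun p' => G (θ p')) p v (Φ p w) = _
    have h3 := hasFDerivAt_comp_mvfderiv (u := θ)
      ((hGs (Φ p w) y hyN).mdifferentiableAt (by simp))
      ((hθ p hpd).mdifferentiableAt (by simp))
    have h4 := (hGθ.hasFDerivAt.clm_apply (hasFDerivAt_const (Φ p w) p)).unique h3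
    have h5 := congrArg (fun l : F →L[ℝ] E => l v) h4
    change G y 0 + fderiv ℝ (fun p' => G (θ p')) p v (Φ p w) =
      mvfderiv 𝓘(ℝ, E) (fun z => G z (Φ p w)) y (mfderiv 𝓘(ℝ, F) 𝓘(ℝ, E) θ p v) at h5
    rw [(G y).map_zero, zero_add] at h5
    rw [h5]
    exact congrArg (fun u => G y (fderiv ℝ Φ p v w) + mvfderiv 𝓘(ℝ, E) (fun z => G z (Φ p w)) y u)
      (mfderiv_fibreTarget hopen hsmooth hanchored hp v)
  have hsymm : fderiv ℝ (fderiv ℝ g) p q r = fderiv ℝ (fderiv ℝ g) p r q :=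
    hgs.isSymmSndFDerivAt (by simpa using (by norm_cast : (2 : WithTop ℕ∞) ≤ ∞)) _ _
  rw [hsecond, hsecond] at hsymm
  have hbr := A.mvfderiv_anchor_bracket (hfs y hyN) (frame E F V y (Φ p q)) (frame E F V y (Φ p r))
  have hfr : ∀ v, frame E F V y (Φ p v) y = φ (fibrePt F V x p) (uncoord F V x x v) :=
    fun v => frame_coord hyN _
  have hbr' : mvfderiv 𝓘(ℝ, E) f y (A.anchor y (A.bracket (frame E F V y (Φ p q))
      (frame E F V y (Φ p r)) y)) =
      mvfderiv 𝓘(ℝ, E) (fun z => G z (Φ p r)) y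
        (A.anchor y (φ (fibrePt F V x p) (uncoord F V x x q))) -
      mvfderiv 𝓘(ℝ, E) (fun z => G z (Φ p q)) y
        (A.anchor y (φ (fibrePt F V x p) (uncoord F V x x r))) := by
    rw [hbr, hfr, hfr]
    rfl
  have hGC : G y (structureAlong D y x p (Φ p q) (Φ p r)) = mvfderiv 𝓘(ℝ, E) f y
      (A.anchor y (A.bracket (frame E F V y (Φ p q)) (frame E F V y (Φ p r)) y)) := by
    rw [hG]
    exact congrArg (fun w => mvfderiv 𝓘(ℝ, E) f y (A.anchor y w)) (frame_coord hyN _)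
  have hmc : G y (mcForm (structureAlong D y x) Φ p q r) = 0 := by
    rw [mcForm, map_add, map_sub, hGC, hbr']
    rw [← sub_eq_zero] at hsymm
    rw [← hsymm]
    abel
  rw [← coord_maurerCartan hopen hsmooth hanchored nabla hpd] at hmc
  have hmc' : mvfderiv 𝓘(ℝ, E) f y (A.anchor y (maurerCartan nabla φ (uncoord F V x x p)
      (uncoord F V x x q) (uncoord F V x x r))) = 0 := by
    refine Eq.trans ?_ hmc
    rw [hG]
    exact congrArg (fun w => mvfderiv 𝓘(ℝ, E) f y (A.anchor y w)) (frame_coord hyN _).symm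
  exact (isInvertible_mfderiv_extChartAt (mem_extChartAt_source (I := 𝓘(ℝ, E)) y)).injective
    (hmc'.trans (map_zero _).symm)

end PreLieAlgebroid

/-! ### Geodesics -/

/-- Two points of the total space agree if their base points and local coordinates do. -/
theorem totalSpace_ext_coord {m : M} {u v : TotalSpace F V} (hm : u.proj ∈ frameNhd E F V m)
    (h : u.proj = v.proj) (h' : coord F V m u.proj u.2 = coord F V m v.proj v.2) : u = v := by
  obtain ⟨x, a⟩ := u
  obtain ⟨y, b⟩ := v
  obtain rfl : x = y := h
  exact congrArg _ (coord_injective (mem_baseSet hm) h')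

namespace PreLieAlgebroid

variable {A : PreLieAlgebroid E F V} {D : A.AConnection}

/-- The connection coefficients in the local frame at `m`. -/
def christoffel (D : A.AConnection) (m y : M) : F →L[ℝ] F →L[ℝ] F :=
  LinearMap.toContinuousBilinearMap (LinearMap.mk₂ ℝ
    (fun v w => coord F V m y (D.derivAt y (frame E F V m v y) (frame E F V m w)))
    (fun v v' w => ((coord F V m y).toLinearMap ∘ₗ D.toFun (frame E F V m w) y ∘ₗ
      evalSection E F V y ∘ₗ frame E F V m).map_add v v')
    (fun c v w => ((coord F V m y).toLinearMap ∘ₗ D.toFun (frame E F V m w) y ∘ₗ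
      evalSection E F V y ∘ₗ frame E F V m).map_smul c v)
    (fun v w w' => by rw [map_add, map_add, map_add])
    (fun c v w => by rw [map_smul, map_smul, map_smul]))

theorem christoffel_apply (m y : M) (v w : F) : christoffel D m y v w =
    coord F V m y (D.derivAt y (frame E F V m v y) (frame E F V m w)) := rfl

theorem contMDiffAt_christoffel_apply {m y : M} (hy : y ∈ frameNhd E F V m) (v w : F) :
    ContMDiffAt 𝓘(ℝ, E) 𝓘(ℝ, F) ∞ (fun z => christoffel D m z v w) y := by
  have h := D.contMDiff (frame E F V m v) (frame E F V m w) y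
  rw [contMDiffAt_iff_coord (m := m) (u := fun x => TotalSpace.mk' F x
    (D.toFun (frame E F V m w) x (frame E F V m v x))) (mem_baseSet hy)] at h
  exact h.2

theorem mdifferentiableAt_proj {g : ℝ → TotalSpace F V} {t : ℝ}
    (hg : MDifferentiableAt 𝓘(ℝ, ℝ) (𝓘(ℝ, E).prod 𝓘(ℝ, F)) g t) :
    MDifferentiableAt 𝓘(ℝ, ℝ) 𝓘(ℝ, E) (fun s => (g s).proj) t :=
  (contMDiff_proj V (n := 1) (IB := 𝓘(ℝ, E)) |>.mdifferentiable (by simp) (g t)).comp t hg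

/-- The geodesic equation in a local frame. -/
theorem curveDeriv_eq_zero_iff {g : ℝ → TotalSpace F V} {t : ℝ} {m : M}
    (hm : (g t).proj ∈ frameNhd E F V m)
    (hg : MDifferentiableAt 𝓘(ℝ, ℝ) (𝓘(ℝ, E).prod 𝓘(ℝ, F)) g t)
    (hpath : A.anchor (g t).proj (g t).2 =
      mfderiv 𝓘(ℝ, ℝ) 𝓘(ℝ, E) (fun s => (g s).proj) t (1 : ℝ)) :
    curveDeriv (g t).proj g t (fun σ => D.toFun σ (g t).proj (g t).2) = 0 ↔
      deriv (fun s => coord F V m (g s).proj (g s).2) t = - christoffel D m (g t).proj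
        (coord F V m (g t).proj (g t).2) (coord F V m (g t).proj (g t).2) := by
  rw [curveDeriv_eq hm hg rfl hpath.symm (D.isDerivationAlong_derivAt (g t).proj (g t).2)
    (D.derivAt_congr (g t).proj (g t).2), christoffel_apply, frame_coord hm,
    ← (coord_injective (mem_baseSet hm)).eq_iff, map_add, coord_uncoord (mem_baseSet hm), map_zero,
    eq_neg_iff_add_eq_zero]

/-- The geodesic vector field in the chart and the local frame at `m`. -/
def geodesicSpray (D : A.AConnection) (m : M) (q : E × F) : E × F :=
  (A.anchorMap m ((extChartAt 𝓘(ℝ, E) m).symm q.1) q.2,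
    - christoffel D m ((extChartAt 𝓘(ℝ, E) m).symm q.1) q.2 q.2)

set_option synthInstance.maxHeartbeats 200000 in
theorem contDiffAt_geodesicSpray {m y : M} (hy : y ∈ frameNhd E F V m) (v : F) :
    ContDiffAt ℝ 1 (geodesicSpray D m) (extChartAt 𝓘(ℝ, E) m y, v) := by
  set f := extChartAt 𝓘(ℝ, E) m
  set U : Set E := f.target ∩ f.symm ⁻¹' frameNhd E F V m
  have hf := contMDiffOn_extChartAt_symm (I := 𝓘(ℝ, E)) (n := ∞) m
  have hto : IsOpen f.target := isOpen_extChartAt_target m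
  have hU : IsOpen U := hf.continuousOn.isOpen_inter_preimage hto (isOpen_frameNhd m)
  have hyU : f y ∈ U := ⟨f.map_source (frameNhd_subset_source m hy), by
    rw [mem_preimage, f.left_inv (frameNhd_subset_source m hy)]; exact hy⟩
  have hf' : ∀ z ∈ U, ContMDiffAt 𝓘(ℝ, E) 𝓘(ℝ, E) ∞ f.symm z := fun z hz =>
    (hf z hz.1).contMDiffAt (hto.mem_nhds hz.1)
  have h1 : ContDiffOn ℝ ∞ (fun z => A.anchorMap m (f.symm z)) U := by
    rw [contDiffOn_clm_apply]
    exact fun v z hz => ((A.contMDiffAt_anchorMap_apply hz.2 v).comp z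
      (hf' z hz)).contDiffAt.contDiffWithinAt
  have h2 : ContDiffOn ℝ ∞ (fun z => christoffel D m (f.symm z)) U := by
    rw [contDiffOn_clm_apply]
    intro v
    rw [contDiffOn_clm_apply]
    exact fun w z hz => ((contMDiffAt_christoffel_apply hz.2 v w).comp z
      (hf' z hz)).contDiffAt.contDiffWithinAt
  have h1' := ((h1.contDiffAt (hU.mem_nhds hyU)).of_le (m := 1) (by norm_cast)).comp (f y, v)
    (contDiffAt_fst (n := 1))
  have h2' := ((h2.contDiffAt (hU.mem_nhds hyU)).of_le (m := 1) (by norm_cast)).comp (f y, v)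
    (contDiffAt_fst (n := 1))
  exact (h1'.clm_apply contDiffAt_snd).prodMk
    ((h2'.clm_apply contDiffAt_snd).clm_apply contDiffAt_snd).neg

theorem IsGeodesicOn.mdifferentiableAt {g : ℝ → TotalSpace F V} {J : Set ℝ} (hJ : IsOpen J)
    (hg : IsGeodesicOn D g J) {t : ℝ} (ht : t ∈ J) :
    MDifferentiableAt 𝓘(ℝ, ℝ) (𝓘(ℝ, E).prod 𝓘(ℝ, F)) g t :=
  (hg.contMDiffOn.contMDiffAt (hJ.mem_nhds ht)).mdifferentiableAt (by simp)

theorem IsGeodesicOn.contMDiffAt_coord {g : ℝ → TotalSpace F V} {J : Set ℝ} (hJ : IsOpen J)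
    (hg : IsGeodesicOn D g J) {t : ℝ} (ht : t ∈ J) {m : M} (hm : (g t).proj ∈ frameNhd E F V m) :
    ContMDiffAt 𝓘(ℝ, ℝ) 𝓘(ℝ, E) ∞ (fun s => (g s).proj) t ∧
    ContDiffAt ℝ ∞ (fun s => coord F V m (g s).proj (g s).2) t := by
  have h := (contMDiffAt_iff_coord (mem_baseSet hm)).1 (hg.contMDiffOn.contMDiffAt (hJ.mem_nhds ht))
  exact ⟨h.1, h.2.contDiffAt⟩

theorem IsGeodesicOn.eventually_mem {g : ℝ → TotalSpace F V} {J : Set ℝ} (hJ : IsOpen J)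
    (hg : IsGeodesicOn D g J) {t : ℝ} (ht : t ∈ J) {m : M} (hm : (g t).proj ∈ frameNhd E F V m) :
    ∀ᶠ s in 𝓝 t, (g s).proj ∈ frameNhd E F V m :=
  (mdifferentiableAt_proj (hg.mdifferentiableAt hJ ht)).continuousAt (frameNhd_mem_nhds hm)

/-- A geodesic is an integral curve of the geodesic vector field, in coordinates. -/
theorem IsGeodesicOn.hasDerivAt {g : ℝ → TotalSpace F V} {J : Set ℝ} (hJ : IsOpen J)
    (hg : IsGeodesicOn D g J) {t : ℝ} (ht : t ∈ J) {m : M} (hm : (g t).proj ∈ frameNhd E F V m) :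
    HasDerivAt (fun s => (extChartAt 𝓘(ℝ, E) m (g s).proj, coord F V m (g s).proj (g s).2))
      (geodesicSpray D m (extChartAt 𝓘(ℝ, E) m (g t).proj, coord F V m (g t).proj (g t).2)) t := by
  have hgt := hg.mdifferentiableAt hJ ht
  have hpath := hg.isAPath t ht
  refine HasDerivAt.prodMk ?_ ?_
  · have h1 := (hasFDerivAt_comp_mvfderiv (u := fun s => (g s).proj)
      ((contMDiffAt_chart hm).mdifferentiableAt (by simp)) (mdifferentiableAt_proj hgt)).hasDerivAt
    refine h1.congr_deriv ?_
    rw [(extChartAt 𝓘(ℝ, E) m).left_inv (frameNhd_subset_source m hm), anchorMap_apply,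
      frame_coord hm, hpath]
    rfl
  · have h2 := (curveDeriv_eq_zero_iff hm hgt hpath).1 (hg.curveDeriv_eq_zero t ht)
    rw [(extChartAt 𝓘(ℝ, E) m).left_inv (frameNhd_subset_source m hm), ← h2]
    exact ((hg.contMDiffAt_coord hJ ht hm).2.differentiableAt (by simp)).hasDerivAt

theorem IsGeodesicOn.eventuallyEq {g g' : ℝ → TotalSpace F V} {J : Set ℝ} (hJ : IsOpen J)
    (hg : IsGeodesicOn D g J) (hg' : IsGeodesicOn D g' J) {t : ℝ} (ht : t ∈ J) (h : g t = g' t) :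
    g =ᶠ[𝓝 t] g' := by
  have hm : (g t).proj ∈ frameNhd E F V (g t).proj := mem_frameNhd_self _
  have hm' : (g' t).proj ∈ frameNhd E F V (g t).proj := by rw [← h]; exact hm
  set m := (g t).proj
  obtain ⟨K, s, hs, hlip⟩ := (contDiffAt_geodesicSpray (D := D) hm
    (coord F V m (g t).proj (g t).2)).exists_lipschitzOnWith
  have key : ∀ g : ℝ → TotalSpace F V, IsGeodesicOn D g J → (hm' : (g t).proj ∈ frameNhd E F V m) →
      s ∈ 𝓝 (extChartAt 𝓘(ℝ, E) m (g t).proj, coord F V m (g t).proj (g t).2) →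
      ∀ᶠ r in 𝓝 t, HasDerivAt
        (fun s => (extChartAt 𝓘(ℝ, E) m (g s).proj, coord F V m (g s).proj (g s).2))
        (geodesicSpray D m (extChartAt 𝓘(ℝ, E) m (g r).proj, coord F V m (g r).proj (g r).2)) r ∧
        (extChartAt 𝓘(ℝ, E) m (g r).proj, coord F V m (g r).proj (g r).2) ∈ s := by
    intro g hg hm' hs
    filter_upwards [hJ.mem_nhds ht, hg.eventually_mem hJ ht hm',
      (hg.hasDerivAt hJ ht hm').continuousAt hs] with r h1 h2 h3
    exact ⟨hg.hasDerivAt hJ h1 h2, h3⟩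
  have := ODE_solution_unique_of_eventually (v := fun _ => geodesicSpray D m) (s := fun _ => s)
    (Filter.Eventually.of_forall fun _ => hlip) (key g hg hm hs)
    (key g' hg' hm' (by rw [← h]; exact hs)) (by rw [h])
  filter_upwards [this, hg.eventually_mem hJ ht hm, hg'.eventually_mem hJ ht hm'] with r h1 h2 h3
  have h4 : (g r).proj = (g' r).proj := (extChartAt 𝓘(ℝ, E) m).injOn (frameNhd_subset_source m h2)
    (frameNhd_subset_source m h3) (congrArg Prod.fst h1)
  exact totalSpace_ext_coord h2 h4 (congrArg Prod.snd h1)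

/-- Uniqueness of geodesics: by local uniqueness the set of times at which two geodesics agree is
open, and by continuity so is its complement. -/
theorem IsGeodesicOn.eqOn {g g' : ℝ → TotalSpace F V} {J : Set ℝ} (hJ : IsOpen J)
    (hJc : J.OrdConnected) (hg : IsGeodesicOn D g J) (hg' : IsGeodesicOn D g' J) {t : ℝ}
    (ht : t ∈ J) (h : g t = g' t) : EqOn g g' J := by
  intro s hs
  refine (hJc.isPreconnected.induction₂ (fun a b => g a = g' a ↔ g b = g' b) ?_
    (fun _ _ _ _ _ _ h h' => h.trans h') (fun _ _ _ _ h => h.symm) ht hs).1 h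
  intro r hr
  refine Filter.Eventually.filter_mono nhdsWithin_le_nhds ?_
  by_cases h : g r = g' r
  · filter_upwards [hg.eventuallyEq hJ hg' hr h] with b hb
    simp [h, hb]
  suffices ∀ᶠ b in 𝓝 r, g b ≠ g' b by
    filter_upwards [this] with b hb
    simp [h, hb]
  have hc := (mdifferentiableAt_proj (hg.mdifferentiableAt hJ hr)).continuousAt
  have hc' := (mdifferentiableAt_proj (hg'.mdifferentiableAt hJ hr)).continuousAt
  by_cases hp : (g r).proj = (g' r).proj
  · have hm : (g r).proj ∈ frameNhd E F V (g r).proj := mem_frameNhd_self _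
    have hm' : (g' r).proj ∈ frameNhd E F V (g r).proj := by rw [← hp]; exact hm
    have h1 := (hg.contMDiffAt_coord hJ hr hm).2.continuousAt
    have h2 := (hg'.contMDiffAt_coord hJ hr hm').2.continuousAt
    filter_upwards [(h1.ne_iff_eventually_ne h2).1 fun h3 => h (totalSpace_ext_coord hm hp h3)]
      with b hb hb'
    exact hb (by rw [hb'])
  · filter_upwards [(hc.ne_iff_eventually_ne hc').1 hp] with b hb hb'
    exact hb (by rw [hb'])

end PreLieAlgebroid

/-! ### The maximal geodesic and the exponential map -/

namespace PreLieAlgebroid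

variable {A : PreLieAlgebroid E F V} {D : A.AConnection}

theorem IsGeodesicOn.mono {g : ℝ → TotalSpace F V} {J J' : Set ℝ} (hg : IsGeodesicOn D g J)
    (h : J' ⊆ J) : IsGeodesicOn D g J' :=
  ⟨hg.contMDiffOn.mono h, fun t ht => hg.isAPath t (h ht), fun t ht => hg.curveDeriv_eq_zero t (h ht)⟩

/-- A reparametrised and rescaled geodesic is a geodesic. -/
theorem IsGeodesicOn.scale {g : ℝ → TotalSpace F V} {J : Set ℝ} (hJ : IsOpen J)
    (hg : IsGeodesicOn D g J) (c : ℝ) :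
    IsGeodesicOn D (fun s => ⟨(g (c * s)).proj, c • (g (c * s)).2⟩) ((c * ·) ⁻¹' J) := by
  have hJ' : IsOpen ((c * ·) ⁻¹' J) := hJ.preimage (by fun_prop)
  have hmul : ∀ s, HasDerivAt (fun s => c * s) c s := fun s => by
    simpa using (hasDerivAt_id s).const_mul c
  have hsm : ContMDiff 𝓘(ℝ, ℝ) 𝓘(ℝ, ℝ) ∞ (fun s : ℝ => c * s) :=
    (contDiff_const.mul contDiff_id).contMDiff
  set G : ℝ → TotalSpace F V := fun s => ⟨(g (c * s)).proj, c • (g (c * s)).2⟩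
  have hG : ∀ t ∈ (c * ·) ⁻¹' J, ContMDiffAt 𝓘(ℝ, ℝ) (𝓘(ℝ, E).prod 𝓘(ℝ, F)) ∞ G t := by
    intro t ht
    have h := hg.contMDiffAt_coord hJ ht (mem_frameNhd_self (E := E) (F := F) (V := V) _)
    have h' : (G t).proj ∈ (trivializationAt F V (g (c * t)).proj).baseSet := mem_baseSet_self _
    rw [contMDiffAt_iff_coord h']
    refine ⟨h.1.comp t (hsm t), ?_⟩
    have h2 := (h.2.comp t (hsm t).contDiffAt).const_smul c
    refine h2.contMDiffAt.congr_of_eventuallyEq (Filter.Eventually.of_forall fun s => ?_)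
    exact map_smul _ _ _
  have hpath : ∀ t ∈ (c * ·) ⁻¹' J, A.anchor (G t).proj (G t).2 =
      mfderiv 𝓘(ℝ, ℝ) 𝓘(ℝ, E) (fun s => (G s).proj) t (1 : ℝ) := by
    intro t ht
    have h1 := (mdifferentiableAt_proj (hg.mdifferentiableAt hJ ht)).hasMFDerivAt.comp t
      (hmul t).hasFDerivAt.hasMFDerivAt
    have h2 := congrArg (fun l : ℝ →L[ℝ] E => l 1) h1.mfderiv
    refine Eq.trans ?_ h2.symm
    have h3 := hg.isAPath (c * t) ht
    refine (map_smul (A.anchor (G t).proj) c (g (c * t)).2).trans ((congrArg (c • ·) h3).trans ?_)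
    have h4 : ∀ l : ℝ →L[ℝ] E, c • l 1 = l ((1 : ℝ) • c) := fun l => by
      rw [← l.map_smul]; simp
    exact h4 _
  refine ⟨fun t ht => (hG t ht).contMDiffWithinAt, hpath, fun t ht => ?_⟩
  have hm : (g (c * t)).proj ∈ frameNhd E F V (g (c * t)).proj := mem_frameNhd_self _
  have hm' : (G t).proj ∈ frameNhd E F V (g (c * t)).proj := hm
  rw [curveDeriv_eq_zero_iff hm' ((hG t ht).mdifferentiableAt (by simp)) (hpath t ht)]
  have h1 := (curveDeriv_eq_zero_iff hm (hg.mdifferentiableAt hJ ht) (hg.isAPath _ ht)).1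
    (hg.curveDeriv_eq_zero _ ht)
  have h2 := ((hg.contMDiffAt_coord hJ ht hm).2.differentiableAt (by simp)).hasDerivAt
  rw [h1] at h2
  have h3 := (h2.scomp t (hmul t)).const_smul c
  have h4 : (fun s => coord F V (g (c * t)).proj (G s).proj (G s).2) =
      fun s => c • coord F V (g (c * t)).proj (g (c * s)).proj (g (c * s)).2 :=
    funext fun s => map_smul _ _ _
  have h5 : coord F V (g (c * t)).proj (G t).proj (G t).2 =
      c • coord F V (g (c * t)).proj (g (c * t)).proj (g (c * t)).2 := congrFun h4 t
  rw [h4, h5]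
  refine h3.deriv.trans ?_
  change _ = - christoffel D _ (g (c * t)).proj _ _
  rw [map_smul, map_smul, _root_.smul_apply, smul_neg, smul_neg]

theorem IsGeodesicOn.congr {g g' : ℝ → TotalSpace F V} {J : Set ℝ} (hJ : IsOpen J)
    (hg : IsGeodesicOn D g J) (h : EqOn g' g J) : IsGeodesicOn D g' J := by
  have hev : ∀ t ∈ J, g' =ᶠ[𝓝 t] g := fun t ht => Filter.eventuallyEq_of_mem (hJ.mem_nhds ht) h
  have hpath : ∀ t ∈ J, A.anchor (g' t).proj (g' t).2 =
      mfderiv 𝓘(ℝ, ℝ) 𝓘(ℝ, E) (fun s => (g' s).proj) t (1 : ℝ) := by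
    intro t ht
    have h1 : (fun s => (g' s).proj) =ᶠ[𝓝 t] fun s => (g s).proj := (hev t ht).fun_comp _
    have h2 := h1.mfderiv_eq (I := 𝓘(ℝ, ℝ)) (I' := 𝓘(ℝ, E))
    have h3 : (A.anchor (g' t).proj (g' t).2 : E) = A.anchor (g t).proj (g t).2 := by
      rw [h ht]
    exact h3.trans ((hg.isAPath t ht).trans (congrArg (fun l : ℝ →L[ℝ] E => l 1) h2.symm))
  refine ⟨hg.contMDiffOn.congr h, hpath, fun t ht => ?_⟩
  have hm : (g t).proj ∈ frameNhd E F V (g t).proj := mem_frameNhd_self _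
  have hm' : (g' t).proj ∈ frameNhd E F V (g t).proj := by rw [h ht]; exact hm
  have hd : MDifferentiableAt 𝓘(ℝ, ℝ) (𝓘(ℝ, E).prod 𝓘(ℝ, F)) g' t :=
    (hg.mdifferentiableAt hJ ht).congr_of_eventuallyEq (hev t ht)
  rw [curveDeriv_eq_zero_iff hm' hd (hpath t ht)]
  have h1 := (curveDeriv_eq_zero_iff hm (hg.mdifferentiableAt hJ ht) (hg.isAPath _ ht)).1
    (hg.curveDeriv_eq_zero _ ht)
  rw [h ht, ← h1]
  exact Filter.EventuallyEq.deriv_eq ((hev t ht).fun_comp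
    fun u => coord F V (g t).proj u.proj u.2)

/-- The choices in the definition of the maximal geodesic fit together. -/
theorem geodesic_eq {a : TotalSpace F V} {t : ℝ} {J : Set ℝ} {g : ℝ → TotalSpace F V}
    (h : IsGeodesicThrough D a t J g) {s : ℝ} (hs : s ∈ J) : geodesic D a s = g s := by
  obtain ⟨hJ, hJc, h0, -, hg, hga⟩ := h
  have hex : ∃ J g, IsGeodesicThrough D a s J g := ⟨J, g, hJ, hJc, h0, hs, hg, hga⟩
  rw [geodesic, dif_pos hex]
  obtain ⟨hJ', hJc', h0', hs', hg', hga'⟩ := hex.choose_spec.choose_spec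
  exact (hg'.mono inter_subset_left).eqOn (hJ'.inter hJ) (hJc'.inter hJc)
    (hg.mono inter_subset_right) ⟨h0', h0⟩ (hga'.trans hga.symm) ⟨hs', hs⟩

theorem exists_isGeodesicThrough_geodesic {a : TotalSpace F V} {t : ℝ}
    (h : t ∈ geodesicDomain D a) : ∃ J, IsGeodesicThrough D a t J (geodesic D a) := by
  obtain ⟨J, g, hg⟩ := h
  have heq : EqOn (geodesic D a) g J := fun s hs => geodesic_eq hg hs
  obtain ⟨hJ, hJc, h0, ht, hgg, hga⟩ := hg
  exact ⟨J, hJ, hJc, h0, ht, hgg.congr hJ heq, (heq h0).trans hga⟩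

/-- `exp (t a) = t g_a(t)`, by rescaling the geodesic `g_a`. -/
theorem exp_smul {a : TotalSpace F V} (h : 1 ∈ geodesicDomain D a) {t : ℝ}
    (ht : t ∈ Icc (0 : ℝ) 1) : exp D ⟨a.proj, t • a.2⟩ =
      ⟨(geodesic D a t).proj, t • (geodesic D a t).2⟩ := by
  obtain ⟨J, hJ, hJc, h0, h1, hg, hga⟩ := exists_isGeodesicThrough_geodesic h
  have := geodesic_eq (D := D) (a := ⟨a.proj, t • a.2⟩) (t := 1) (s := 1) (J := (t * ·) ⁻¹' J)
    (g := fun s => ⟨(geodesic D a (t * s)).proj, t • (geodesic D a (t * s)).2⟩)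
    ⟨hJ.preimage (by fun_prop), hJc.preimage_mono fun _ _ h => mul_le_mul_of_nonneg_left h ht.1,
      by simpa using h0, by simpa using hJc.out h0 h1 ht, hg.scale hJ t, by
        change (⟨(geodesic D a (t * 0)).proj, t • (geodesic D a (t * 0)).2⟩ : TotalSpace F V) = _
        rw [mul_zero, hga]⟩ (by simpa using hJc.out h0 h1 ht)
  refine this.trans ?_
  rw [mul_one]

/-! ### One-forms whose Maurer-Cartan form is radially trivial -/

/-- The conditions on `φ`: it is smooth and anchored, normalised by the exponential map along the
radial direction, and its Maurer-Cartan form vanishes on the radial direction; its domain is open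
and star-shaped in each fibre. -/
structure IsRadialForm (nabla : CovariantDerivative 𝓘(ℝ, E) F V) (φ : OneForm D)
    (A₀ : Set (TotalSpace F V)) : Prop where
  isOpen : IsOpen A₀
  star : ∀ (x : M) (a : V x), (⟨x, a⟩ : TotalSpace F V) ∈ A₀ →
    ∀ t ∈ Icc (0 : ℝ) 1, (⟨x, t • a⟩ : TotalSpace F V) ∈ A₀
  dom : ∀ a ∈ A₀, (1 : ℝ) ∈ geodesicDomain D a
  smooth : IsSmoothOneForm φ A₀
  weak : ∀ (x : M) (a b : V x), (⟨x, a⟩ : TotalSpace F V) ∈ A₀ → maurerCartan nabla φ a a b = 0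
  anchored : IsAnchored φ A₀
  exp_eq : ∀ a ∈ A₀, φ a a.2 = (exp D a).2

namespace IsRadialForm

variable {nabla : CovariantDerivative 𝓘(ℝ, E) F V} {φ : OneForm D} {A₀ : Set (TotalSpace F V)}

theorem smul_mem (hφ : IsRadialForm nabla φ A₀) {x : M} {p : F} (hp : p ∈ fibreDomain A₀ x)
    {t : ℝ} (ht : t ∈ Icc (0 : ℝ) 1) : t • p ∈ fibreDomain A₀ x := by
  have := hφ.star x _ hp t ht
  rwa [← map_smul] at this

theorem exp_fibrePt_smul (hφ : IsRadialForm nabla φ A₀) {x : M} {p : F} (hp : p ∈ fibreDomain A₀ x)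
    {t : ℝ} (ht : t ∈ Icc (0 : ℝ) 1) : exp D (fibrePt F V x (t • p)) =
      ⟨(geodesic D (fibrePt F V x p) t).proj, t • (geodesic D (fibrePt F V x p) t).2⟩ := by
  rw [← exp_smul (hφ.dom _ hp) ht, fibrePt, fibrePt, map_smul]

theorem fibreTarget_smul (hφ : IsRadialForm nabla φ A₀) {x : M} {p : F}
    (hp : p ∈ fibreDomain A₀ x) {t : ℝ} (ht : t ∈ Icc (0 : ℝ) 1) :
    fibreTarget D x (t • p) = (geodesic D (fibrePt F V x p) t).proj := by
  rw [fibreTarget, target, hφ.exp_fibrePt_smul hp ht]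

theorem continuousAt_smul {p : F} (t : ℝ) : ContinuousAt (fun t : ℝ => t • p) t := by fun_prop

theorem fibreTarget_zero (hφ : IsRadialForm nabla φ A₀) {x : M} {p : F}
    (hp : p ∈ fibreDomain A₀ x) : fibreTarget D x 0 = x := by
  have h := hφ.fibreTarget_smul hp (t := 0) (by simp)
  obtain ⟨J, -, -, -, -, -, hga⟩ := exists_isGeodesicThrough_geodesic (hφ.dom _ hp)
  rw [hga, zero_smul] at h
  exact h

/-- The geodesic `g_a` is the value of `φ` on the radial direction: `φ_{ta}(a) = g_a(t)`. -/
theorem form_radial (hφ : IsRadialForm nabla φ A₀) {x : M} {p : F} (hp : p ∈ fibreDomain A₀ x)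
    {t : ℝ} (ht : t ∈ Icc (0 : ℝ) 1) :
    (⟨fibreTarget D x (t • p), φ (fibrePt F V x (t • p)) (uncoord F V x x p)⟩ : TotalSpace F V) =
      geodesic D (fibrePt F V x p) t := by
  have hpos : ∀ t ∈ Ioc (0 : ℝ) 1,
      (⟨fibreTarget D x (t • p), φ (fibrePt F V x (t • p)) (uncoord F V x x p)⟩ :
        TotalSpace F V) = geodesic D (fibrePt F V x p) t := by
    intro t ht
    have ht' : t ∈ Icc (0 : ℝ) 1 := ⟨ht.1.le, ht.2⟩
    have h1 := congrArg (fun u : TotalSpace F V => (⟨u.proj, t⁻¹ • u.2⟩ : TotalSpace F V))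
      (hφ.exp_fibrePt_smul hp ht')
    simp only [smul_smul, inv_mul_cancel₀ ht.1.ne', one_smul] at h1
    refine Eq.trans ?_ h1
    have h2 := hφ.exp_eq _ (hφ.smul_mem hp ht')
    rw [← h2]
    have h3 : (fibrePt F V x (t • p)).2 = t • uncoord F V x x p := map_smul _ _ _
    have h4 : φ (fibrePt F V x (t • p)) (fibrePt F V x (t • p)).2 =
        t • φ (fibrePt F V x (t • p)) (uncoord F V x x p) :=
      (congrArg (φ (fibrePt F V x (t • p))) h3).trans (map_smul (φ (fibrePt F V x (t • p))) t _)
    rw [h4, smul_smul, inv_mul_cancel₀ ht.1.ne', one_smul]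
    rfl
  rcases eq_or_lt_of_le ht.1 with rfl | h
  swap
  · exact hpos t ⟨h, ht.2⟩
  -- at time zero the equality holds by continuity
  obtain ⟨J, hJ, hJc, h0, -, hg, hga⟩ := exists_isGeodesicThrough_geodesic (hφ.dom _ hp)
  have hx := mem_frameNhd_self (E := E) (F := F) (V := V) x
  have htx : fibreTarget D x ((0 : ℝ) • p) = x := by rw [zero_smul, hφ.fibreTarget_zero hp]
  have hgx : (geodesic D (fibrePt F V x p) 0).proj = x := by rw [hga]; rfl
  have hd : (0 : ℝ) • p ∈ formDomain D A₀ x x := ⟨hφ.smul_mem hp ht, by rw [htx]; exact hx⟩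
  refine totalSpace_ext_coord (E := E) (m := x) hd.2 (htx.trans hgx.symm) ?_
  have c1 : ContinuousAt (fun t : ℝ => formCoord φ x x (t • p) p) 0 :=
    (ContinuousAt.comp (f := fun t : ℝ => t • p)
      (contDiffAt_formCoord hφ.isOpen hφ.smooth hd).continuousAt (continuousAt_smul 0)).clm_apply
      continuousAt_const
  have c2 := (hg.contMDiffAt_coord hJ h0 (m := x) (by rw [hgx]; exact hx)).2.continuousAt
  refine tendsto_nhds_unique (c1.tendsto.mono_left (nhdsWithin_le_nhds (s := Ioi 0)))
    ((c2.tendsto.mono_left (nhdsWithin_le_nhds (s := Ioi 0))).congr' ?_)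
  filter_upwards [Ioc_mem_nhdsGT (show (0 : ℝ) < 1 by norm_num)] with t ht
  rw [← hpos t ht]
  rfl

theorem mcForm_radial (hφ : IsRadialForm nabla φ A₀) {m x : M} {p : F}
    (hp : p ∈ formDomain D A₀ m x) (q : F) :
    mcForm (structureAlong D m x) (formCoord φ m x) p p q = 0 := by
  rw [← coord_maurerCartan hφ.isOpen hφ.smooth hφ.anchored nabla hp]
  exact (congrArg _ (hφ.weak x (uncoord F V x x p) (uncoord F V x x q) hp.1)).trans (map_zero _)

theorem smul_mem_formDomain (hφ : IsRadialForm nabla φ A₀) {m x : M} {p : F}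
    (hp : p ∈ fibreDomain A₀ x) {t : ℝ} (ht : t ∈ Icc (0 : ℝ) 1)
    (hm : (geodesic D (fibrePt F V x p) t).proj ∈ frameNhd E F V m) :
    t • p ∈ formDomain D A₀ m x :=
  ⟨hφ.smul_mem hp ht, by rw [hφ.fibreTarget_smul hp ht]; exact hm⟩

set_option synthInstance.maxHeartbeats 200000 in
/-- Along a ray the Maurer-Cartan form is differentiable, and its derivative is governed by the
Jacobiator. -/
theorem hasDerivAt_mcForm_ray (hφ : IsRadialForm nabla φ A₀) {m x : M} {p : F} {t : ℝ}
    (hp : t • p ∈ formDomain D A₀ m x) (q r : F) :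
    ∃ k', HasDerivAt (fun t : ℝ => mcForm (structureAlong D m x) (formCoord φ m x) (t • p) q r) k' t ∧
      t • k' + (2 : ℝ) • mcForm (structureAlong D m x) (formCoord φ m x) (t • p) q r +
        t • structureAlong D m x (t • p) (formCoord φ m x (t • p) p)
          (mcForm (structureAlong D m x) (formCoord φ m x) (t • p) q r) =
      - t • jacForm (structureAlong D m x) (formCoord φ m x) (t • p) p q r := by
  have hd := contDiffAt_mcForm hφ.isOpen hφ.smooth hp q r
  have h1 : HasDerivAt (fun t : ℝ => t • p) p t := by simpa using (hasDerivAt_id t).smul_const p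
  refine ⟨_, HasFDerivAt.comp_hasDerivAt (l := fun p => mcForm (structureAlong D m x)
    (formCoord φ m x) p q r) t (hd.differentiableAt (by simp)).hasFDerivAt h1, ?_⟩
  have h2 := fderiv_mcForm_radial (structureAlong_antisymm m x)
    ((contDiffAt_structureAlong hφ.isOpen hφ.smooth hp).differentiableAt (by simp))
    (contDiffAt_formCoord hφ.isOpen hφ.smooth hp) (by
      filter_upwards [(isOpen_formDomain hφ.isOpen hφ.smooth m x).mem_nhds hp] with p' hp' q
      exact hφ.mcForm_radial hp' q) q r
  rw [jacForm_smul_left, map_smul, map_smul, map_smul, _root_.smul_apply, ← neg_smul] at h2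
  exact h2

theorem mcForm_zero (hφ : IsRadialForm nabla φ A₀) {x : M} {p : F} (hp : p ∈ fibreDomain A₀ x)
    (q r : F) : mcForm (structureAlong D x x) (formCoord φ x x) 0 q r = 0 := by
  have h0 : (0 : ℝ) • p ∈ formDomain D A₀ x x := hφ.smul_mem_formDomain hp (by simp) (by
    rw [← hφ.fibreTarget_smul hp (by simp), zero_smul, hφ.fibreTarget_zero hp]
    exact mem_frameNhd_self x)
  have h := hφ.hasDerivAt_mcForm_ray h0 q r
  obtain ⟨k', -, h⟩ := h
  simpa using h

/-- The derivative at time zero of the Maurer-Cartan form along a ray. The equation along the ray,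
divided by `t`, has the limit `k' + 2 k' = - Jac` as `t` tends to zero. -/
theorem hasDerivAt_mcForm_ray_zero (hφ : IsRadialForm nabla φ A₀) {x : M} {p : F}
    (hp : p ∈ fibreDomain A₀ x) (q r : F) :
    ∃ k', HasDerivAt (fun t : ℝ => mcForm (structureAlong D x x) (formCoord φ x x) (t • p) q r)
      k' 0 ∧ jacForm (structureAlong D x x) (formCoord φ x x) 0 p q r = (-3 : ℝ) • k' := by
  set c := structureAlong D x x
  set Φ := formCoord φ x x
  have h0 : (0 : ℝ) • p ∈ formDomain D A₀ x x := hφ.smul_mem_formDomain hp (by simp) (by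
    rw [← hφ.fibreTarget_smul hp (by simp), zero_smul, hφ.fibreTarget_zero hp]
    exact mem_frameNhd_self x)
  have hsm := contDiffAt_mcForm hφ.isOpen hφ.smooth h0 q r
  have hray : ContDiffAt ℝ ∞ (fun t : ℝ => t • p) 0 := contDiffAt_id.smul contDiffAt_const
  set k : ℝ → F := fun t => mcForm c Φ (t • p) q r
  have hk : ContDiffAt ℝ ∞ k 0 :=
    ContDiffAt.comp (g := fun p => mcForm c Φ p q r) (0 : ℝ) hsm hray
  have hk0 : k 0 = 0 := by simp only [k, zero_smul]; exact hφ.mcForm_zero hp q r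
  have hkd := (hk.differentiableAt (by simp)).hasDerivAt
  refine ⟨deriv k 0, hkd, ?_⟩
  have cont : ∀ {G : Type _} [TopologicalSpace G] {f : F → G}, ContinuousAt f ((0 : ℝ) • p) →
      ContinuousAt (fun t : ℝ => f (t • p)) 0 := fun h =>
    ContinuousAt.comp (f := fun t : ℝ => t • p) h (continuousAt_smul 0)
  have cΦ := cont (contDiffAt_formCoord hφ.isOpen hφ.smooth h0).continuousAt
  have cc := cont (contDiffAt_structureAlong hφ.isOpen hφ.smooth h0).continuousAt
  have cj := cont (continuousAt_jacForm hφ.isOpen hφ.smooth h0 p q r)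
  have ck : ContinuousAt (deriv k) 0 := by
    have h1 := ((hk.fderiv_right (m := ∞) (by simp)).continuousAt).clm_apply
      (continuousAt_const (y := (1 : ℝ)))
    exact h1
  have hslope := hasDerivAt_iff_tendsto_slope_zero.1 hkd
  -- `t⁻¹ k(t)` tends to `k'(0)` because `k(0) = 0`
  have hlim : Filter.Tendsto (fun t : ℝ => deriv k t + (2 : ℝ) • (t⁻¹ • k t) +
      c (t • p) (Φ (t • p) p) (k t)) (𝓝[≠] 0)
      (𝓝 (deriv k 0 + (2 : ℝ) • deriv k 0 + c ((0 : ℝ) • p) (Φ ((0 : ℝ) • p) p) (k 0))) := by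
    refine ((ck.tendsto.mono_left nhdsWithin_le_nhds).add (Filter.Tendsto.const_smul ?_ _)).add ?_
    · simpa [hk0] using hslope
    · exact ((cc.clm_apply (cΦ.clm_apply continuousAt_const)).clm_apply
        hk.continuousAt).tendsto.mono_left nhdsWithin_le_nhds
  have heq : ∀ᶠ t : ℝ in 𝓝[≠] 0, deriv k t + (2 : ℝ) • (t⁻¹ • k t) + c (t • p) (Φ (t • p) p) (k t) =
      - jacForm c Φ (t • p) p q r := by
    have h1 : ∀ᶠ t : ℝ in 𝓝 0, t • p ∈ formDomain D A₀ x x :=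
      (continuousAt_smul 0) ((isOpen_formDomain hφ.isOpen hφ.smooth x x).mem_nhds h0)
    filter_upwards [h1.filter_mono nhdsWithin_le_nhds, self_mem_nhdsWithin] with t ht htne
    obtain ⟨k', hk', h2⟩ := hφ.hasDerivAt_mcForm_ray ht q r
    have h3 := congrArg (t⁻¹ • ·) h2
    have htne : t ≠ 0 := htne
    simp only [smul_add, smul_smul, neg_smul, smul_neg, inv_mul_cancel₀ htne, one_smul] at h3
    rw [hk'.deriv, ← h3, smul_smul, mul_comm (2 : ℝ)]
  have h4 := tendsto_nhds_unique (hlim.congr' heq) (cj.tendsto.mono_left nhdsWithin_le_nhds).neg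
  rw [hk0, map_zero, add_zero, zero_smul] at h4
  rw [← neg_eq_iff_eq_neg.2 h4]
  module

end IsRadialForm

end PreLieAlgebroid

/-! ### Linear differential equations -/

/-- A continuous linear map commutes with derivatives of curves; the source and the target need not
be normed. -/
theorem hasDerivWithinAt_clm_comp {W W' : Type*} [AddCommGroup W] [Module ℝ W] [TopologicalSpace W]
    [ContinuousSMul ℝ W] [AddCommGroup W'] [Module ℝ W'] [TopologicalSpace W']
    [ContinuousSMul ℝ W'] (l : W →L[ℝ] W') {f : ℝ → W} {f' : W} {s : Set ℝ} {t : ℝ}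
    (h : HasDerivWithinAt f f' s t) : HasDerivWithinAt (fun t => l (f t)) (l f') s t := by
  refine HasFDerivAtFilter.of_isLittleOTVS ?_
  refine ((l.isBigOTVS_comp).trans_isLittleOTVS h.isLittleOTVS).congr_left fun p => ?_
  change l (f p.1 - f p.2 - (p.1 - p.2) • f') = l (f p.1) - l (f p.2) - (p.1 - p.2) • l f'
  rw [map_sub, map_sub, map_smul]

/-- Local solvability of the linear equation `Q' = Q B` on an interval, by invertible elements. -/
theorem exists_local_fundamental_solution {R : Type*} [NormedRing R] [NormedAlgebra ℝ R]
    [CompleteSpace R] {B : ℝ → R} {S : Set ℝ} {t₀ : ℝ} (ht₀ : t₀ ∈ Icc (0 : ℝ) 1)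
    (hS : S ∈ 𝓝[Icc 0 1] t₀) (hB : ContinuousOn B S) :
    ∃ U ∈ 𝓝 t₀, U ∩ Icc 0 1 ⊆ S ∧ ∃ Q : ℝ → R, ∀ t ∈ U ∩ Icc 0 1, IsUnit (Q t) ∧
      HasDerivWithinAt Q (Q t * B t) (U ∩ Icc 0 1) t := by
  -- `K` bounds `B` near `t₀`, and `L` bounds `Y * B t` for `Y` in the unit ball around `1`
  set K : ℝ := ‖B t₀‖ + 1
  have hK : 0 ≤ K := by positivity
  have ht₀S : t₀ ∈ S := mem_of_mem_nhdsWithin ht₀ hS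
  have hBK : ∀ᶠ t in 𝓝[Icc 0 1] t₀, t ∈ S ∧ ‖B t‖ ≤ K := by
    refine Filter.Eventually.and hS ?_
    have h1 : ContinuousWithinAt B (S ∩ Icc 0 1) t₀ := (hB t₀ ht₀S).mono inter_subset_left
    have h2 : ContinuousWithinAt B (Icc 0 1) t₀ :=
      h1.mono_of_mem_nhdsWithin (Filter.inter_mem hS self_mem_nhdsWithin)
    exact (h2.norm.eventually_lt_const (lt_add_one _)).mono fun _ h => h.le
  obtain ⟨ε, hε, hεB⟩ := Metric.mem_nhdsWithin_iff.1 hBK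
  set L : ℝ := (‖(1 : R)‖ + 1) * K
  have hL : 0 ≤ L := by positivity
  set δ : ℝ := min (ε / 2) (1 / (L + 1))
  have hδ : 0 < δ := by positivity
  have hLδ : L * δ ≤ 1 := by
    calc L * δ ≤ L * (1 / (L + 1)) := mul_le_mul_of_nonneg_left (min_le_right _ _) hL
      _ ≤ 1 := by rw [mul_one_div, div_le_one (by positivity)]; linarith
  set lo := max 0 (t₀ - δ)
  set hi := min 1 (t₀ + δ)
  have hlo : lo ≤ t₀ := max_le ht₀.1 (by linarith)
  have hhi : t₀ ≤ hi := le_min ht₀.2 (by linarith)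
  have hsub : ∀ t ∈ Icc lo hi, t ∈ S ∧ ‖B t‖ ≤ K := by
    intro t ht
    refine hεB ⟨?_, (le_max_left _ _).trans ht.1, ht.2.trans (min_le_left _ _)⟩
    have h1 : t₀ - δ ≤ t := (le_max_right _ _).trans ht.1
    have h2 : t ≤ t₀ + δ := ht.2.trans (min_le_right _ _)
    have h3 : δ < ε := (min_le_left _ _).trans_lt (half_lt_self hε)
    rw [Metric.mem_ball, Real.dist_eq, abs_lt]
    constructor <;> linarith
  have hPL : IsPicardLindelof (fun t (Y : R) => Y * B t) (tmin := lo) (tmax := hi)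
      ⟨t₀, hlo, hhi⟩ 1 1 0 ⟨L, hL⟩ ⟨K, hK⟩ := by
    refine ⟨fun t ht => LipschitzOnWith.of_dist_le_mul fun Y _ Z _ => ?_, fun Y _ =>
      continuousOn_const.mul (hB.mono fun t ht => (hsub t ht).1), fun t ht Y hY => ?_, ?_⟩
    · rw [dist_eq_norm, dist_eq_norm, ← sub_mul]
      refine (norm_mul_le _ _).trans ?_
      rw [mul_comm]
      exact mul_le_mul_of_nonneg_right (hsub t ht).2 (norm_nonneg (Y - Z))
    · refine (norm_mul_le _ _).trans (mul_le_mul ?_ (hsub t ht).2 (norm_nonneg (B t)) (by positivity))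
      have h1 : ‖Y - 1‖ ≤ 1 := by simpa [dist_eq_norm] using hY
      calc ‖Y‖ = ‖1 + (Y - 1)‖ := by rw [add_sub_cancel]
        _ ≤ ‖(1 : R)‖ + 1 := (norm_add_le _ _).trans (by linarith)
    · have h1 : max (hi - t₀) (t₀ - lo) ≤ δ := by
        refine max_le ?_ ?_
        · have : hi ≤ t₀ + δ := min_le_right _ _
          linarith
        · have : t₀ - δ ≤ lo := le_max_right _ _
          linarith
      have h2 := (mul_le_mul_of_nonneg_left h1 hL).trans hLδ
      change L * max (hi - t₀) (t₀ - lo) ≤ (1 : ℝ) - 0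
      rwa [sub_zero]
  -- the solution with the initial value `1` stays invertible for a short time
  obtain ⟨Q, hQ0, hQ⟩ := hPL.exists_eq_forall_mem_Icc_hasDerivWithinAt₀
  have hQc : ContinuousWithinAt Q (Icc lo hi) t₀ := (hQ t₀ ⟨hlo, hhi⟩).continuousWithinAt
  have hunit : {t | IsUnit (Q t)} ∈ 𝓝[Icc lo hi] t₀ :=
    hQc (Units.isOpen.mem_nhds (by
      change IsUnit (Q t₀); rw [show Q t₀ = 1 from hQ0]; exact isUnit_one))
  obtain ⟨U, hU, hUQ⟩ := mem_nhdsWithin_iff_exists_mem_nhds_inter.1 hunit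
  have hUsub : U ∩ Icc (t₀ - δ) (t₀ + δ) ∩ Icc 0 1 ⊆ Icc lo hi := fun t ht =>
    ⟨max_le ht.2.1 ht.1.2.1, le_min ht.2.2 ht.1.2.2⟩
  refine ⟨U ∩ Icc (t₀ - δ) (t₀ + δ), Filter.inter_mem hU (Icc_mem_nhds (by linarith) (by linarith)),
    fun t ht => (hsub t (hUsub ht)).1, Q, fun t ht => ⟨hUQ ⟨ht.1.1, hUsub ht⟩, ?_⟩⟩
  exact (hQ t (hUsub ht)).mono hUsub

/-! ### The infinitesimal flow of a time dependent section -/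

namespace PreLieAlgebroid

variable (A : PreLieAlgebroid E F V)

/-- A smooth curve `γ` along which the time dependent section `ξ` is smooth, and which is an
integral curve of `ρ(ξ)`. -/
structure IsAnchoredCurve (ξ : ℝ → Section E F V) (γ : ℝ → M) : Prop where
  smooth_section : ∀ t ∈ Icc (0 : ℝ) 1, ContMDiffAt (𝓘(ℝ, ℝ).prod 𝓘(ℝ, E))
    (𝓘(ℝ, E).prod 𝓘(ℝ, F)) ∞ (fun p : ℝ × M => TotalSpace.mk' F p.2 (ξ p.1 p.2)) (t, γ t)
  smooth_curve : ∀ t ∈ Icc (0 : ℝ) 1, ContMDiffAt 𝓘(ℝ, ℝ) 𝓘(ℝ, E) ∞ γ t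
  velocity : ∀ t ∈ Icc (0 : ℝ) 1, mfderiv 𝓘(ℝ, ℝ) 𝓘(ℝ, E) γ t (1 : ℝ) =
    A.anchor (γ t) (ξ t (γ t))

/-- The operator `v ↦ [ξᵗ, v]` at the point `γ t`, in the local frame at `m`. -/
def bracketOperator (ξ : ℝ → Section E F V) (γ : ℝ → M) (m : M) (t : ℝ) : F →L[ℝ] F :=
  LinearMap.toContinuousLinearMap ((coord F V m (γ t)).toLinearMap ∘ₗ evalSection E F V (γ t) ∘ₗ
    A.bracket (ξ t) ∘ₗ frame E F V m)

theorem bracketOperator_apply (ξ : ℝ → Section E F V) (γ : ℝ → M) (m : M) (t : ℝ) (v : F) :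
    A.bracketOperator ξ γ m t v = coord F V m (γ t) (A.bracket (ξ t) (frame E F V m v) (γ t)) := rfl

/-- In a local frame, `[ξ, α]` along an integral curve is the derivative of `α` along the curve plus
a zeroth order operator. -/
theorem coord_bracket_eq {ξ : ℝ → Section E F V} {γ : ℝ → M} {m : M} {t : ℝ}
    (hm : γ t ∈ frameNhd E F V m) (α : Section E F V) :
    coord F V m (γ t) (A.bracket (ξ t) α (γ t)) =
      mvfderiv 𝓘(ℝ, E) (fun y => coord F V m y (α y)) (γ t) (A.anchor (γ t) (ξ t (γ t))) +
      A.bracketOperator ξ γ m t (coord F V m (γ t) (α (γ t))) :=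
  (A.isDerivationAlong_bracket (ξ t) (γ t)).coord_eq hm α

theorem bracketOperator_eq {ξ : ℝ → Section E F V} {γ : ℝ → M} {m : M} {t : ℝ}
    (hm : γ t ∈ frameNhd E F V m) (v : F) :
    A.bracketOperator ξ γ m t v =
      - mvfderiv 𝓘(ℝ, E) (fun y => coord F V m y (ξ t y)) (γ t)
        (A.anchor (γ t) (frame E F V m v (γ t))) +
      A.structureMap m (γ t) (coord F V m (γ t) (ξ t (γ t))) v := by
  have h2 : (fun y => coord F V m y (frame E F V m v y)) =ᶠ[𝓝 (γ t)] fun _ => v := by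
    filter_upwards [frameNhd_mem_nhds hm] with y hy
    exact coord_frame hy v
  have h3 : mvfderiv 𝓘(ℝ, E) (fun _ : M => v) (γ t) = 0 := by
    ext; simp [mvfderiv, mfderiv_const]
  rw [bracketOperator_apply, A.coord_bracket hm, mvfderiv_congr h2, h3, coord_frame hm,
    _root_.zero_apply, zero_sub]

variable {A}

theorem IsAnchoredCurve.continuousOn_bracketOperator {ξ : ℝ → Section E F V} {γ : ℝ → M}
    (h : A.IsAnchoredCurve ξ γ) (m : M) :
    ContinuousOn (A.bracketOperator ξ γ m) (Icc 0 1 ∩ γ ⁻¹' frameNhd E F V m) := by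
  rw [continuousOn_clm_apply]
  intro v
  have h1 : ContinuousOn (fun t => - mvfderiv 𝓘(ℝ, E) (fun y => coord F V m y (ξ t y)) (γ t)
        (A.anchor (γ t) (frame E F V m v (γ t))) +
      A.structureMap m (γ t) (coord F V m (γ t) (ξ t (γ t))) v)
      (Icc 0 1 ∩ γ ⁻¹' frameNhd E F V m) := by
    intro t ht
    have hc := h.smooth_curve t ht.1
    have hξ : ContMDiffAt (𝓘(ℝ, ℝ).prod 𝓘(ℝ, E)) 𝓘(ℝ, F) ∞
        (Function.uncurry fun t y => coord F V m y (ξ t y)) (t, γ t) :=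
      ((contMDiffAt_iff_coord (m := m) (p := (t, γ t))
        (u := fun p : ℝ × M => TotalSpace.mk' F p.2 (ξ p.1 p.2)) (mem_baseSet ht.2)).1
        (h.smooth_section t ht.1)).2
    have hf := (A.contMDiff_anchor_section (frame E F V m v) (γ t)).comp t hc
    have c1 := (contMDiffAt_mvfderiv_apply (f := fun t y => coord F V m y (ξ t y)) (g := γ)
      hξ hf).continuousAt
    have c2 : ContinuousAt (fun t => coord F V m (γ t) (ξ t (γ t))) t :=
      ContinuousAt.comp (f := fun t => (t, γ t)) hξ.continuousAt
        (continuousAt_id.prodMk hc.continuousAt)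
    have c3 : ContinuousOn (fun y => A.structureMap m y) (frameNhd E F V m) := by
      rw [continuousOn_clm_apply]
      intro w
      rw [continuousOn_clm_apply]
      exact fun w' y hy => (A.contMDiffAt_structureMap_apply hy w w').continuousAt.continuousWithinAt
    have c4 : ContinuousAt (fun t => A.structureMap m (γ t)) t :=
      ContinuousAt.comp (g := fun y => A.structureMap m y)
        (c3.continuousAt (frameNhd_mem_nhds ht.2)) hc.continuousAt
    exact (c1.neg.add ((c4.clm_apply c2).clm_apply continuousAt_const)).continuousWithinAt
  exact h1.congr fun t ht => A.bracketOperator_eq ht.2 v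

variable (A) in
/-- Linear isomorphisms `R t` of the fibres along `γ` with the fixed vector space `F`, for which the
derivative of sections along `γ` becomes the bracket with `ξ`. -/
structure IsParallelFrame (ξ : ℝ → Section E F V) (γ : ℝ → M) (R : ∀ t, V (γ t) →L[ℝ] F)
    (s : Set ℝ) : Prop where
  bijective : ∀ t ∈ s, Function.Bijective (R t)
  hasDeriv : ∀ t ∈ s, ∀ α : Section E F V, HasDerivWithinAt (fun t => R t (α (γ t)))
    (R t (A.bracket (ξ t) α (γ t))) s t

theorem IsParallelFrame.mono {ξ : ℝ → Section E F V} {γ : ℝ → M} {R : ∀ t, V (γ t) →L[ℝ] F}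
    {s s' : Set ℝ} (h : A.IsParallelFrame ξ γ R s) (hs : s' ⊆ s) : A.IsParallelFrame ξ γ R s' :=
  ⟨fun t ht => h.bijective t (hs ht), fun t ht α => (h.hasDeriv t (hs ht) α).mono hs⟩

theorem coord_bijective {m y : M} (hy : y ∈ (trivializationAt F V m).baseSet) :
    Function.Bijective (coord F V m y) :=
  ⟨coord_injective hy, fun v => ⟨_, coord_uncoord hy v⟩⟩

theorem IsAnchoredCurve.hasDerivAt_coord {ξ : ℝ → Section E F V} {γ : ℝ → M}
    (h : A.IsAnchoredCurve ξ γ) {t : ℝ} (ht : t ∈ Icc (0 : ℝ) 1) {m : M}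
    (hm : γ t ∈ frameNhd E F V m) (α : Section E F V) :
    HasDerivAt (fun t => coord F V m (γ t) (α (γ t)))
      (mvfderiv 𝓘(ℝ, E) (fun y => coord F V m y (α y)) (γ t) (A.anchor (γ t) (ξ t (γ t)))) t := by
  have h1 := (hasFDerivAt_comp_mvfderiv (u := γ)
    ((contMDiffAt_coord (mem_baseSet hm) α).mdifferentiableAt (by simp))
    ((h.smooth_curve t ht).mdifferentiableAt (by simp))).hasDerivAt
  exact h1.congr_deriv (congrArg (mvfderiv 𝓘(ℝ, E) (fun y => coord F V m y (α y)) (γ t))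
    (h.velocity t ht))

/-- If `B` is the matrix of `[ξ, ·]` in a local frame and `Q' = Q B`, then `Q` composed with the
coordinate of the frame is a parallel frame. -/
theorem IsAnchoredCurve.exists_isParallelFrame_local {ξ : ℝ → Section E F V} {γ : ℝ → M}
    (h : A.IsAnchoredCurve ξ γ) {t₀ : ℝ} (ht₀ : t₀ ∈ Icc (0 : ℝ) 1) :
    ∃ U ∈ 𝓝 t₀, ∃ R, A.IsParallelFrame ξ γ R (U ∩ Icc 0 1) := by
  have hS : Icc 0 1 ∩ γ ⁻¹' frameNhd E F V (γ t₀) ∈ 𝓝[Icc 0 1] t₀ :=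
    Filter.inter_mem self_mem_nhdsWithin (mem_nhdsWithin_of_mem_nhds
      ((h.smooth_curve t₀ ht₀).continuousAt (frameNhd_mem_nhds (mem_frameNhd_self _))))
  obtain ⟨U, hU, hUS, Q, hQ⟩ := exists_local_fundamental_solution (R := F →L[ℝ] F) ht₀ hS
    (h.continuousOn_bracketOperator (γ t₀))
  refine ⟨U, hU, fun t => (Q t).comp (coord F V (γ t₀) (γ t)), fun t ht => ?_, fun t ht α => ?_⟩
  · have hm : γ t ∈ frameNhd E F V (γ t₀) := (hUS ht).2
    obtain ⟨q, hq⟩ := (hQ t ht).1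
    have hb : Function.Bijective (Q t) := by
      rw [← hq]
      exact (ContinuousLinearEquiv.ofUnit q).bijective
    exact hb.comp (coord_bijective (mem_baseSet hm))
  · have hm : γ t ∈ frameNhd E F V (γ t₀) := (hUS ht).2
    have h1 := (hQ t ht).2.clm_apply (h.hasDerivAt_coord ht.2 hm α).hasDerivWithinAt
    refine h1.congr_deriv ?_
    change Q t (A.bracketOperator ξ γ (γ t₀) t _) + _ = Q t (coord F V (γ t₀) (γ t) _)
    rw [A.coord_bracket_eq hm, map_add, add_comm]

/-- Parallel frames over adjacent intervals can be matched, by composing the second one with a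
constant isomorphism. -/
theorem IsParallelFrame.glue {ξ : ℝ → Section E F V} {γ : ℝ → M} {R R' : ∀ t, V (γ t) →L[ℝ] F}
    {a b c : ℝ} (hab : a ≤ b) (hbc : b ≤ c) (h : A.IsParallelFrame ξ γ R (Icc a b))
    (h' : A.IsParallelFrame ξ γ R' (Icc b c)) : ∃ R, A.IsParallelFrame ξ γ R (Icc a c) := by
  classical
  have hb : b ∈ Icc a b := ⟨hab, le_rfl⟩
  have hb' : b ∈ Icc b c := ⟨le_rfl, hbc⟩
  set e := LinearEquiv.ofBijective (R' b).toLinearMap (h'.bijective b hb')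
  set e₀ := LinearEquiv.ofBijective (R b).toLinearMap (h.bijective b hb)
  set T : F →L[ℝ] F := LinearMap.toContinuousLinearMap (e.symm.trans e₀ : F →ₗ[ℝ] F)
  have hT : Function.Bijective T := (e.symm.trans e₀).bijective
  have hTb : ∀ v, T (R' b v) = R b v := fun v =>
    congrArg (R b) (e.symm_apply_apply v)
  let R₂ : ∀ t, V (γ t) →L[ℝ] F := fun t => if t ≤ b then R t else T.comp (R' t)
  have e1 : ∀ t ∈ Icc a b, R₂ t = R t := fun t ht => if_pos ht.2
  have e2 : ∀ t ∈ Icc b c, R₂ t = T.comp (R' t) := fun t ht => by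
    rcases eq_or_lt_of_le ht.1 with rfl | hlt
    · rw [e1 b hb]
      ext v
      exact (hTb v).symm
    · exact if_neg (not_le.2 hlt)
  refine ⟨R₂, fun t ht => ?_, fun t ht α => ?_⟩
  · rcases le_total t b with htb | htb
    · rw [e1 t ⟨ht.1, htb⟩]; exact h.bijective t ⟨ht.1, htb⟩
    · rw [e2 t ⟨htb, ht.2⟩]; exact hT.comp (h'.bijective t ⟨htb, ht.2⟩)
  · have d1 : t ∈ Icc a b → HasDerivWithinAt (fun t => R₂ t (α (γ t)))
        (R₂ t (A.bracket (ξ t) α (γ t))) (Icc a b) t := fun ht => by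
      rw [e1 t ht]
      exact (h.hasDeriv t ht α).congr (fun s hs => by rw [e1 s hs]) (by rw [e1 t ht])
    have d2 : t ∈ Icc b c → HasDerivWithinAt (fun t => R₂ t (α (γ t)))
        (R₂ t (A.bracket (ξ t) α (γ t))) (Icc b c) t := fun ht => by
      rw [e2 t ht]
      exact (hasDerivWithinAt_clm_comp T (h'.hasDeriv t ht α)).congr
        (fun s hs => by rw [e2 s hs]; rfl) (by rw [e2 t ht]; rfl)
    rcases lt_trichotomy t b with htb | rfl | htb
    · refine (d1 ⟨ht.1, htb.le⟩).mono_of_mem_nhdsWithin ?_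
      filter_upwards [mem_nhdsWithin_of_mem_nhds (Iio_mem_nhds htb), self_mem_nhdsWithin] with s h1 h2
      exact ⟨h2.1, h1.le⟩
    · rw [← Icc_union_Icc_eq_Icc hab hbc]
      exact (d1 hb).union (d2 hb')
    · refine (d2 ⟨htb.le, ht.2⟩).mono_of_mem_nhdsWithin ?_
      filter_upwards [mem_nhdsWithin_of_mem_nhds (Ioi_mem_nhds htb), self_mem_nhdsWithin] with s h1 h2
      exact ⟨h1.le, h2.2⟩

theorem IsAnchoredCurve.exists_isParallelFrame {ξ : ℝ → Section E F V} {γ : ℝ → M}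
    (h : A.IsAnchoredCurve ξ γ) : ∃ R, A.IsParallelFrame ξ γ R (Icc 0 1) := by
  have h01 : (0 : ℝ) ≤ 1 := zero_le_one
  have hloc : ∀ t₀ : Icc (0 : ℝ) 1, ∃ U : Set ℝ, IsOpen U ∧ (t₀ : ℝ) ∈ U ∧
      ∃ R, A.IsParallelFrame ξ γ R (U ∩ Icc 0 1) := fun t₀ => by
    obtain ⟨U, hU, R, hR⟩ := h.exists_isParallelFrame_local t₀.2
    obtain ⟨U', hU', hUo, ht⟩ := mem_nhds_iff.1 hU
    exact ⟨U', hUo, ht, R, hR.mono (inter_subset_inter_left _ hU')⟩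
  choose U hUo hU R hR using hloc
  obtain ⟨τ, hτ0, hτm, ⟨N, hN⟩, hτ⟩ := exists_monotone_Icc_subset_open_cover_Icc h01
    (c := fun t₀ => Subtype.val ⁻¹' U t₀) (fun t₀ => (hUo t₀).preimage continuous_subtype_val)
    (fun t₀ _ => mem_iUnion.2 ⟨t₀, hU t₀⟩)
  have hstep : ∀ n, ∃ R, A.IsParallelFrame ξ γ R (Icc (τ n : ℝ) (τ (n + 1))) := fun n => by
    obtain ⟨i, hi⟩ := hτ n
    refine ⟨R i, (hR i).mono fun t ht => ?_⟩
    have ht' : t ∈ Icc (0 : ℝ) 1 := ⟨(τ n).2.1.trans ht.1, ht.2.trans (τ (n + 1)).2.2⟩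
    exact ⟨hi (show (⟨t, ht'⟩ : Icc (0 : ℝ) 1) ∈ Icc (τ n) (τ (n + 1)) from ht), ht'⟩
  have hind : ∀ n, ∃ R, A.IsParallelFrame ξ γ R (Icc (0 : ℝ) (τ (n + 1))) := fun n => by
    induction n with
    | zero => have := hstep 0; rwa [hτ0] at this
    | succ n ih =>
      obtain ⟨R, hR⟩ := ih
      obtain ⟨R', hR'⟩ := hstep (n + 1)
      exact hR.glue (τ (n + 1)).2.1 (hτm (Nat.le_succ _)) hR'
  have := hind N
  rwa [hN (N + 1) (Nat.le_succ N)] at this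

/-- A parallel frame `R` gives the infinitesimal flow `ψ^{t,s} = R_t⁻¹ ∘ R_s`. -/
theorem IsAnchoredCurve.isInfinitesimalFlow {ξ : ℝ → Section E F V} {γ : ℝ → M}
    (h : A.IsAnchoredCurve ξ γ) : A.IsInfinitesimalFlow ξ γ (A.infinitesimalFlow ξ γ) := by
  classical
  suffices hex : ∃ ψ, A.IsInfinitesimalFlow ξ γ ψ by
    rw [infinitesimalFlow, dif_pos hex]
    exact hex.choose_spec
  obtain ⟨R, hR⟩ := h.exists_isParallelFrame
  let e : ∀ t, t ∈ Icc (0 : ℝ) 1 → V (γ t) ≃ₗ[ℝ] F := fun t ht =>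
    LinearEquiv.ofBijective (R t).toLinearMap (hR.bijective t ht)
  let P : ∀ t, F →ₗ[ℝ] V (γ t) := fun t =>
    if ht : t ∈ Icc (0 : ℝ) 1 then (e t ht).symm.toLinearMap else 0
  have hP : ∀ t (ht : t ∈ Icc (0 : ℝ) 1), P t = (e t ht).symm.toLinearMap := fun t ht => dif_pos ht
  have hPR : ∀ t ∈ Icc (0 : ℝ) 1, ∀ v, P t (R t v) = v := fun t ht v => by
    rw [hP t ht]; exact (e t ht).symm_apply_apply v
  have hRP : ∀ t ∈ Icc (0 : ℝ) 1, ∀ v, R t (P t v) = v := fun t ht v => by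
    rw [hP t ht]; exact (e t ht).apply_symm_apply v
  refine ⟨fun t s => P t ∘ₗ (R s).toLinearMap, fun s _ t ht u _ => ?_, fun s hs => ?_,
    fun s hs α => ?_⟩
  · ext v
    exact congrArg (P u) (hRP t ht (R s v))
  · ext v
    exact hPR s hs v
  · have h1 := hasDerivWithinAt_clm_comp (LinearMap.toContinuousLinearMap (P s)) (hR.hasDeriv s hs α)
    have h2 : LinearMap.toContinuousLinearMap (P s) (R s (A.bracket (ξ s) α (γ s))) =
      A.bracket (ξ s) α (γ s) := hPR s hs _
    rw [h2] at h1
    exact h1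

end PreLieAlgebroid

/-! ### Derivatives along the infinitesimal flow -/

/-- Linear maps out of a fibre are continuous. -/
def fibreCLM {G : Type*} [NormedAddCommGroup G] [NormedSpace ℝ G] {x : M} (T : V x →ₗ[ℝ] G) :
    V x →L[ℝ] G :=
  (LinearMap.toContinuousLinearMap (T ∘ₗ (uncoord F V x x).toLinearMap)).comp (coord F V x x)

theorem fibreCLM_apply {G : Type*} [NormedAddCommGroup G] [NormedSpace ℝ G] {x : M}
    (T : V x →ₗ[ℝ] G) (v : V x) : fibreCLM (F := F) T v = T v :=
  congrArg T (uncoord_coord (mem_baseSet_self x) v)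

theorem coord_fiberCast {m x y : M} (h : x = y) (v : V x) :
    coord F V m y (fiberCast v : V y) = coord F V m x v := by
  subst h
  rw [fiberCast, dif_pos rfl]

/-- The expansion of a vector in a local frame. -/
theorem exists_frame_expansion (E F : Type*) [NormedAddCommGroup E] [NormedSpace ℝ E]
    [FiniteDimensional ℝ E] [NormedAddCommGroup F] [NormedSpace ℝ F] [FiniteDimensional ℝ F]
    {M : Type*} [TopologicalSpace M] [ChartedSpace E M] [T2Space M] [IsManifold 𝓘(ℝ, E) ∞ M]
    {V : M → Type*} [TopologicalSpace (TotalSpace F V)]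
    [∀ x, AddCommGroup (V x)] [∀ x, Module ℝ (V x)] [∀ x, TopologicalSpace (V x)]
    [∀ x, IsTopologicalAddGroup (V x)] [∀ x, ContinuousSMul ℝ (V x)]
    [FiberBundle F V] [VectorBundle ℝ F V] [ContMDiffVectorBundle ∞ F V 𝓘(ℝ, E)] (m : M) :
    ∃ (ι : Type) (_ : Fintype ι) (b : ι → F) (c : ι → F →L[ℝ] ℝ),
      (∀ v, ∑ i, c i v • b i = v) ∧ ∀ y ∈ frameNhd E F V m, ∀ v : V y,
        v = ∑ i, c i (coord F V m y v) • frame E F V m (b i) y := by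
  set b := Module.finBasis ℝ F
  have hs : ∀ v, ∑ i, (b.coord i).toContinuousLinearMap v • b i = v := b.sum_repr
  refine ⟨_, inferInstance, b, fun i => (b.coord i).toContinuousLinearMap, hs, fun y hy v => ?_⟩
  apply coord_injective (mem_baseSet hy)
  conv_lhs => rw [← hs (coord F V m y v)]
  rw [map_sum]
  refine Finset.sum_congr rfl fun i _ => ?_
  rw [map_smul, coord_frame hy]

namespace PreLieAlgebroid

variable {A : PreLieAlgebroid E F V} {ξ : ℝ → Section E F V} {γ : ℝ → M}
  {ψ : ∀ t s : ℝ, V (γ s) →ₗ[ℝ] V (γ t)} {G : Type*} [NormedAddCommGroup G] [NormedSpace ℝ G]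

/-- The defining property of the infinitesimal flow at a time `t` different from `s`. -/
theorem IsInfinitesimalFlow.hasDerivWithinAt_section (hψ : A.IsInfinitesimalFlow ξ γ ψ)
    {s t : ℝ} (hs : s ∈ Icc (0 : ℝ) 1) (ht : t ∈ Icc (0 : ℝ) 1) (l : V (γ s) →L[ℝ] G)
    (α : Section E F V) : HasDerivWithinAt (fun u => l (ψ s u (α (γ u))))
      (l (ψ s t (A.bracket (ξ t) α (γ t)))) (Icc 0 1) t := by
  have h1 := hasDerivWithinAt_clm_comp (fibreCLM (F := F) (l.toLinearMap ∘ₗ ψ s t))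
    (hψ.hasDeriv t ht α)
  simp only [fibreCLM_apply] at h1
  have h2 : ∀ u ∈ Icc (0 : ℝ) 1, ∀ v : V (γ u), l (ψ s t (ψ t u v)) = l (ψ s u v) :=
    fun u hu v => congrArg (fun T => l (T v)) (hψ.comp u hu t ht s hs)
  exact h1.congr (fun u hu => (h2 u hu _).symm) (h2 t ht _).symm

theorem IsAnchoredCurve.eventually_mem (h : A.IsAnchoredCurve ξ γ) {t : ℝ}
    (ht : t ∈ Icc (0 : ℝ) 1) {m : M} (hm : γ t ∈ frameNhd E F V m) :
    ∀ᶠ u in 𝓝[Icc 0 1] t, γ u ∈ frameNhd E F V m :=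
  mem_nhdsWithin_of_mem_nhds ((h.smooth_curve t ht).continuousAt (frameNhd_mem_nhds hm))

/-- The derivative of a curve of vectors along `γ`, not necessarily the values of a section, after
transport to the fibre over `γ s`. -/
theorem IsInfinitesimalFlow.hasDerivWithinAt_curve (hψ : A.IsInfinitesimalFlow ξ γ ψ)
    (h : A.IsAnchoredCurve ξ γ) {s t : ℝ} (hs : s ∈ Icc (0 : ℝ) 1) (ht : t ∈ Icc (0 : ℝ) 1)
    (l : V (γ s) →L[ℝ] G) {m : M} (hm : γ t ∈ frameNhd E F V m) {v : ∀ u, V (γ u)} {v' : F}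
    (hv : HasDerivWithinAt (fun u => coord F V m (γ u) (v u)) v' (Icc 0 1) t) :
    HasDerivWithinAt (fun u => l (ψ s u (v u))) (l (ψ s t (uncoord F V m (γ t)
      (v' + A.bracketOperator ξ γ m t (coord F V m (γ t) (v t)))))) (Icc 0 1) t := by
  obtain ⟨ι, _, b, c, hbc, hfr⟩ := exists_frame_expansion E F (V := V) m
  have h1 : ∀ i, HasDerivWithinAt
      (fun u => c i (coord F V m (γ u) (v u)) • l (ψ s u (frame E F V m (b i) (γ u))))
      (c i (coord F V m (γ t) (v t)) • l (ψ s t (A.bracket (ξ t) (frame E F V m (b i)) (γ t))) +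
        c i v' • l (ψ s t (frame E F V m (b i) (γ t)))) (Icc 0 1) t := fun i =>
    ((c i).hasFDerivAt.comp_hasDerivWithinAt t hv).smul
      (hψ.hasDerivWithinAt_section hs ht l (frame E F V m (b i)))
  have hsum : ∀ u, γ u ∈ frameNhd E F V m → l (ψ s u (v u)) =
      ∑ i, c i (coord F V m (γ u) (v u)) • l (ψ s u (frame E F V m (b i) (γ u))) := by
    intro u hu
    conv_lhs => rw [hfr _ hu (v u)]
    simp only [map_sum, map_smul]
  have h2 := (HasDerivWithinAt.fun_sum (u := Finset.univ) fun i _ => h1 i).congr_of_eventuallyEq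
    ((h.eventually_mem ht hm).mono fun u hu => hsum u hu) (hsum t hm)
  refine h2.congr_deriv ?_
  have h3 : uncoord F V m (γ t) v' = ∑ i, c i v' • frame E F V m (b i) (γ t) := by
    have := hfr _ hm (uncoord F V m (γ t) v')
    rwa [coord_uncoord (mem_baseSet hm)] at this
  have h4 : ∀ w, uncoord F V m (γ t) (A.bracketOperator ξ γ m t w) =
      ∑ i, c i w • A.bracket (ξ t) (frame E F V m (b i)) (γ t) := by
    intro w
    conv_lhs => rw [← hbc w]
    simp only [map_sum, map_smul, bracketOperator_apply, uncoord_coord (mem_baseSet hm)]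
  rw [map_add, map_add, map_add, h3, h4, Finset.sum_add_distrib, add_comm]
  simp only [map_sum, map_smul]

theorem IsInfinitesimalFlow.continuousWithinAt_curve (hψ : A.IsInfinitesimalFlow ξ γ ψ)
    (h : A.IsAnchoredCurve ξ γ) {s t : ℝ} (hs : s ∈ Icc (0 : ℝ) 1) (ht : t ∈ Icc (0 : ℝ) 1)
    (l : V (γ s) →L[ℝ] G) {m : M} (hm : γ t ∈ frameNhd E F V m) {v : ∀ u, V (γ u)}
    (hv : ContinuousWithinAt (fun u => coord F V m (γ u) (v u)) (Icc 0 1) t) :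
    ContinuousWithinAt (fun u => l (ψ s u (v u))) (Icc 0 1) t := by
  obtain ⟨ι, _, b, c, hbc, hfr⟩ := exists_frame_expansion E F (V := V) m
  have hsum : ∀ u, γ u ∈ frameNhd E F V m → l (ψ s u (v u)) =
      ∑ i, c i (coord F V m (γ u) (v u)) • l (ψ s u (frame E F V m (b i) (γ u))) := by
    intro u hu
    conv_lhs => rw [hfr _ hu (v u)]
    simp only [map_sum, map_smul]
  have h1 : ContinuousWithinAt (fun u => ∑ i, c i (coord F V m (γ u) (v u)) •
      l (ψ s u (frame E F V m (b i) (γ u)))) (Icc 0 1) t :=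
    tendsto_finsetSum _ fun i _ => ((c i).continuous.continuousAt.comp_continuousWithinAt hv).smul
      (hψ.hasDerivWithinAt_section hs ht l (frame E F V m (b i))).continuousWithinAt
  exact h1.congr_of_eventuallyEq ((h.eventually_mem ht hm).mono fun u hu => hsum u hu) (hsum t hm)

/-- On the kernel of the anchor the bracket with `ξ` is given by the structure functions. -/
theorem bracketOperator_of_anchor_eq_zero {m : M} {t : ℝ} (hm : γ t ∈ frameNhd E F V m) {v : F}
    (hv : A.anchor (γ t) (frame E F V m v (γ t)) = 0) :
    A.bracketOperator ξ γ m t v = A.structureMap m (γ t) (coord F V m (γ t) (ξ t (γ t))) v := by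
  rw [A.bracketOperator_eq hm, hv, map_zero, neg_zero, zero_add]

variable {D : A.AConnection}

/-- A time dependent section which extends a geodesic on `(0, 1)` does so on `[0, 1]`, and the
base curve of the geodesic is an integral curve of it. -/
theorem isAnchoredCurve_geodesic {a : TotalSpace F V} (ha : 1 ∈ geodesicDomain D a) {J : Set ℝ}
    (hξ : IsTimeDependentSection E F V J ξ) (hJ : Icc 0 1 ⊆ J)
    (hξa : ∀ t ∈ Ioo (0 : ℝ) 1, ξ t (geodesic D a t).proj = (geodesic D a t).2) :
    A.IsAnchoredCurve ξ (fun t => (geodesic D a t).proj) ∧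
      ∀ t ∈ Icc (0 : ℝ) 1, ξ t (geodesic D a t).proj = (geodesic D a t).2 := by
  obtain ⟨J', hJ', hJc, h0, h1, hg, -⟩ := exists_isGeodesicThrough_geodesic ha
  have hIJ : ∀ t ∈ Icc (0 : ℝ) 1, t ∈ J' := fun t ht => hJc.out h0 h1 ht
  have hsec : ∀ t ∈ Icc (0 : ℝ) 1, ContMDiffAt (𝓘(ℝ, ℝ).prod 𝓘(ℝ, E))
      (𝓘(ℝ, E).prod 𝓘(ℝ, F)) ∞ (fun p : ℝ × M => TotalSpace.mk' F p.2 (ξ p.1 p.2))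
      (t, (geodesic D a t).proj) := fun t ht =>
    hξ.2.2.contMDiffAt ((hξ.1.prod isOpen_univ).mem_nhds ⟨hJ ht, mem_univ _⟩)
  have hcur : ∀ t ∈ Icc (0 : ℝ) 1, ContMDiffAt 𝓘(ℝ, ℝ) 𝓘(ℝ, E) ∞
      (fun t => (geodesic D a t).proj) t := fun t ht =>
    (hg.contMDiffAt_coord hJ' (hIJ t ht) (mem_frameNhd_self (E := E) (F := F) (V := V) _)).1
  have heq : ∀ t ∈ Icc (0 : ℝ) 1, ξ t (geodesic D a t).proj = (geodesic D a t).2 := by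
    intro t ht
    have hm : (geodesic D a t).proj ∈ frameNhd E F V (geodesic D a t).proj := mem_frameNhd_self _
    set m := (geodesic D a t).proj
    apply coord_injective (mem_baseSet hm)
    have c1 : ContinuousAt (fun p : ℝ × M => coord F V m p.2 (ξ p.1 p.2))
        (t, (geodesic D a t).proj) :=
      ((contMDiffAt_iff_coord (m := m) (p := (t, (geodesic D a t).proj))
        (u := fun p : ℝ × M => TotalSpace.mk' F p.2 (ξ p.1 p.2)) (mem_baseSet hm)).1
        (hsec t ht)).2.continuousAt
    have c2 : ContinuousAt (fun t => coord F V m (geodesic D a t).proj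
        (ξ t (geodesic D a t).proj)) t :=
      ContinuousAt.comp (f := fun t => (t, (geodesic D a t).proj)) c1
        (continuousAt_id.prodMk (hcur t ht).continuousAt)
    have c3 := (hg.contMDiffAt_coord hJ' (hIJ t ht) hm).2.continuousAt
    have hne : (𝓝[Ioo 0 1] t).NeBot := by
      rw [← mem_closure_iff_nhdsWithin_neBot, closure_Ioo (zero_ne_one)]
      exact ht
    refine tendsto_nhds_unique (c2.tendsto.mono_left (nhdsWithin_le_nhds (s := Ioo 0 1)))
      ((c3.tendsto.mono_left (nhdsWithin_le_nhds (s := Ioo 0 1))).congr' ?_)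
    filter_upwards [self_mem_nhdsWithin] with u hu
    rw [hξa u hu]
  exact ⟨⟨hsec, hcur, fun t ht => by rw [heq t ht]; exact (hg.isAPath t (hIJ t ht)).symm⟩, heq⟩

end PreLieAlgebroid

/-! ### The Maurer-Cartan form along rays -/

namespace PreLieAlgebroid

variable {A : PreLieAlgebroid E F V} {D : A.AConnection}

variable (A) in
/-- The Jacobiator at `y`, of vectors given by their coordinates in the local frame at `m`. Unlike
for `jac`, the type of the arguments and of the value does not depend on `y`. -/
def jacCoord (m y : M) (u v w : F) : F :=
  coord F V m y (A.jacobiator (frame E F V m u) (frame E F V m v) (frame E F V m w) y)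

namespace IsRadialForm

variable {nabla : CovariantDerivative 𝓘(ℝ, E) F V} {φ : OneForm D} {A₀ : Set (TotalSpace F V)}

theorem zero_mem (hφ : IsRadialForm nabla φ A₀) {x : M} {p : F} (hp : p ∈ fibreDomain A₀ x) :
    (0 : F) ∈ fibreDomain A₀ x := by
  simpa using hφ.smul_mem hp (t := 0) (by simp)

theorem zero_mem_formDomain (hφ : IsRadialForm nabla φ A₀) {x : M} {p : F}
    (hp : p ∈ fibreDomain A₀ x) : (0 : F) ∈ formDomain D A₀ x x :=
  ⟨hφ.zero_mem hp, by rw [hφ.fibreTarget_zero hp]; exact mem_frameNhd_self x⟩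

/-- The fibre of the domain contains a nonzero multiple of every vector. -/
theorem exists_smul_mem (hφ : IsRadialForm nabla φ A₀) {x : M} {p : F}
    (hp : p ∈ fibreDomain A₀ x) (q : F) : ∃ ε : ℝ, ε ≠ 0 ∧ ε • q ∈ fibreDomain A₀ x := by
  have h1 : ∀ᶠ ε : ℝ in 𝓝 0, ε • q ∈ fibreDomain A₀ x :=
    continuousAt_smul 0 ((isOpen_fibreDomain hφ.isOpen x).mem_nhds (by
      simpa only [zero_smul] using hφ.zero_mem hp))
  have h2 : ∀ᶠ ε : ℝ in 𝓝[≠] 0, ε ≠ 0 ∧ ε • q ∈ fibreDomain A₀ x := by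
    filter_upwards [h1.filter_mono nhdsWithin_le_nhds, self_mem_nhdsWithin] with ε h h'
    exact ⟨h', h⟩
  exact h2.exists

/-- At the zero section `φ` is the identity. -/
theorem formCoord_zero (hφ : IsRadialForm nabla φ A₀) {x : M} {p : F} (hp : p ∈ fibreDomain A₀ x)
    (q : F) : formCoord φ x x 0 q = q := by
  obtain ⟨ε, hε, hq⟩ := hφ.exists_smul_mem hp q
  have h1 := hφ.form_radial hq (t := 0) (by simp)
  obtain ⟨J, -, -, -, -, -, hga⟩ := exists_isGeodesicThrough_geodesic (hφ.dom _ hq)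
  rw [hga, zero_smul] at h1
  have h2 : formCoord φ x x 0 (ε • q) = coord F V x x (uncoord F V x x (ε • q)) :=
    congrArg (fun u : TotalSpace F V => coord F V x u.proj u.2) h1
  rw [coord_uncoord (mem_baseSet_self x), map_smul] at h2
  exact smul_right_injective F hε h2

theorem jacForm_zero (hφ : IsRadialForm nabla φ A₀) {x : M} {p : F} (hp : p ∈ fibreDomain A₀ x)
    (q r s : F) : jacForm (structureAlong D x x) (formCoord φ x x) 0 q r s =
      coord F V x x (A.jac (uncoord F V x x q) (uncoord F V x x r) (uncoord F V x x s)) := by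
  have h0 := hφ.zero_mem_formDomain hp
  have h1 : ∀ u v w : V (fibreTarget D x 0), coord F V x (fibreTarget D x 0) (A.jac u v w) =
      A.jacCoord x (fibreTarget D x 0) (coord F V x _ u) (coord F V x _ v) (coord F V x _ w) :=
    fun u v w => A.coord_jac h0.2 u v w
  rw [← coord_jac_form hφ.isOpen hφ.smooth hφ.anchored h0 q r s]
  refine (h1 _ _ _).trans ?_
  rw [A.coord_jac (mem_frameNhd_self x)]
  change A.jacCoord x (fibreTarget D x 0) (formCoord φ x x 0 q) (formCoord φ x x 0 r)
    (formCoord φ x x 0 s) = _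
  rw [hφ.formCoord_zero hp, hφ.formCoord_zero hp, hφ.formCoord_zero hp, hφ.fibreTarget_zero hp,
    coord_uncoord (mem_baseSet_self x), coord_uncoord (mem_baseSet_self x),
    coord_uncoord (mem_baseSet_self x)]
  rfl

/-- The equation for the Maurer-Cartan form along a ray becomes regular after multiplication
with `t²`. -/
theorem hasDerivAt_sq_smul_mcForm (hφ : IsRadialForm nabla φ A₀) {m x : M} {p : F} {t : ℝ}
    (hp : t • p ∈ formDomain D A₀ m x) (q r : F) :
    HasDerivAt (fun t : ℝ => t ^ 2 • mcForm (structureAlong D m x) (formCoord φ m x) (t • p) q r)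
      (- structureAlong D m x (t • p) (formCoord φ m x (t • p) p)
          (t ^ 2 • mcForm (structureAlong D m x) (formCoord φ m x) (t • p) q r) -
        t ^ 2 • jacForm (structureAlong D m x) (formCoord φ m x) (t • p) p q r) t := by
  obtain ⟨k', hk', h⟩ := hφ.hasDerivAt_mcForm_ray hp q r
  have h1 := (hasDerivAt_pow 2 t).smul hk'
  refine h1.congr_deriv ?_
  have h2 := congrArg (t • ·) h
  simp only [smul_add, smul_smul, neg_smul, smul_neg] at h2
  rw [map_smul]
  simp only [Nat.cast_ofNat, Nat.add_one_sub_one, pow_one]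
  linear_combination (norm := module) h2

/-- If the Jacobiator vanishes, then so does the Maurer-Cartan form: `t²` times it solves a
homogeneous linear equation in every local frame, so that the set of `t` at which it vanishes is
open and closed in `[0, 1]`, and it contains `0`. -/
theorem maurerCartan_eq_zero (hφ : IsRadialForm nabla φ A₀)
    (hJac : ∀ α β γ : Section E F V, A.jacobiator α β γ = 0) {x : M} {p : F}
    (hp : p ∈ fibreDomain A₀ x) (q r : F) :
    maurerCartan nabla φ (uncoord F V x x p) (uncoord F V x x q) (uncoord F V x x r) = 0 := by
  have hj : ∀ (m : M) (p' : F), p' ∈ formDomain D A₀ m x →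
      jacForm (structureAlong D m x) (formCoord φ m x) p' p q r = 0 := by
    intro m p' hp'
    have hj0 : ∀ u v w : V (fibreTarget D x p'), A.jac u v w = 0 := fun u v w => by
      rw [jac, hJac]; rfl
    rw [← coord_jac_form hφ.isOpen hφ.smooth hφ.anchored hp']
    exact (congrArg _ (hj0 _ _ _)).trans (map_zero _)
  let P : ℝ → Prop := fun t => maurerCartan nabla φ (uncoord F V x x (t • p)) (uncoord F V x x q)
    (uncoord F V x x r) = 0
  have hP : ∀ (m : M) (t : ℝ), t • p ∈ formDomain D A₀ m x →
      (P t ↔ mcForm (structureAlong D m x) (formCoord φ m x) (t • p) q r = 0) := by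
    intro m t ht
    rw [← coord_maurerCartan hφ.isOpen hφ.smooth hφ.anchored nabla ht]
    exact (map_eq_zero_iff _ (coord_injective (mem_baseSet ht.2))).symm
  have h0 : P 0 := by
    have h0' : (0 : ℝ) • p ∈ formDomain D A₀ x x := by
      rw [zero_smul]; exact hφ.zero_mem_formDomain hp
    rw [hP x 0 h0', zero_smul]
    exact hφ.mcForm_zero hp q r
  suffices P 1 by
    change maurerCartan nabla φ (uncoord F V x x ((1 : ℝ) • p)) _ _ = 0 at this
    rwa [one_smul] at this
  refine (isPreconnected_Icc.induction₂ (fun a b => P a ↔ P b) ?_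
    (fun _ _ _ _ _ _ h h' => h.trans h') (fun _ _ _ _ h => h.symm)
    (show (0 : ℝ) ∈ Icc (0 : ℝ) 1 by simp) (show (1 : ℝ) ∈ Icc (0 : ℝ) 1 by simp)).1 h0
  intro t ht
  refine Filter.Eventually.filter_mono nhdsWithin_le_nhds ?_
  set m := fibreTarget D x (t • p)
  have htd : t • p ∈ formDomain D A₀ m x := ⟨hφ.smul_mem hp ht, mem_frameNhd_self _⟩
  set c := structureAlong D m x
  set Φ := formCoord φ m x
  have hev : ∀ᶠ s : ℝ in 𝓝 t, s • p ∈ formDomain D A₀ m x :=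
    continuousAt_smul t ((isOpen_formDomain hφ.isOpen hφ.smooth m x).mem_nhds htd)
  set K : ℝ → F := fun s => s ^ 2 • mcForm c Φ (s • p) q r
  have hK : ∀ s : ℝ, s • p ∈ formDomain D A₀ m x →
      HasDerivAt K (- c (s • p) (Φ (s • p) p) (K s)) s := fun s hs => by
    have := hφ.hasDerivAt_sq_smul_mcForm hs q r
    rwa [hj m _ hs, smul_zero, sub_zero] at this
  have hPK : ∀ s : ℝ, s • p ∈ formDomain D A₀ m x → (P s ↔ K s = 0) := by
    intro s hs
    -- the factor `s²` is harmless, since the Maurer-Cartan form is known to vanish at `s = 0`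
    by_cases hs0 : s = 0
    · subst hs0
      simp [K, h0]
    · rw [hP m s hs]
      simp only [K]
      rw [smul_eq_zero_iff_right (pow_ne_zero 2 hs0)]
  have hc : ContinuousAt (fun s : ℝ => c (s • p) (Φ (s • p) p)) t :=
    (ContinuousAt.comp (f := fun s : ℝ => s • p)
      (contDiffAt_structureAlong hφ.isOpen hφ.smooth htd).continuousAt (continuousAt_smul t)).clm_apply
    ((ContinuousAt.comp (f := fun s : ℝ => s • p)
      (contDiffAt_formCoord hφ.isOpen hφ.smooth htd).continuousAt (continuousAt_smul t)).clm_apply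
      continuousAt_const)
  by_cases hKt : K t = 0
  · have hbd : ∀ᶠ s in 𝓝 t, ‖c (s • p) (Φ (s • p) p)‖₊ < ‖c (t • p) (Φ (t • p) p)‖₊ + 1 :=
      hc.nnnorm.eventually_lt_const (lt_add_one _)
    have hun := ODE_solution_unique_of_eventually (f := K) (g := fun _ => 0)
      (v := fun s y => - c (s • p) (Φ (s • p) p) y) (s := fun _ => univ)
      (K := ‖c (t • p) (Φ (t • p) p)‖₊ + 1) (t₀ := t) (hbd.mono fun s hs =>
        (((c (s • p) (Φ (s • p) p)).lipschitz.neg).weaken hs.le).lipschitzOnWith)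
      (hev.mono fun s hs => ⟨hK s hs, mem_univ _⟩)
      (Filter.Eventually.of_forall fun s => ⟨by simpa using hasDerivAt_const s (0 : F), mem_univ _⟩)
      hKt
    filter_upwards [hun, hev] with s h1 h2
    exact ⟨fun _ => (hPK s h2).2 h1, fun _ => (hPK t htd).2 hKt⟩
  · filter_upwards [(hK t htd).continuousAt.eventually_ne hKt, hev] with s h1 h2
    rw [hPK s h2, hPK t htd]
    simp [h1, hKt]

/-- If the Maurer-Cartan form vanishes, then so does the Jacobiator, which is a multiple of the
derivative of the Maurer-Cartan form at the zero section. -/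
theorem jac_eq_zero (hφ : IsRadialForm nabla φ A₀)
    (hMC : ∀ (x : M) (a b c : V x), (⟨x, a⟩ : TotalSpace F V) ∈ A₀ → maurerCartan nabla φ a b c = 0)
    {x : M} {p : F} (hp : p ∈ fibreDomain A₀ x) (q r : F) :
    A.jac (uncoord F V x x p) (uncoord F V x x q) (uncoord F V x x r) = 0 := by
  obtain ⟨k', hk', h⟩ := hφ.hasDerivAt_mcForm_ray_zero hp q r
  have hev : ∀ᶠ s : ℝ in 𝓝 0, s • p ∈ formDomain D A₀ x x :=
    continuousAt_smul 0 ((isOpen_formDomain hφ.isOpen hφ.smooth x x).mem_nhds (by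
      simpa only [zero_smul] using hφ.zero_mem_formDomain hp))
  have h0 : HasDerivAt (fun t : ℝ => mcForm (structureAlong D x x) (formCoord φ x x) (t • p) q r)
      0 0 := by
    refine (hasDerivAt_const (0 : ℝ) (0 : F)).congr_of_eventuallyEq ?_
    filter_upwards [hev] with s hs
    rw [← coord_maurerCartan hφ.isOpen hφ.smooth hφ.anchored nabla hs]
    exact (congrArg _ (hMC _ _ _ _ hs.1)).trans (map_zero _)
  rw [hk'.unique h0, smul_zero, hφ.jacForm_zero hp] at h
  exact (map_eq_zero_iff _ (coord_injective (mem_baseSet_self x))).1 h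

theorem maurerCartan_eq_zero_iff (hφ : IsRadialForm nabla φ A₀)
    (hzero : ∀ x : M, (⟨x, 0⟩ : TotalSpace F V) ∈ A₀) :
    (∀ (x : M) (a b c : V x), (⟨x, a⟩ : TotalSpace F V) ∈ A₀ → maurerCartan nabla φ a b c = 0) ↔
      ∀ α β γ : Section E F V, A.jacobiator α β γ = 0 := by
  have hsurj : ∀ (x : M) (a : V x), ∃ p, uncoord F V x x p = a := fun x a =>
    ⟨_, uncoord_coord (mem_baseSet_self x) a⟩
  refine ⟨fun h α β γ => ?_, fun h x a b c ha => ?_⟩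
  · ext x
    rw [← A.jac_eq]
    obtain ⟨p, hp⟩ := hsurj x (α x)
    obtain ⟨q, hq⟩ := hsurj x (β x)
    obtain ⟨r, hr⟩ := hsurj x (γ x)
    rw [← hp, ← hq, ← hr]
    have h0 : (0 : F) ∈ fibreDomain A₀ x := by
      change (⟨x, uncoord F V x x 0⟩ : TotalSpace F V) ∈ A₀
      rw [map_zero]; exact hzero x
    -- `p` need not lie in the domain, but a nonzero multiple of it does
    obtain ⟨ε, hε, hp'⟩ := hφ.exists_smul_mem h0 p
    have h1 := congrArg (coord F V x x) (hφ.jac_eq_zero h hp' q r)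
    apply coord_injective (F := F) (mem_baseSet_self x)
    have hx := mem_frameNhd_self (E := E) (F := F) (V := V) x
    have h2 : ∀ p q r, coord F V x x (A.jac (uncoord F V x x p) (uncoord F V x x q)
        (uncoord F V x x r)) = coord F V x x (A.jacobiator (frame E F V x p) (frame E F V x q)
          (frame E F V x r) x) := fun p q r => by
      rw [A.coord_jac hx, coord_uncoord (mem_baseSet_self x), coord_uncoord (mem_baseSet_self x),
        coord_uncoord (mem_baseSet_self x)]
    rw [h2, map_smul] at h1
    rw [h2]
    have h3 : A.jacobiator (ε • frame E F V x p) (frame E F V x q) (frame E F V x r) =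
        ε • A.jacobiator (frame E F V x p) (frame E F V x q) (frame E F V x r) := by
      rw [jacobiator_cyclic, ← jacobiatorLeft_apply, map_smul, jacobiatorLeft_apply,
        jacobiator_cyclic A (frame E F V x p)]
    rw [h3] at h1
    have h4 : ε • coord F V x x (A.jacobiator (frame E F V x p) (frame E F V x q)
          (frame E F V x r) x) = 0 := by
      rw [← map_smul]; exact h1.trans (map_zero _)
    exact ((smul_eq_zero_iff_right hε).1 h4).trans (map_zero _).symm
  · obtain ⟨p, rfl⟩ := hsurj x a
    obtain ⟨q, rfl⟩ := hsurj x b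
    obtain ⟨r, rfl⟩ := hsurj x c
    exact hφ.maurerCartan_eq_zero h ha q r

end IsRadialForm

end PreLieAlgebroid

/-! ### The Maurer-Cartan form as an integral of the Jacobiator -/

namespace PreLieAlgebroid

variable {A : PreLieAlgebroid E F V} {D : A.AConnection}

namespace IsRadialForm

variable {nabla : CovariantDerivative 𝓘(ℝ, E) F V} {φ : OneForm D} {A₀ : Set (TotalSpace F V)}
  {ξ : ℝ → Section E F V}

theorem coord_fiberCast_maurerCartan (hφ : IsRadialForm nabla φ A₀) {m x : M} {p : F}
    (hp : p ∈ fibreDomain A₀ x) {t : ℝ} (ht : t ∈ Icc (0 : ℝ) 1)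
    (hm : (geodesic D (fibrePt F V x p) t).proj ∈ frameNhd E F V m) (q r : F) :
    coord F V m (geodesic D (fibrePt F V x p) t).proj (fiberCast
      (maurerCartan nabla φ (t • uncoord F V x x p) (uncoord F V x x q) (uncoord F V x x r)) :
        V (geodesic D (fibrePt F V x p) t).proj) =
      mcForm (structureAlong D m x) (formCoord φ m x) (t • p) q r := by
  rw [← map_smul]
  refine (coord_fiberCast (hφ.fibreTarget_smul hp ht) _).trans ?_
  exact coord_maurerCartan hφ.isOpen hφ.smooth hφ.anchored nabla
    (hφ.smul_mem_formDomain hp ht hm) q r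

variable (φ) in
/-- The vector `t² Jac(φ_{ta}(a), φ_{ta}(b), φ_{ta}(c))` in the fibre over `γ_a(t)`, where `p`,
`q`, `r` are the coordinates of `a`, `b`, `c`. -/
def rayJac (x : M) (p q r : F) (t : ℝ) : V (geodesic D (fibrePt F V x p) t).proj :=
  t ^ 2 • fiberCast (A.jac (φ (fibrePt F V x (t • p)) (uncoord F V x x p))
    (φ (fibrePt F V x (t • p)) (uncoord F V x x q)) (φ (fibrePt F V x (t • p)) (uncoord F V x x r)))

theorem coord_rayJac (hφ : IsRadialForm nabla φ A₀) {m x : M} {p : F}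
    (hp : p ∈ fibreDomain A₀ x) {t : ℝ} (ht : t ∈ Icc (0 : ℝ) 1)
    (hm : (geodesic D (fibrePt F V x p) t).proj ∈ frameNhd E F V m) (q r : F) :
    coord F V m (geodesic D (fibrePt F V x p) t).proj (rayJac φ x p q r t) =
      t ^ 2 • jacForm (structureAlong D m x) (formCoord φ m x) (t • p) p q r := by
  rw [rayJac, map_smul]
  refine congrArg (t ^ 2 • ·) ((coord_fiberCast (hφ.fibreTarget_smul hp ht) _).trans ?_)
  exact coord_jac_form hφ.isOpen hφ.smooth hφ.anchored (hφ.smul_mem_formDomain hp ht hm) p q r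

/-- The integrand of the integral formula is `rayJac`, because `φ_{ta}(ta) = exp(ta)`. -/
theorem fiberCast_jac_eq (hφ : IsRadialForm nabla φ A₀) {x : M} {p : F}
    (hp : p ∈ fibreDomain A₀ x) {t : ℝ} (ht : t ∈ Ioc (0 : ℝ) 1) (q r : F) :
    (fiberCast (A.jac (t⁻¹ • (exp D ⟨x, t • uncoord F V x x p⟩).2)
        (φ ⟨x, t • uncoord F V x x p⟩ (t • uncoord F V x x q))
        (φ ⟨x, t • uncoord F V x x p⟩ (t • uncoord F V x x r))) :
        V (geodesic D (fibrePt F V x p) t).proj) = rayJac φ x p q r t := by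
  have ht' : t ∈ Icc (0 : ℝ) 1 := ⟨ht.1.le, ht.2⟩
  have hm := mem_frameNhd_self (E := E) (F := F) (V := V) (geodesic D (fibrePt F V x p) t).proj
  have hd := hφ.smul_mem_formDomain hp ht' hm
  have h1 : t⁻¹ • (exp D ⟨x, t • uncoord F V x x p⟩).2 =
      φ ⟨x, t • uncoord F V x x p⟩ (uncoord F V x x p) := by
    rw [← hφ.exp_eq _ (hφ.star x _ hp t ht')]
    refine (congrArg (t⁻¹ • ·) (map_smul (φ ⟨x, t • uncoord F V x x p⟩) t
      (uncoord F V x x p))).trans ?_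
    simp only
    rw [smul_smul, inv_mul_cancel₀ ht.1.ne', one_smul]
  apply coord_injective (F := F) (mem_baseSet hm)
  rw [hφ.coord_rayJac hp ht' hm, h1, ← map_smul (uncoord F V x x) t p,
    ← map_smul (uncoord F V x x) t q, ← map_smul (uncoord F V x x) t r, ← jacForm_smul_right]
  refine (coord_fiberCast (hφ.fibreTarget_smul hp ht') _).trans ?_
  exact coord_jac_form hφ.isOpen hφ.smooth hφ.anchored hd p (t • q) (t • r)

/-- The derivative of the curve `t ↦ t² MC_{ta}(b, c)`, transported by the infinitesimal flow to
the fixed fibre over `γ_a(s)`: the zeroth order term of the equation along the ray is cancelled by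
the generator of the flow. -/
theorem hasDerivWithinAt_flow_sq_smul (hφ : IsRadialForm nabla φ A₀) {x : M} {p : F}
    (hp : p ∈ fibreDomain A₀ x)
    (h : A.IsAnchoredCurve ξ (fun t => (geodesic D (fibrePt F V x p) t).proj))
    (hξ : ∀ t ∈ Icc (0 : ℝ) 1, ξ t (geodesic D (fibrePt F V x p) t).proj =
      (geodesic D (fibrePt F V x p) t).2)
    {ψ : ∀ t s : ℝ, V (geodesic D (fibrePt F V x p) s).proj →ₗ[ℝ]
      V (geodesic D (fibrePt F V x p) t).proj}
    (hψ : A.IsInfinitesimalFlow ξ (fun t => (geodesic D (fibrePt F V x p) t).proj) ψ)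
    {s t : ℝ} (hs : s ∈ Icc (0 : ℝ) 1) (ht : t ∈ Icc (0 : ℝ) 1)
    (l : V (geodesic D (fibrePt F V x p) s).proj →L[ℝ] ℝ) (q r : F) :
    HasDerivWithinAt (fun u => l (ψ s u (u ^ 2 • fiberCast
      (maurerCartan nabla φ (u • uncoord F V x x p) (uncoord F V x x q) (uncoord F V x x r)))))
      (- l (ψ s t (rayJac φ x p q r t))) (Icc 0 1) t := by
  have hm := mem_frameNhd_self (E := E) (F := F) (V := V) (geodesic D (fibrePt F V x p) t).proj
  set m := (geodesic D (fibrePt F V x p) t).proj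
  have hd := hφ.smul_mem_formDomain hp ht hm
  have hcoord : ∀ u ∈ Icc (0 : ℝ) 1, (geodesic D (fibrePt F V x p) u).proj ∈ frameNhd E F V m →
      coord F V m (geodesic D (fibrePt F V x p) u).proj (u ^ 2 • fiberCast
      (maurerCartan nabla φ (u • uncoord F V x x p) (uncoord F V x x q) (uncoord F V x x r))) =
      u ^ 2 • mcForm (structureAlong D m x) (formCoord φ m x) (u • p) q r := fun u hu hum => by
    rw [map_smul, hφ.coord_fiberCast_maurerCartan hp hu hum]
  have h1 := hφ.hasDerivAt_sq_smul_mcForm hd q r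
  have h2 : HasDerivWithinAt (fun u => coord F V m (geodesic D (fibrePt F V x p) u).proj
      (u ^ 2 • fiberCast (maurerCartan nabla φ (u • uncoord F V x x p) (uncoord F V x x q)
        (uncoord F V x x r)))) _ (Icc 0 1) t :=
    h1.hasDerivWithinAt.congr_of_eventuallyEq (by
      filter_upwards [h.eventually_mem ht hm, self_mem_nhdsWithin] with u hu hu'
      exact hcoord u hu' hu) (hcoord t ht hm)
  have h3 := hψ.hasDerivWithinAt_curve h hs ht l hm h2
  refine h3.congr_deriv ?_
  simp only [hcoord t ht hm]
  -- the Maurer-Cartan form takes values in the kernel of the anchor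
  have hker : A.anchor (geodesic D (fibrePt F V x p) t).proj (frame E F V m
      (t ^ 2 • mcForm (structureAlong D m x) (formCoord φ m x) (t • p) q r)
      (geodesic D (fibrePt F V x p) t).proj) = 0 := by
    have h4 : A.anchor (fibreTarget D x (t • p)) (frame E F V m
      (t ^ 2 • mcForm (structureAlong D m x) (formCoord φ m x) (t • p) q r)
      (fibreTarget D x (t • p))) = 0 := by
      have h5 := anchor_maurerCartan hφ.isOpen hφ.smooth hφ.anchored nabla hd.1 q r
      rw [← coord_maurerCartan hφ.isOpen hφ.smooth hφ.anchored nabla hd q r]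
      have h6 : ∀ w : V (fibreTarget D x (t • p)), frame E F V m
          (t ^ 2 • coord F V m (fibreTarget D x (t • p)) w) (fibreTarget D x (t • p)) =
          t ^ 2 • w := fun w => by rw [← map_smul, frame_coord hd.2]
      refine (congrArg (A.anchor _) (h6 _)).trans ?_
      refine (map_smul (A.anchor _) _ _).trans ?_
      exact (congrArg (t ^ 2 • ·) h5).trans (smul_zero _)
    rwa [hφ.fibreTarget_smul hp ht] at h4
  have hvel : coord F V m (geodesic D (fibrePt F V x p) t).proj
      (ξ t (geodesic D (fibrePt F V x p) t).proj) = formCoord φ m x (t • p) p := by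
    rw [hξ t ht]
    exact (congrArg (fun u : TotalSpace F V => coord F V m u.proj u.2) (hφ.form_radial hp ht)).symm
  have hC : A.structureMap m (geodesic D (fibrePt F V x p) t).proj = structureAlong D m x (t • p) := by
    rw [structureAlong, hφ.fibreTarget_smul hp ht]
  have hB := bracketOperator_of_anchor_eq_zero (ξ := ξ)
    (γ := fun t => (geodesic D (fibrePt F V x p) t).proj) hm hker
  rw [hB, hvel, hC, ← uncoord_coord (mem_baseSet hm) (rayJac φ x p q r t),
    hφ.coord_rayJac hp ht hm, ← map_neg l, ← map_neg (ψ s t)]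
  refine congrArg (fun w => l (ψ s t w)) ?_
  refine (congrArg (uncoord F V m _) ?_).trans (map_neg (uncoord F V m _) _)
  abel

/-- The transported Maurer-Cartan form has a right derivative at time zero, which determines the
Jacobiator. Since the Maurer-Cartan form vanishes at time zero, the flow does not contribute. -/
theorem exists_hasDerivWithinAt_zero (hφ : IsRadialForm nabla φ A₀) {x : M} {p : F}
    (hp : p ∈ fibreDomain A₀ x)
    (h : A.IsAnchoredCurve ξ (fun t => (geodesic D (fibrePt F V x p) t).proj))
    {ψ : ∀ t s : ℝ, V (geodesic D (fibrePt F V x p) s).proj →ₗ[ℝ]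
      V (geodesic D (fibrePt F V x p) t).proj}
    (hψ : A.IsInfinitesimalFlow ξ (fun t => (geodesic D (fibrePt F V x p) t).proj) ψ) (q r : F) :
    ∃ d : V x, HasDerivWithinAt (fun t : ℝ => (fiberCast (ψ 0 t (fiberCast
      (maurerCartan nabla φ (t • uncoord F V x x p) (uncoord F V x x q) (uncoord F V x x r)))) : V x))
      d (Icc 0 1) 0 ∧
      A.jac (uncoord F V x x p) (uncoord F V x x q) (uncoord F V x x r) = (-3 : ℝ) • d := by
  have h0 : (0 : ℝ) ∈ Icc (0 : ℝ) 1 := by simp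
  obtain ⟨k', hk', hjac⟩ := hφ.hasDerivAt_mcForm_ray_zero hp q r
  obtain ⟨J, -, -, -, -, -, hga⟩ := exists_isGeodesicThrough_geodesic (hφ.dom _ hp)
  have hγ0 : (geodesic D (fibrePt F V x p) 0).proj = x := by rw [hga]; rfl
  have hm : (geodesic D (fibrePt F V x p) 0).proj ∈ frameNhd E F V x := by
    rw [hγ0]; exact mem_frameNhd_self x
  have h2 : HasDerivWithinAt (fun u => coord F V x (geodesic D (fibrePt F V x p) u).proj
      (fiberCast (maurerCartan nabla φ (u • uncoord F V x x p) (uncoord F V x x q)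
        (uncoord F V x x r)))) k' (Icc 0 1) 0 :=
    hk'.hasDerivWithinAt.congr_of_eventuallyEq (by
      filter_upwards [h.eventually_mem h0 hm, self_mem_nhdsWithin] with u hu hu'
      exact hφ.coord_fiberCast_maurerCartan hp hu' hu q r)
      (hφ.coord_fiberCast_maurerCartan hp h0 hm q r)
  have h3 := hψ.hasDerivWithinAt_curve h h0 h0
    (coord F V x (geodesic D (fibrePt F V x p) 0).proj) hm h2
  have h4 := hasDerivWithinAt_clm_comp (uncoord F V x x) h3
  have hfun : ∀ w : V (geodesic D (fibrePt F V x p) 0).proj, (fiberCast w : V x) =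
      uncoord F V x x (coord F V x (geodesic D (fibrePt F V x p) 0).proj w) := fun w => by
    rw [← coord_fiberCast hγ0, uncoord_coord (mem_baseSet_self x)]
  refine ⟨uncoord F V x x k', ?_, ?_⟩
  · simp only [hfun]
    have hval : coord F V x (geodesic D (fibrePt F V x p) 0).proj (ψ 0 0 (uncoord F V x
        (geodesic D (fibrePt F V x p) 0).proj (k' + A.bracketOperator ξ
          (fun t => (geodesic D (fibrePt F V x p) t).proj) x 0
          (coord F V x (geodesic D (fibrePt F V x p) 0).proj (fiberCast
            (maurerCartan nabla φ ((0 : ℝ) • uncoord F V x x p) (uncoord F V x x q)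
              (uncoord F V x x r))))))) = k' := by
      rw [hφ.coord_fiberCast_maurerCartan hp h0 hm, zero_smul, hφ.mcForm_zero hp, map_zero,
        add_zero, hψ.self 0 h0, LinearMap.id_apply, coord_uncoord (mem_baseSet hm)]
    rw [hval] at h4
    exact h4
  · apply coord_injective (F := F) (mem_baseSet_self x)
    rw [← hφ.jacForm_zero hp, hjac, map_smul, coord_uncoord (mem_baseSet_self x)]

/-- The fundamental theorem of calculus for the transported curve `t ↦ t² MC_{ta}(b, c)`. -/
theorem hasFiberIntegral_jac (hφ : IsRadialForm nabla φ A₀) {x : M} {p : F}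
    (hp : p ∈ fibreDomain A₀ x)
    (h : A.IsAnchoredCurve ξ (fun t => (geodesic D (fibrePt F V x p) t).proj))
    (hξ : ∀ t ∈ Icc (0 : ℝ) 1, ξ t (geodesic D (fibrePt F V x p) t).proj =
      (geodesic D (fibrePt F V x p) t).2)
    {ψ : ∀ t s : ℝ, V (geodesic D (fibrePt F V x p) s).proj →ₗ[ℝ]
      V (geodesic D (fibrePt F V x p) t).proj}
    (hψ : A.IsInfinitesimalFlow ξ (fun t => (geodesic D (fibrePt F V x p) t).proj) ψ) (q r : F) :
    HasFiberIntegral (fun t : ℝ => ψ 1 t (fiberCast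
      (A.jac (t⁻¹ • (exp D ⟨x, t • uncoord F V x x p⟩).2)
        (φ ⟨x, t • uncoord F V x x p⟩ (t • uncoord F V x x q))
        (φ ⟨x, t • uncoord F V x x p⟩ (t • uncoord F V x x r)))))
      (- maurerCartan nabla φ (uncoord F V x x p) (uncoord F V x x q) (uncoord F V x x r) :
        V (target D (fibrePt F V x p))) := by
  intro l
  have h1 : (1 : ℝ) ∈ Icc (0 : ℝ) 1 := by simp
  set f : ℝ → ℝ := fun u => l (ψ 1 u (u ^ 2 • fiberCast (maurerCartan nabla φ
    (u • uncoord F V x x p) (uncoord F V x x q) (uncoord F V x x r))))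
  set g : ℝ → ℝ := fun t => l (ψ 1 t (rayJac φ x p q r t))
  have hf : ∀ t ∈ Icc (0 : ℝ) 1, HasDerivWithinAt f (- g t) (Icc 0 1) t := fun t ht =>
    hφ.hasDerivWithinAt_flow_sq_smul hp h hξ hψ h1 ht l q r
  have hg : ContinuousOn g (Icc 0 1) := by
    intro t ht
    have hm := mem_frameNhd_self (E := E) (F := F) (V := V) (geodesic D (fibrePt F V x p) t).proj
    set m := (geodesic D (fibrePt F V x p) t).proj
    refine hψ.continuousWithinAt_curve h h1 ht l hm ?_
    have hc : ContinuousAt (fun u : ℝ => u ^ 2 • jacForm (structureAlong D m x) (formCoord φ m x)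
        (u • p) p q r) t :=
      (continuousAt_id.pow 2).smul (ContinuousAt.comp (f := fun u : ℝ => u • p)
        (continuousAt_jacForm hφ.isOpen hφ.smooth (hφ.smul_mem_formDomain hp ht hm) p q r)
        (continuousAt_smul t))
    refine hc.continuousWithinAt.congr_of_eventuallyEq ?_ (hφ.coord_rayJac hp ht hm q r)
    filter_upwards [h.eventually_mem ht hm, self_mem_nhdsWithin] with u hu hu'
    exact hφ.coord_rayJac hp hu' hu q r
  have hgi : IntervalIntegrable g volume 0 1 := by
    refine ContinuousOn.intervalIntegrable ?_
    rwa [uIcc_of_le zero_le_one]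
  have hcongr : EqOn g (fun t : ℝ => l (ψ 1 t (fiberCast
      (A.jac (t⁻¹ • (exp D ⟨x, t • uncoord F V x x p⟩).2)
        (φ ⟨x, t • uncoord F V x x p⟩ (t • uncoord F V x x q))
        (φ ⟨x, t • uncoord F V x x p⟩ (t • uncoord F V x x r)))))) (Ioc 0 1) := fun t ht =>
    (congrArg (fun w => l (ψ 1 t w)) (hφ.fiberCast_jac_eq hp ht q r)).symm
  have hint : ∫ t in (0 : ℝ)..1, - g t = f 1 - f 0 :=
    intervalIntegral.integral_eq_sub_of_hasDerivAt_of_le zero_le_one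
      (fun t ht => (hf t ht).continuousWithinAt)
      (fun t ht => (hf t (Ioo_subset_Icc_self ht)).hasDerivAt (Icc_mem_nhds ht.1 ht.2)) hgi.neg
  have hf0 : f 0 = 0 := by
    simp only [f]
    rw [zero_pow two_ne_zero, zero_smul, map_zero, map_zero]
  have hf1 : f 1 = l (maurerCartan nabla φ (uncoord F V x x p) (uncoord F V x x q)
      (uncoord F V x x r)) := by
    have hm := mem_frameNhd_self (E := E) (F := F) (V := V) (geodesic D (fibrePt F V x p) 1).proj
    have h2 : (fiberCast (maurerCartan nabla φ ((1 : ℝ) • uncoord F V x x p) (uncoord F V x x q)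
        (uncoord F V x x r)) : V (geodesic D (fibrePt F V x p) 1).proj) =
        maurerCartan nabla φ (uncoord F V x x p) (uncoord F V x x q) (uncoord F V x x r) := by
      apply coord_injective (F := F) (mem_baseSet hm)
      rw [hφ.coord_fiberCast_maurerCartan hp h1 hm, one_smul]
      exact (coord_maurerCartan hφ.isOpen hφ.smooth hφ.anchored nabla ⟨hp, hm⟩ q r).symm
    have h3 : ∀ w : V (geodesic D (fibrePt F V x p) 1).proj,
        l (ψ 1 1 ((1 : ℝ) ^ 2 • w)) = l w := fun w => by
      rw [one_pow, one_smul, hψ.self 1 h1]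
      rfl
    exact (h3 _).trans (congrArg l h2)
  rw [intervalIntegral.integral_neg, hf0, hf1, sub_zero] at hint
  have hcongr' := hcongr.mono Ioo_subset_Ioc_self
  refine ⟨hgi.congr_uIoo (by rwa [uIoo_of_le zero_le_one]), ?_⟩
  rw [← intervalIntegral.integral_congr_Ioo_of_le zero_le_one hcongr']
  exact (neg_eq_iff_eq_neg.1 hint).trans (map_neg l _).symm

end IsRadialForm

end PreLieAlgebroid

end PreLie

end

open PreLie PreLieAlgebroid in
theorem mainTheorem4
    {E : Type*} [NormedAddCommGroup E] [NormedSpace ℝ E] [FiniteDimensional ℝ E]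
    {F : Type*} [NormedAddCommGroup F] [NormedSpace ℝ F] [FiniteDimensional ℝ F]
    {M : Type*} [TopologicalSpace M] [T2Space M] [SigmaCompactSpace M]
    [ChartedSpace E M] [IsManifold 𝓘(ℝ, E) ∞ M]
    {V : M → Type*} [TopologicalSpace (TotalSpace F V)]
    [∀ x, AddCommGroup (V x)] [∀ x, Module ℝ (V x)] [∀ x, TopologicalSpace (V x)]
    [∀ x, IsTopologicalAddGroup (V x)] [∀ x, ContinuousSMul ℝ (V x)]
    [FiberBundle F V] [VectorBundle ℝ F V] [ContMDiffVectorBundle ∞ F V 𝓘(ℝ, E)]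
    (A : PreLieAlgebroid E F V) (D : A.AConnection)
    (nabla : CovariantDerivative 𝓘(ℝ, E) F V) [nabla.ContMDiffCovariantDerivative ∞]
    (A₀ : Set (TotalSpace F V)) (hopen : IsOpen A₀)
    (hzero : ∀ x : M, (⟨x, 0⟩ : TotalSpace F V) ∈ A₀)
    (hstar : ∀ (x : M) (a : V x), (⟨x, a⟩ : TotalSpace F V) ∈ A₀ →
      ∀ t ∈ Icc (0 : ℝ) 1, (⟨x, t • a⟩ : TotalSpace F V) ∈ A₀)
    (hdom : ∀ a ∈ A₀, (1 : ℝ) ∈ geodesicDomain D a)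
    (φ : OneForm D) (hsmooth : IsSmoothOneForm φ A₀)
    (hweak : ∀ (x : M) (a b : V x), (⟨x, a⟩ : TotalSpace F V) ∈ A₀ →
      maurerCartan nabla φ a a b = 0)
    (hanchored : IsAnchored φ A₀)
    (hexp : ∀ a ∈ A₀, φ a a.2 = (exp D a).2)
    (hiso : ∀ a ∈ A₀, Function.Bijective (φ a)) :
    ((∀ (x : M) (a b c : V x), (⟨x, a⟩ : TotalSpace F V) ∈ A₀ → maurerCartan nabla φ a b c = 0) ↔
      ∀ α β γ : Section E F V, A.jacobiator α β γ = 0) ∧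
    ∀ (x : M) (a b c : V x), (⟨x, a⟩ : TotalSpace F V) ∈ A₀ →
      ∀ (J : Set ℝ) (ξ : ℝ → Section E F V), IsTimeDependentSection E F V J ξ → Icc 0 1 ⊆ J →
      (∀ t ∈ Ioo (0 : ℝ) 1, ξ t (geodesic D ⟨x, a⟩ t).proj = (geodesic D ⟨x, a⟩ t).2) →
      (∃ d : V x,
        HasDerivWithinAt (fun t : ℝ => (fiberCast
          (A.infinitesimalFlow ξ (fun s => (geodesic D ⟨x, a⟩ s).proj) 0 t
            (fiberCast (maurerCartan nabla φ (t • a) b c))) : V x)) d (Icc 0 1) 0 ∧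
        A.jac a b c = (-3 : ℝ) • d) ∧
      ∃ w : V (target D ⟨x, a⟩),
        HasFiberIntegral (fun t : ℝ =>
          A.infinitesimalFlow ξ (fun s => (geodesic D ⟨x, a⟩ s).proj) 1 t
            (fiberCast (A.jac (t⁻¹ • (exp D ⟨x, t • a⟩).2)
              (φ ⟨x, t • a⟩ (t • b)) (φ ⟨x, t • a⟩ (t • c))))) w ∧
        maurerCartan nabla φ a b c = -w := by 
  have hφ : IsRadialForm nabla φ A₀ :=
    ⟨hopen, hstar, hdom, hsmooth, hweak, hanchored, hexp⟩
  refine ⟨hφ.maurerCartan_eq_zero_iff hzero, ?_⟩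
  intro x a b c ha J ξ hξ hJ hξa
  obtain ⟨h, hξ'⟩ := isAnchoredCurve_geodesic (hdom _ ha) hξ hJ hξa
  obtain ⟨p, rfl⟩ : ∃ p, uncoord F V x x p = a := ⟨_, uncoord_coord (mem_baseSet_self x) a⟩
  obtain ⟨q, rfl⟩ : ∃ q, uncoord F V x x q = b := ⟨_, uncoord_coord (mem_baseSet_self x) b⟩
  obtain ⟨r, rfl⟩ : ∃ r, uncoord F V x x r = c := ⟨_, uncoord_coord (mem_baseSet_self x) c⟩
  have hψ := h.isInfinitesimalFlow
  exact ⟨hφ.exists_hasDerivWithinAt_zero ha h hψ q r,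
    _, hφ.hasFiberIntegral_jac ha h hξ' hψ q r, (neg_neg _).symm⟩
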